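/- Let $p$ be a prime ($p=2$ allowed), let $R$ be a complete regular local ring of dimension $r$ with arbitrary (not necessarily perfect) residue field $k$ of characteristic $p$, and let $C$ be a $p$-ring with residue field $k$, i.e. a complete discrete valuation ring with maximal ideal $pC$. Put $\mathfrak S=C[[x_1,\ldots,x_r]]$. Choose a surjective ring homomorphism $\pi:\mathfrak S\to R$ that lifts the identity of $k$ and maps $x_1,\ldots,x_r$ to a regular system of parameters, a power series $E\in\mathfrak S$ with constant term $p$ such that $\ker\pi=E\mathfrak S$, and a ring endomorphism $\sigma:\mathfrak S\to\mathfrak S$ with $\sigma(a)\equiv a^p$ modulo $p\mathfrak S$ for all $a$, preserving the ideal $(x_1,\ldots,x_r)$. A frame $(S,I,S/I,\sigma,\sigma_1)$ consists of a ring $S$, an ideal $I$, a ring endomorphism $\sigma$ of $S$ and a $\sigma$-linear map $\sigma_1:I\to S$ such that $I+pS\subseteq\mathrm{Rad}(S)$, $\sigma(a)\equiv a^p$ mod $pS$, and $\sigma_1(I)$ generates $S$; then there is a unique $\theta\in S$ with $\sigma(a)=\theta\sigma_1(a)$ for $a\in I$. A window over it is a quadruple $(P,Q,F,F_1)$ with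 $P$ a finitely generated projective $S$-module, $Q\subseteq P$ a submodule, and $\sigma$-linear maps $F:P\to P$, $F_1:Q\to P$ such that $P=L\oplus T$, $Q=L\oplus IT$ for some submodules $L,T$, $F_1(ax)=\sigma_1(a)F(x)$ for $a\in I$, $x\in P$, and $F_1(Q)$ generates $P$. Homomorphisms of windows are $S$-linear maps compatible with $Q$, $F$ and $F_1$. An ideal $J\subseteq S$ with $\sigma(J)+I+\theta S\subseteq J$ is called an ideal of definition; a window is nilpotent with respect to $J$ if the iterates $P\to P^{(\sigma)}\to\cdots\to P^{(\sigma^n)}$ of the $S$-linear map $V^\sharp:P\to P^{(\sigma)}=S\otimes_{\sigma,S}P$, $V^\sharp(F_1(x))=1\otimes x$ for $x\in Q$, vanish modulo $J$ for all large $n$. A homomorphism of frames is a ring homomorphism $\alpha:S\to S'$ with $\alpha(I)\subseteq I'$, $\sigma'\alpha=\alpha\sigma$ and $\sigma_1'\alpha=u\cdot\alpha\sigma_1$ for a unit $u\in S'$; it induces a base change functor $\alpha_*$ on windows. It is called nil-crystalline with respect to ideals of definition $J\subseteq S$ and $J'\subseteq S'$ with $\alpha(J)\subseteq J'$ if $\alpha_*$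 induces an equivalence between the categories of windows over $S$ nilpotent with respect to $J$ and of windows over $S'$ nilpotent with respect to $J'$. Consider the frame $\mathscr B=(\mathfrak S,E\mathfrak S,R,\sigma,\sigma_1)$ with $\sigma_1(Ey)=\sigma(y)$, the Witt frame $\mathscr W_R=(W(R),I_R,R,f,f_1)$, where $I_R=\ker(W(R)\to R)$, $f$ is the Frobenius and $f_1$ is the inverse of the Verschiebung $W(R)\to I_R$, and the homomorphism of frames $\varkappa:\mathscr B\to\mathscr W_R$ given by the composition $\mathfrak S\xrightarrow{\delta}W(\mathfrak S)\xrightarrow{W(\pi)}W(R)$, where $\delta$ is the ring homomorphism whose $n$-th ghost component is $\sigma^n$ for every $n\ge 0$. **Theorem.** The homomorphism $\varkappa$ is nil-crystalline with respect to the maximal ideals of $\mathfrak S$ and of $W(R)$. In other words, base change along $\varkappa$ is an equivalence between nilpotent $\mathscr B$-windows and nilpotent windows over $\mathscr W_R$ (that is, nilpotent displays over $R$). -/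

import Mathlib

universe u

set_option linter.unusedSectionVars false

namespace WindowTheory

open scoped TensorProduct

/-- A frame `(S, I, S ⧸ I, σ, σ₁)` on the ring `S`: an ideal `I`, a ring endomorphism `σ` lifting
the `p`-power map modulo `p`, and a `σ`-linear map `σ₁ : I → S` whose image generates `S`,
with `I + pS` contained in the Jacobson radical. -/
structure Frame (p : ℕ) (S : Type u) [CommRing S] where
  I : Ideal S
  σ : S →+* S
  σ₁ : I →ₛₗ[σ] S
  le_rad : I ⊔ Ideal.span {(p : S)} ≤ Ideal.jacobson ⊥
  frob : ∀ a : S, σ a - a ^ p ∈ Ideal.span {(p : S)}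
  span_σ₁ : Submodule.span S (Set.range σ₁) = ⊤

namespace Frame

variable {p : ℕ} {S : Type u} [CommRing S]

theorem existsUnique_theta (F : Frame p S) :
    ∃! θ : S, ∀ a : F.I, F.σ a = θ * F.σ₁ a := by
  have key : ∀ y ∈ Submodule.span S (Set.range F.σ₁),
      ∃ t : S, ∀ a : F.I, y * F.σ a = t * F.σ₁ a := by
    intro y hy
    induction hy using Submodule.span_induction with
    | mem y hy =>
      obtain ⟨b, rfl⟩ := hy
      refine ⟨F.σ b, fun a => ?_⟩
      have h1 := F.σ₁.map_smulₛₗ (a : S) b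
      have h2 := F.σ₁.map_smulₛₗ (b : S) a
      have h3 : (a : S) • b = (b : S) • a := Subtype.ext (mul_comm _ _)
      rw [h3, h2] at h1
      simp only [smul_eq_mul] at h1
      rw [h1, mul_comm]
    | zero => exact ⟨0, fun a => by simp⟩
    | add y z _ _ hy hz =>
      obtain ⟨t, ht⟩ := hy
      obtain ⟨s, hs⟩ := hz
      exact ⟨t + s, fun a => by rw [add_mul, add_mul, ht, hs]⟩
    | smul c y _ hy =>
      obtain ⟨t, ht⟩ := hy
      exact ⟨c * t, fun a => by rw [smul_eq_mul, mul_assoc, mul_assoc, ht]⟩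
  obtain ⟨t, ht⟩ := key 1 (by rw [F.span_σ₁]; trivial)
  refine ⟨t, fun a => by simpa using ht a, fun s hs => ?_⟩
  have : ∀ y ∈ Submodule.span S (Set.range F.σ₁), s * y = t * y := by
    intro y hy
    induction hy using Submodule.span_induction with
    | mem y hy =>
      obtain ⟨b, rfl⟩ := hy
      rw [← hs, ← ht, one_mul]
    | zero => simp
    | add y z _ _ hy hz => rw [mul_add, mul_add, hy, hz]
    | smul c y _ hy => rw [smul_eq_mul, mul_left_comm, hy, mul_left_comm]
  simpa using this 1 (by rw [F.span_σ₁]; trivial)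

/-- The unique element `θ` with `σ a = θ * σ₁ a` for `a ∈ I`. -/
noncomputable def theta (F : Frame p S) : S := F.existsUnique_theta.choose

theorem sigma_eq_theta (F : Frame p S) (a : F.I) : F.σ a = F.theta * F.σ₁ a :=
  F.existsUnique_theta.choose_spec.1 a

/-- An ideal of definition: `σ(J) + I + θS ⊆ J`. -/
def IsIdealOfDefinition (F : Frame p S) (J : Ideal S) : Prop :=
  (∀ a ∈ J, F.σ a ∈ J) ∧ F.I ≤ J ∧ F.theta ∈ J

end Frame

/-- A window `(P, Q, Fr, F₁)` over a frame. The field `normal` is the existence of a normal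
decomposition `P = L ⊕ T`, `Q = L ⊕ IT`. -/
structure Window {p : ℕ} {S : Type u} [CommRing S] (F : Frame p S) where
  P : Type u
  [addCommGroup : AddCommGroup P]
  [module : Module S P]
  [finite : Module.Finite S P]
  [projective : Module.Projective S P]
  Q : Submodule S P
  Fr : P →ₛₗ[F.σ] P
  F₁ : Q →ₛₗ[F.σ] P
  normal : ∃ L T : Submodule S P, IsCompl L T ∧ Q = L ⊔ F.I • T
  F₁_smul : ∀ (a : F.I) (x : P) (h : (a : S) • x ∈ Q), F₁ ⟨(a : S) • x, h⟩ = F.σ₁ a • Fr x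
  span_F₁ : Submodule.span S (Set.range F₁) = ⊤

attribute [instance] Window.addCommGroup Window.module Window.finite Window.projective

namespace Window

open CategoryTheory ChangeOfRings

variable {p : ℕ} {S : Type u} [CommRing S] {F : Frame p S}

theorem smul_mem_Q (P : Window F) (a : F.I) (x : P.P) : (a : S) • x ∈ P.Q := by
  obtain ⟨L, T, hLT, hQ⟩ := P.normal
  have hx : x ∈ L ⊔ T := by rw [hLT.sup_eq_top]; trivial
  obtain ⟨l, hl, t, ht, rfl⟩ := Submodule.mem_sup.1 hx
  rw [hQ, smul_add]
  exact Submodule.add_mem _ (Submodule.mem_sup_left (L.smul_mem _ hl))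
    (Submodule.mem_sup_right (Submodule.smul_mem_smul a.2 ht))

theorem Fr_eq_theta (P : Window F) (q : P.Q) : P.Fr q = F.theta • P.F₁ q := by
  have key : ∀ y ∈ Submodule.span S (Set.range F.σ₁), y • (P.Fr q - F.theta • P.F₁ q) = 0 := by
    intro y hy
    induction hy using Submodule.span_induction with
    | mem y hy =>
      obtain ⟨a, rfl⟩ := hy
      have h1 := P.F₁_smul a q (P.smul_mem_Q a q)
      have h2 := P.F₁.map_smulₛₗ (a : S) q
      rw [F.sigma_eq_theta, mul_comm, mul_smul] at h2
      rw [smul_sub, ← h1, ← h2, sub_eq_zero]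
      rfl
    | zero => simp
    | add y z _ _ hy hz => rw [add_smul, hy, hz, add_zero]
    | smul c y _ hy => rw [smul_eq_mul, mul_smul, hy, smul_zero]
  have h := key 1 (by rw [F.span_σ₁]; trivial)
  rw [one_smul] at h
  exact sub_eq_zero.1 h

/-- Homomorphisms of windows over the same frame. -/
@[ext]
structure Hom (P₁ P₂ : Window F) where
  toLin : P₁.P →ₗ[S] P₂.P
  map_Q : ∀ x ∈ P₁.Q, toLin x ∈ P₂.Q
  map_Fr : ∀ x, toLin (P₁.Fr x) = P₂.Fr (toLin x)
  map_F₁ : ∀ x : P₁.Q, toLin (P₁.F₁ x) = P₂.F₁ ⟨toLin x, map_Q x x.2⟩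

instance : Category (Window F) where
  Hom := Hom
  id P := ⟨LinearMap.id, fun _ h => h, fun _ => rfl, fun _ => rfl⟩
  comp f g := ⟨g.toLin ∘ₗ f.toLin, fun x h => g.map_Q _ (f.map_Q x h),
    fun x => by simp [f.map_Fr, g.map_Fr], fun x => by
      simp only [LinearMap.comp_apply]; rw [f.map_F₁, g.map_F₁]⟩

@[simp] theorem id_toLin (P : Window F) : Hom.toLin (𝟙 P) = LinearMap.id := rfl

@[simp] theorem comp_toLin {P₁ P₂ P₃ : Window F} (f : P₁ ⟶ P₂) (g : P₂ ⟶ P₃) :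
    Hom.toLin (f ≫ g) = g.toLin ∘ₗ f.toLin := rfl

/-- The iterated Frobenius twist `P^(σ^n)`, formed by `M ↦ S ⊗_{σ,S} M`. -/
noncomputable def twist (P : Window F) : ℕ → ModuleCat.{u} S
  | 0 => ModuleCat.of S P.P
  | n + 1 => (ModuleCat.extendScalars F.σ).obj (P.twist n)

/-- `V` is the `S`-linear map `V♯ : P → P^(σ)` characterised by `V♯ (F₁ x) = 1 ⊗ x` for `x ∈ Q`.
It exists for every window, and it is unique because `F₁(Q)` generates `P`. -/
def IsVSharp (P : Window F) (V : P.twist 0 ⟶ P.twist 1) : Prop :=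
  ∀ x : P.Q, V.hom (P.F₁ x) = (1 : S) ⊗ₜ[S, F.σ] (x : P.P)

/-- The iterate `(V♯)^n : P → P^(σ) → ⋯ → P^(σ^n)`. -/
noncomputable def iterV (P : Window F) (V : P.twist 0 ⟶ P.twist 1) :
    (n : ℕ) → (P.twist 0 ⟶ P.twist n)
  | 0 => 𝟙 _
  | n + 1 => V ≫ (ModuleCat.extendScalars F.σ).map (P.iterV V n)

/-- A window is nilpotent with respect to `J` if `(V♯)^n ≡ 0` modulo `J` for all large `n`. -/
def IsNilpotent (J : Ideal S) : ObjectProperty (Window F) := fun P =>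
  ∃ V : P.twist 0 ⟶ P.twist 1, P.IsVSharp V ∧
    ∃ N : ℕ, ∀ n ≥ N, ∀ x, (P.iterV V n).hom x ∈ J • (⊤ : Submodule S (P.twist n))

end Window

namespace BaseChange

open scoped TensorProduct

variable {S S' : Type u} [CommRing S] [CommRing S'] [Algebra S S']

section semi

variable {M N : Type u} [AddCommGroup M] [Module S M] [AddCommGroup N] [Module S N]

/-- The base change `s ⊗ x ↦ σ'(s) ⊗ A x` of a `σ`-linear map `A`. -/
noncomputable def semi (σ : S →+* S) (σ' : S' →+* S')
    (h : ∀ a, σ' (algebraMap S S' a) = algebraMap S S' (σ a)) (A : M →ₛₗ[σ] N) :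
    S' ⊗[S] M →ₛₗ[σ'] S' ⊗[S] N :=
  let f : S' ⊗[S] M →+ S' ⊗[S] N := TensorProduct.liftAddHom
    { toFun := fun s =>
        { toFun := fun x => σ' s ⊗ₜ[S] A x
          map_zero' := by rw [map_zero, TensorProduct.tmul_zero]
          map_add' := fun x y => by rw [map_add, TensorProduct.tmul_add] }
      map_zero' := by ext x; simp
      map_add' := fun s t => by ext x; simp [TensorProduct.add_tmul] }
    (fun r s x => by
      simp only [AddMonoidHom.coe_mk, ZeroHom.coe_mk]
      rw [Algebra.smul_def, map_mul, h, ← Algebra.smul_def, A.map_smulₛₗ,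
        TensorProduct.smul_tmul])
  { toFun := f
    map_add' := map_add f
    map_smul' := fun c x => by
      induction x using TensorProduct.induction_on with
      | zero => simp
      | tmul s y =>
        change σ' (c * s) ⊗ₜ[S] A y = σ' c • (σ' s ⊗ₜ[S] A y)
        rw [TensorProduct.smul_tmul', smul_eq_mul, map_mul]
      | add y z hy hz => rw [smul_add, map_add, hy, hz, map_add, smul_add] }

theorem semi_tmul (σ : S →+* S) (σ' : S' →+* S')
    (h : ∀ a, σ' (algebraMap S S' a) = algebraMap S S' (σ a)) (A : M →ₛₗ[σ] N) (s : S') (x : M) :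
    semi σ σ' h A (s ⊗ₜ[S] x) = σ' s ⊗ₜ[S] A x := rfl

end semi

/-- On `IP` the rule `a • x ↦ σ₁ a • Fr x` is a well-defined `σ`-linear map. -/
theorem exists_F₁_on_IP {I : Ideal S} {σ : S →+* S} (σ₁ : I →ₛₗ[σ] S)
    {P : Type u} [AddCommGroup P] [Module S P] [Module.Finite S P] [Module.Projective S P]
    (Fr : P →ₛₗ[σ] P) :
    ∃ G : ↥(I • (⊤ : Submodule S P)) →ₛₗ[σ] P,
      ∀ (a : I) (x : P) (h : (a : S) • x ∈ I • (⊤ : Submodule S P)),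
        G ⟨(a : S) • x, h⟩ = σ₁ a • Fr x := by
  obtain ⟨n, f, g, -, -, hfg⟩ := Module.Finite.exists_comp_eq_id_of_projective S P
  have hg : ∀ t ∈ I • (⊤ : Submodule S P), ∀ i, g t i ∈ I := by
    intro t ht i
    refine Submodule.smul_induction_on ht (fun a ha x _ => ?_) (fun x y hx hy => ?_)
    · rw [map_smul]; exact I.mul_mem_right _ ha
    · rw [map_add]; exact I.add_mem hx hy
  have hx : ∀ x : P, ∑ i, g x i • f (Pi.single i 1) = x := by
    intro x
    conv_rhs => rw [← LinearMap.id_apply (R := S) x, ← hfg, LinearMap.comp_apply,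
      pi_eq_sum_univ' (g x), map_sum]
    exact Finset.sum_congr rfl fun i _ => by
      rw [map_smul]
  refine ⟨{ toFun := fun t => ∑ i, σ₁ ⟨g t i, hg t t.2 i⟩ • Fr (f (Pi.single i 1))
            map_add' := fun s t => ?_
            map_smul' := fun c t => ?_ }, fun a x h => ?_⟩
  · rw [← Finset.sum_add_distrib]
    refine Finset.sum_congr rfl fun i _ => ?_
    rw [← add_smul, ← map_add]
    congr 2
    exact Subtype.ext (by simp)
  · rw [Finset.smul_sum]
    refine Finset.sum_congr rfl fun i _ => ?_
    rw [smul_smul, ← smul_eq_mul, ← σ₁.map_smulₛₗ]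
    congr 2
    exact Subtype.ext (by simp)
  · change ∑ i, σ₁ ⟨g ((a : S) • x) i, _⟩ • Fr (f (Pi.single i 1)) = _
    conv_rhs => rw [← hx x, map_sum, Finset.smul_sum]
    refine Finset.sum_congr rfl fun i _ => ?_
    rw [Fr.map_smulₛₗ, smul_smul, mul_comm, ← smul_eq_mul (σ (g x i)), ← σ₁.map_smulₛₗ]
    congr 2
    exact Subtype.ext (by simp [mul_comm])

variable {p : ℕ} {F : Frame p S} {F' : Frame p S'}

/-- The submodule of the base change: generated by the image of `Q` and by `I' (S' ⊗ P)`, that is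
`(S' ⊗ L) ⊕ I' (S' ⊗ T)` for a normal decomposition `P = L ⊕ T`. -/
def Q (P : Window F) : Submodule S' (S' ⊗[S] P.P) :=
  Submodule.span S' (Set.range fun q : P.Q => (1 : S') ⊗ₜ[S] (q : P.P)) ⊔ F'.I • ⊤

theorem tmul_mem_Q (P : Window F) (q : P.Q) : (1 : S') ⊗ₜ[S] (q : P.P) ∈ Q (F' := F') P :=
  Submodule.mem_sup_left (Submodule.subset_span ⟨q, rfl⟩)

theorem smul_mem_Q (P : Window F) (a : F'.I) (x : S' ⊗[S] P.P) : (a : S') • x ∈ Q (F' := F') P :=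
  Submodule.mem_sup_right (Submodule.smul_mem_smul a.2 trivial)

theorem exists_normal (hI : ∀ a ∈ F.I, algebraMap S S' a ∈ F'.I) (P : Window F) :
    ∃ (e : P.P →ₗ[S] P.P), (∀ x, e x ∈ P.Q) ∧
      (∀ q ∈ P.Q, q - e q ∈ F.I • (⊤ : Submodule S P.P)) ∧
      ∃ L T : Submodule S' (S' ⊗[S] P.P), IsCompl L T ∧ Q (F' := F') P = L ⊔ F'.I • T := by
  obtain ⟨L, T, hLT, hQ⟩ := P.normal
  let e : P.P →ₗ[S] P.P := L.projection T hLT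
  have heL : ∀ x, e x ∈ L := fun x => Submodule.projection_apply_mem hLT x
  have heL' : ∀ x ∈ L, e x = x := fun x hx => Submodule.projection_apply_left hLT ⟨x, hx⟩
  have heT : ∀ x ∈ T, e x = 0 := fun x hx => Submodule.projection_apply_right hLT ⟨x, hx⟩
  have hIT : F.I • T ≤ T := Submodule.smul_le_right
  have hee : ∀ x, e (e x) = e x := fun x => heL' _ (heL x)
  refine ⟨e, fun x => hQ ▸ Submodule.mem_sup_left (heL x), fun q hq => ?_, ?_⟩
  · rw [hQ] at hq
    obtain ⟨l, hl, t, ht, rfl⟩ := Submodule.mem_sup.1 hq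
    rw [map_add, heL' l hl, heT t (hIT ht), add_zero, add_sub_cancel_left]
    exact Submodule.smul_mono le_rfl le_top ht
  · let e' : S' ⊗[S] P.P →ₗ[S'] S' ⊗[S] P.P := e.baseChange S'
    have he' : ∀ x, e' (e' x) = e' x := by
      intro x
      induction x using TensorProduct.induction_on with
      | zero => simp
      | tmul s y => simp [e', hee]
      | add y z hy hz => rw [map_add, map_add, hy, hz]
    refine ⟨LinearMap.range e', LinearMap.ker e', ?_, ?_⟩
    · refine IsCompl.of_eq ?_ ?_
      · rw [eq_bot_iff]
        rintro x ⟨⟨y, rfl⟩, hx⟩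
        have hx' : e' (e' y) = 0 := hx
        rw [he'] at hx'
        simp [hx']
      · rw [eq_top_iff]
        intro x _
        refine Submodule.mem_sup.2 ⟨e' x, ⟨x, rfl⟩, x - e' x, ?_, by abel⟩
        rw [LinearMap.mem_ker, map_sub, he', sub_self]
    · have htop : ∀ x : S' ⊗[S] P.P, ∃ y ∈ LinearMap.ker e', x = e' x + y := fun x =>
        ⟨x - e' x, by rw [LinearMap.mem_ker, map_sub, he', sub_self], by abel⟩
      apply le_antisymm
      · refine sup_le (Submodule.span_le.2 ?_) (Submodule.smul_le.2 ?_)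
        · rintro _ ⟨q, rfl⟩
          have hq : (q : P.P) ∈ L ⊔ F.I • T := hQ ▸ q.2
          change (1 : S') ⊗ₜ[S] (q : P.P) ∈ _
          obtain ⟨l, hl, t, ht, hlt⟩ := Submodule.mem_sup.1 hq
          rw [← hlt, TensorProduct.tmul_add]
          refine Submodule.add_mem _ (Submodule.mem_sup_left ⟨1 ⊗ₜ l, ?_⟩)
            (Submodule.mem_sup_right ?_)
          · simp [e', heL' l hl]
          · refine Submodule.smul_induction_on ht (fun a ha x hx => ?_) (fun x y hx hy => ?_)
            · rw [← TensorProduct.smul_tmul, Algebra.smul_def, mul_one, ← mul_one (algebraMap S S' a),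
                ← smul_eq_mul, ← TensorProduct.smul_tmul']
              refine Submodule.smul_mem_smul (hI a ha) ?_
              simp [e', heT x hx]
            · rw [TensorProduct.tmul_add]; exact Submodule.add_mem _ hx hy
        · intro a ha x _
          obtain ⟨y, hy, hxy⟩ := htop x
          rw [hxy, smul_add]
          exact Submodule.add_mem _ (Submodule.mem_sup_left (Submodule.smul_mem _ _ ⟨x, rfl⟩))
            (Submodule.mem_sup_right (Submodule.smul_mem_smul ha hy))
      · refine sup_le ?_ (le_sup_of_le_right (Submodule.smul_mono le_rfl le_top))
        rintro _ ⟨x, rfl⟩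
        induction x using TensorProduct.induction_on with
        | zero => simp
        | tmul s y =>
          have : e' (s ⊗ₜ y) = s • ((1 : S') ⊗ₜ[S] e y) := by
            simp [e', TensorProduct.smul_tmul']
          rw [this]
          exact Submodule.smul_mem _ _
            (tmul_mem_Q P ⟨e y, hQ ▸ Submodule.mem_sup_left (heL y)⟩)
        | add y z hy hz => rw [map_add]; exact Submodule.add_mem _ hy hz

theorem map_theta
    (hI : ∀ a ∈ F.I, algebraMap S S' a ∈ F'.I)
    (hσ : ∀ a, F'.σ (algebraMap S S' a) = algebraMap S S' (F.σ a))
    (u : S'ˣ)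
    (hσ₁ : ∀ a : F.I, F'.σ₁ ⟨algebraMap S S' a, hI a a.2⟩ = u * algebraMap S S' (F.σ₁ a)) : algebraMap S S' F.theta = u * F'.theta := by
  have key : ∀ y ∈ Submodule.span S (Set.range F.σ₁),
      (algebraMap S S' F.theta - u * F'.theta) * algebraMap S S' y = 0 := by
    intro y hy
    induction hy using Submodule.span_induction with
    | mem y hy =>
      obtain ⟨a, rfl⟩ := hy
      have h1 := F'.sigma_eq_theta ⟨algebraMap S S' a, hI a a.2⟩
      rw [hσ₁, hσ, F.sigma_eq_theta, map_mul] at h1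
      rw [sub_mul, h1]; ring
    | zero => simp
    | add y z _ _ hy hz => rw [map_add, mul_add, hy, hz, add_zero]
    | smul c y _ hy => rw [smul_eq_mul, map_mul, mul_left_comm, hy, mul_zero]
  have h := key 1 (by rw [F.span_σ₁]; trivial)
  rw [map_one, mul_one] at h
  exact sub_eq_zero.1 h

theorem exists_F₁
    (hI : ∀ a ∈ F.I, algebraMap S S' a ∈ F'.I)
    (hσ : ∀ a, F'.σ (algebraMap S S' a) = algebraMap S S' (F.σ a))
    (u : S'ˣ)
    (hσ₁ : ∀ a : F.I, F'.σ₁ ⟨algebraMap S S' a, hI a a.2⟩ = u * algebraMap S S' (F.σ₁ a))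
    (P : Window F) :
    ∃ G : Q (F' := F') P →ₛₗ[F'.σ] S' ⊗[S] P.P,
      (∀ q : P.Q, G ⟨1 ⊗ₜ[S] (q : P.P), tmul_mem_Q P q⟩ = u • (1 ⊗ₜ[S] P.F₁ q)) ∧
      (∀ (a : F'.I) (x : S' ⊗[S] P.P),
        G ⟨(a : S') • x, smul_mem_Q P a x⟩ = F'.σ₁ a • semi F.σ F'.σ hσ P.Fr x) := by
  obtain ⟨e, heQ, heI, -⟩ := exists_normal (F' := F') hI P
  obtain ⟨G, hG⟩ := exists_F₁_on_IP F'.σ₁ (semi F.σ F'.σ hσ P.Fr)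
  let e' : S' ⊗[S] P.P →ₗ[S'] S' ⊗[S] P.P := e.baseChange S'
  let A : P.P →ₛₗ[F.σ] P.P := P.F₁.comp (e.codRestrict P.Q heQ)
  let A' : S' ⊗[S] P.P →ₛₗ[F'.σ] S' ⊗[S] P.P := semi F.σ F'.σ hσ A
  have hA' : ∀ x : S' ⊗[S] P.P,
      (u * F'.theta : S') • A' x = semi F.σ F'.σ hσ P.Fr (e' x) := by
    intro x
    induction x using TensorProduct.induction_on with
    | zero => simp
    | tmul s y =>
      change (u * F'.theta : S') • (F'.σ s ⊗ₜ[S] P.F₁ ⟨e y, heQ y⟩) = F'.σ s ⊗ₜ[S] P.Fr (e y)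
      rw [P.Fr_eq_theta ⟨e y, heQ y⟩, ← map_theta hI hσ u hσ₁, TensorProduct.smul_tmul',
        TensorProduct.tmul_smul, TensorProduct.smul_tmul', smul_eq_mul, Algebra.smul_def]
    | add y z hy hz => rw [map_add, smul_add, hy, hz, map_add, map_add]
  have hG' : ∀ t ∈ F.I • (⊤ : Submodule S P.P), ∃ (hQ : t ∈ P.Q)
      (h : (1 : S') ⊗ₜ[S] t ∈ F'.I • (⊤ : Submodule S' (S' ⊗[S] P.P))),
      G ⟨1 ⊗ₜ[S] t, h⟩ = u • (1 ⊗ₜ[S] P.F₁ ⟨t, hQ⟩) := by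
    intro t ht
    refine Submodule.smul_induction_on ht (fun a ha x _ => ?_) (fun x y hx hy => ?_)
    · have e1 : (1 : S') ⊗ₜ[S] (a • x) = algebraMap S S' a • ((1 : S') ⊗ₜ[S] x) := by
        rw [TensorProduct.tmul_smul, algebraMap_smul]
      have h1 : algebraMap S S' a • ((1 : S') ⊗ₜ[S] x) ∈
          F'.I • (⊤ : Submodule S' (S' ⊗[S] P.P)) := Submodule.smul_mem_smul (hI a ha) trivial
      refine ⟨P.smul_mem_Q ⟨a, ha⟩ x, e1 ▸ h1, ?_⟩
      have h2 := hG ⟨algebraMap S S' a, hI a ha⟩ ((1 : S') ⊗ₜ[S] x) h1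
      rw [hσ₁ ⟨a, ha⟩, semi_tmul, map_one] at h2
      have h3 : u • ((1 : S') ⊗ₜ[S] (F.σ₁ ⟨a, ha⟩ • P.Fr x)) =
          (u * algebraMap S S' (F.σ₁ ⟨a, ha⟩)) • ((1 : S') ⊗ₜ[S] P.Fr x) := by
        rw [TensorProduct.tmul_smul, mul_smul, algebraMap_smul, Units.smul_def]
      rw [P.F₁_smul ⟨a, ha⟩ x, h3, ← h2]
      congr 1
      exact Subtype.ext e1
    · obtain ⟨hx1, hx2, hx3⟩ := hx
      obtain ⟨hy1, hy2, hy3⟩ := hy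
      have e1 : (1 : S') ⊗ₜ[S] (x + y) = 1 ⊗ₜ[S] x + 1 ⊗ₜ[S] y := TensorProduct.tmul_add _ _ _
      refine ⟨P.Q.add_mem hx1 hy1, e1 ▸ Submodule.add_mem _ hx2 hy2, ?_⟩
      have e2 : P.F₁ ⟨x + y, P.Q.add_mem hx1 hy1⟩ = P.F₁ ⟨x, hx1⟩ + P.F₁ ⟨y, hy1⟩ := by
        rw [← map_add]; rfl
      conv_rhs => rw [e2, TensorProduct.tmul_add, smul_add, ← hx3, ← hy3, ← map_add]
      congr 1
      exact Subtype.ext e1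
  have he' : ∀ x ∈ Q (F' := F') P, x - e' x ∈ F'.I • (⊤ : Submodule S' (S' ⊗[S] P.P)) := by
    intro x hx
    have : Q (F' := F') P ≤
        (F'.I • (⊤ : Submodule S' (S' ⊗[S] P.P))).comap (LinearMap.id - e') := by
      refine sup_le (Submodule.span_le.2 ?_) (Submodule.smul_le.2 ?_)
      · rintro _ ⟨q, rfl⟩
        have h1 := (hG' _ (heI q q.2)).choose_spec.choose
        rw [TensorProduct.tmul_sub] at h1
        exact h1
      · intro a ha x _
        rw [Submodule.mem_comap, map_smul]
        exact Submodule.smul_mem_smul ha trivial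
    exact this hx
  let B : Q (F' := F') P →ₗ[S'] ↥(F'.I • (⊤ : Submodule S' (S' ⊗[S] P.P))) :=
    ((LinearMap.id - e').comp (Q (F' := F') P).subtype).codRestrict _ (fun x => he' x x.2)
  refine ⟨(u : S') • A'.comp (Q (F' := F') P).subtype + G.comp B, fun q => ?_, fun a x => ?_⟩
  · change (u : S') • A' (1 ⊗ₜ[S] (q : P.P)) + G (B _) = _
    obtain ⟨h1, h2, h3⟩ := hG' _ (heI q q.2)
    have e1 : B ⟨1 ⊗ₜ[S] (q : P.P), tmul_mem_Q P q⟩ = ⟨1 ⊗ₜ[S] ((q : P.P) - e q), h2⟩ :=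
      Subtype.ext (TensorProduct.tmul_sub _ _ _).symm
    have e2 : A' (1 ⊗ₜ[S] (q : P.P)) = 1 ⊗ₜ[S] P.F₁ ⟨e q, heQ q⟩ := by
      change F'.σ 1 ⊗ₜ[S] P.F₁ ⟨e q, heQ q⟩ = _
      rw [map_one]
    rw [e1, h3, e2, Units.smul_def, Units.smul_def, ← smul_add, ← TensorProduct.tmul_add, ← map_add]
    congr 3
    exact Subtype.ext (add_sub_cancel _ _)
  · change (u : S') • A' ((a : S') • x) + G (B _) = _
    have h1 : (a : S') • (x - e' x) ∈ F'.I • (⊤ : Submodule S' (S' ⊗[S] P.P)) :=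
      Submodule.smul_mem_smul a.2 trivial
    have e1 : B ⟨(a : S') • x, smul_mem_Q P a x⟩ = ⟨(a : S') • (x - e' x), h1⟩ :=
      Subtype.ext (by
        change (a : S') • x - e' ((a : S') • x) = _
        rw [map_smul]
        exact (smul_sub _ _ _).symm)
    rw [e1, hG, A'.map_smulₛₗ, F'.sigma_eq_theta, smul_smul,
      show (u : S') * (F'.theta * F'.σ₁ a) = F'.σ₁ a * (u * F'.theta) by ring, mul_smul, hA',
      ← smul_add, ← map_add, add_sub_cancel]

theorem Q_ext (P : Window F) {N : Type u} [AddCommGroup N] [Module S' N] {τ : S' →+* S'}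
    (f g : Q (F' := F') P →ₛₗ[τ] N)
    (h1 : ∀ q : P.Q, f ⟨1 ⊗ₜ[S] (q : P.P), tmul_mem_Q P q⟩ =
      g ⟨1 ⊗ₜ[S] (q : P.P), tmul_mem_Q P q⟩)
    (h2 : ∀ (a : F'.I) (x : S' ⊗[S] P.P),
      f ⟨(a : S') • x, smul_mem_Q P a x⟩ = g ⟨(a : S') • x, smul_mem_Q P a x⟩) : f = g := by
  have h : Q (F' := F') P ≤ (LinearMap.eqLocus f g).map (Q (F' := F') P).subtype := by
    refine sup_le (Submodule.span_le.2 ?_) (Submodule.smul_le.2 ?_)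
    · rintro _ ⟨q, rfl⟩
      exact ⟨⟨_, tmul_mem_Q P q⟩, h1 q, rfl⟩
    · intro a ha x _
      exact ⟨⟨_, smul_mem_Q P ⟨a, ha⟩ x⟩, h2 ⟨a, ha⟩ x, rfl⟩
  ext x
  obtain ⟨y, hy, hyx⟩ := h x.2
  obtain rfl : y = x := Subtype.ext hyx
  exact hy

/-- The base change of a window: `Fr' (s ⊗ x) = σ'(s) ⊗ Fr x`, and `F₁'` is the `σ'`-linear map with
`F₁' (1 ⊗ q) = u • (1 ⊗ F₁ q)` for `q ∈ Q` and `F₁' (a • x) = σ₁' a • Fr' x` for `a ∈ I'`. -/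
noncomputable def window
    (hI : ∀ a ∈ F.I, algebraMap S S' a ∈ F'.I)
    (hσ : ∀ a, F'.σ (algebraMap S S' a) = algebraMap S S' (F.σ a))
    (u : S'ˣ)
    (hσ₁ : ∀ a : F.I, F'.σ₁ ⟨algebraMap S S' a, hI a a.2⟩ = u * algebraMap S S' (F.σ₁ a))
    (P : Window F) : Window F' where
  P := S' ⊗[S] P.P
  Q := Q P
  Fr := semi F.σ F'.σ hσ P.Fr
  F₁ := (exists_F₁ hI hσ u hσ₁ P).choose
  normal := (exists_normal hI P).choose_spec.2.2
  F₁_smul := fun a x _ => (exists_F₁ hI hσ u hσ₁ P).choose_spec.2 a x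
  span_F₁ := by
    rw [eq_top_iff]
    have h1 : ∀ y ∈ Submodule.span S (Set.range P.F₁), (1 : S') ⊗ₜ[S] y ∈
        Submodule.span S' (Set.range (exists_F₁ hI hσ u hσ₁ P).choose) := by
      intro y hy
      induction hy using Submodule.span_induction with
      | mem y hy =>
        obtain ⟨q, rfl⟩ := hy
        have h2 := Submodule.subset_span (R := S') (Set.mem_range_self
          (f := (exists_F₁ hI hσ u hσ₁ P).choose) ⟨1 ⊗ₜ[S] (q : P.P), tmul_mem_Q P q⟩)
        rw [(exists_F₁ hI hσ u hσ₁ P).choose_spec.1 q] at h2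
        have h3 := Submodule.smul_mem _ ((u⁻¹ : S'ˣ) : S') h2
        rwa [← Units.smul_def, inv_smul_smul] at h3
      | zero => rw [TensorProduct.tmul_zero]; exact Submodule.zero_mem _
      | add y z _ _ hy hz => rw [TensorProduct.tmul_add]; exact Submodule.add_mem _ hy hz
      | smul c y _ hy =>
        rw [TensorProduct.tmul_smul, ← algebraMap_smul S']
        exact Submodule.smul_mem _ _ hy
    intro x hx
    clear hx
    induction x using TensorProduct.induction_on with
    | zero => exact Submodule.zero_mem _
    | tmul s y =>
      have := Submodule.smul_mem _ s (h1 y (by rw [P.span_F₁]; trivial))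
      rwa [TensorProduct.smul_tmul', smul_eq_mul, mul_one] at this
    | add y z hy hz => exact Submodule.add_mem _ hy hz

theorem window_F₁_tmul
    (hI : ∀ a ∈ F.I, algebraMap S S' a ∈ F'.I)
    (hσ : ∀ a, F'.σ (algebraMap S S' a) = algebraMap S S' (F.σ a))
    (u : S'ˣ)
    (hσ₁ : ∀ a : F.I, F'.σ₁ ⟨algebraMap S S' a, hI a a.2⟩ = u * algebraMap S S' (F.σ₁ a))
    (P : Window F) (q : P.Q) :
    (window hI hσ u hσ₁ P).F₁ ⟨(1 : S') ⊗ₜ[S] (q : P.P), tmul_mem_Q P q⟩ =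
      u • ((1 : S') ⊗ₜ[S] P.F₁ q) :=
  (exists_F₁ hI hσ u hσ₁ P).choose_spec.1 q

theorem baseChange_mem_Q {P₁ P₂ : Window F} (g : P₁.Hom P₂) :
    ∀ x ∈ Q (F' := F') P₁, g.toLin.baseChange S' x ∈ Q (F' := F') P₂ := by
  have : Q (F' := F') P₁ ≤ (Q (F' := F') P₂).comap (g.toLin.baseChange S') := by
    refine sup_le (Submodule.span_le.2 ?_) (Submodule.smul_le.2 ?_)
    · rintro _ ⟨q, rfl⟩
      exact tmul_mem_Q P₂ ⟨g.toLin q, g.map_Q q q.2⟩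
    · intro a ha x _
      rw [Submodule.mem_comap, map_smul]
      exact smul_mem_Q P₂ ⟨a, ha⟩ _
  exact this

theorem baseChange_semi
    (hσ : ∀ a, F'.σ (algebraMap S S' a) = algebraMap S S' (F.σ a))
    {P₁ P₂ : Window F} (g : P₁.Hom P₂) (x : S' ⊗[S] P₁.P) :
    g.toLin.baseChange S' (semi F.σ F'.σ hσ P₁.Fr x) =
      semi F.σ F'.σ hσ P₂.Fr (g.toLin.baseChange S' x) := by
  induction x using TensorProduct.induction_on with
  | zero => simp
  | tmul s y => simp [semi_tmul, g.map_Fr]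
  | add y z hy hz => simp only [map_add, hy, hz]

/-- The base change of a homomorphism of windows. -/
noncomputable def hom
    (hI : ∀ a ∈ F.I, algebraMap S S' a ∈ F'.I)
    (hσ : ∀ a, F'.σ (algebraMap S S' a) = algebraMap S S' (F.σ a))
    (u : S'ˣ)
    (hσ₁ : ∀ a : F.I, F'.σ₁ ⟨algebraMap S S' a, hI a a.2⟩ = u * algebraMap S S' (F.σ₁ a))
    {P₁ P₂ : Window F} (g : P₁.Hom P₂) :
    (window hI hσ u hσ₁ P₁).Hom (window hI hσ u hσ₁ P₂) where
  toLin := g.toLin.baseChange S'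
  map_Q := baseChange_mem_Q g
  map_Fr := baseChange_semi hσ g
  map_F₁ := by
    let g' : Q (F' := F') P₁ →ₗ[S'] Q (F' := F') P₂ :=
      (g.toLin.baseChange S').restrict (baseChange_mem_Q g)
    have h := Q_ext P₁
      ((g.toLin.baseChange S').comp (exists_F₁ hI hσ u hσ₁ P₁).choose)
      ((exists_F₁ hI hσ u hσ₁ P₂).choose.comp g') (fun q => ?_) (fun a x => ?_)
    · exact fun x => LinearMap.congr_fun h x
    · rw [LinearMap.comp_apply, LinearMap.comp_apply,
        (exists_F₁ hI hσ u hσ₁ P₁).choose_spec.1 q, Units.smul_def, map_smul,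
        LinearMap.baseChange_tmul, g.map_F₁]
      exact ((exists_F₁ hI hσ u hσ₁ P₂).choose_spec.1 ⟨g.toLin q, g.map_Q q q.2⟩).symm
    · rw [LinearMap.comp_apply, LinearMap.comp_apply,
        (exists_F₁ hI hσ u hσ₁ P₁).choose_spec.2 a x, map_smul, baseChange_semi,
        ← (exists_F₁ hI hσ u hσ₁ P₂).choose_spec.2 a]
      congr 1
      exact Subtype.ext (map_smul _ _ _).symm

end BaseChange

/-- A homomorphism of frames: a ring homomorphism `α` with `α(I) ⊆ I'`, `σ' α = α σ` and
`σ₁' α = u * α σ₁` for a (necessarily unique) unit `u` of `S'`. -/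
structure FrameHom {p : ℕ} {S S' : Type u} [CommRing S] [CommRing S']
    (F : Frame p S) (F' : Frame p S') where
  toRingHom : S →+* S'
  u : S'ˣ
  map_I : ∀ a ∈ F.I, toRingHom a ∈ F'.I
  map_σ : ∀ a, F'.σ (toRingHom a) = toRingHom (F.σ a)
  map_σ₁ : ∀ a : F.I, F'.σ₁ ⟨toRingHom a, map_I a a.2⟩ = u * toRingHom (F.σ₁ a)

namespace FrameHom

open CategoryTheory

variable {p : ℕ} {S S' : Type u} [CommRing S] [CommRing S'] {F : Frame p S} {F' : Frame p S'}

/-- The base change functor `α_*` from windows over `F` to windows over `F'`. -/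
noncomputable def baseChange (α : FrameHom F F') : Window F ⥤ Window F' :=
  letI := α.toRingHom.toAlgebra
  { obj := fun P => BaseChange.window α.map_I α.map_σ α.u α.map_σ₁ P
    map := fun g => BaseChange.hom α.map_I α.map_σ α.u α.map_σ₁ g
    map_id := fun _ => Window.Hom.ext (LinearMap.baseChange_id)
    map_comp := fun _ _ => Window.Hom.ext (LinearMap.baseChange_comp _ _) }

/-- `α` is nil-crystalline with respect to the ideals of definition `J` and `J'`, `α(J) ⊆ J'`:
`α_*` preserves nilpotent windows, and the resulting functor from nilpotent windows over `F` to
nilpotent windows over `F'` is an equivalence of categories. -/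
def IsNilCrystalline (α : FrameHom F F') (J : Ideal S) (J' : Ideal S') : Prop :=
  F.IsIdealOfDefinition J ∧ F'.IsIdealOfDefinition J' ∧ (∀ a ∈ J, α.toRingHom a ∈ J') ∧
  ∃ h : ∀ P : Window F, Window.IsNilpotent J P → Window.IsNilpotent J' (α.baseChange.obj P),
    ((Window.IsNilpotent J').lift ((Window.IsNilpotent (F := F) J).ι ⋙ α.baseChange)
      (fun P => h P.obj P.property)).IsEquivalence

end FrameHom

section WittLemmas

variable {p : ℕ} [hp : Fact p.Prime]

theorem ghostComponent_eq_sum {A : Type*} [CommRing A] (x : WittVector p A) (n : ℕ) :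
    WittVector.ghostComponent n x =
      ∑ i ∈ Finset.range (n + 1), (p : A) ^ i * x.coeff i ^ p ^ (n - i) := by
  rw [WittVector.ghostComponent_apply, aeval_wittPolynomial]

theorem coeff_eq_of_ghost {A : Type*} [CommRing A] (htf : ∀ a : A, (p : A) * a = 0 → a = 0)
    (x y : WittVector p A) (n : ℕ)
    (h : ∀ i ≤ n, WittVector.ghostComponent i x = WittVector.ghostComponent i y) :
    ∀ i ≤ n, x.coeff i = y.coeff i := by
  have htf' : ∀ (m : ℕ) (a : A), (p : A) ^ m * a = 0 → a = 0 := by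
    intro m
    induction m with
    | zero => intro a ha; simpa using ha
    | succ m ih => intro a ha; exact ih a (htf _ (by rw [← ha]; ring))
  intro i
  induction i using Nat.strong_induction_on with
  | _ i ih =>
    intro hi
    have h1 := h i hi
    rw [ghostComponent_eq_sum, ghostComponent_eq_sum, Finset.sum_range_succ,
      Finset.sum_range_succ, Finset.sum_congr rfl (fun j hj => by
        rw [ih j (Finset.mem_range.1 hj) (by have := Finset.mem_range.1 hj; omega)])] at h1
    have h2 := add_left_cancel h1
    simp only [Nat.sub_self, pow_zero, pow_one] at h2
    exact sub_eq_zero.1 (htf' i _ (by rw [mul_sub, h2, sub_self]))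

theorem eq_of_ghost {A : Type*} [CommRing A] (htf : ∀ a : A, (p : A) * a = 0 → a = 0)
    (x y : WittVector p A)
    (h : ∀ i, WittVector.ghostComponent i x = WittVector.ghostComponent i y) : x = y :=
  WittVector.ext fun i => coeff_eq_of_ghost htf x y i (fun j _ => h j) i le_rfl

theorem exists_ghost {A : Type*} [CommRing A] (htf : ∀ a : A, (p : A) * a = 0 → a = 0)
    (σ : A →+* A) (hσ : ∀ a, (p : A) ∣ σ a - a ^ p) (a : A) :
    ∃ x : WittVector p A, ∀ n, WittVector.ghostComponent n x = σ^[n] a := by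
  have fin : ∀ n, ∃ x : WittVector p A, ∀ i ≤ n, WittVector.ghostComponent i x = σ^[i] a := by
    intro n
    induction n with
    | zero =>
      refine ⟨WittVector.teichmuller p a, fun i hi => ?_⟩
      obtain rfl : i = 0 := by omega
      simp
    | succ n ih =>
      obtain ⟨x, hx⟩ := ih
      have hdvd : (p : A) ^ (n + 1) ∣ σ^[n + 1] a -
          ∑ i ∈ Finset.range (n + 1), (p : A) ^ i * x.coeff i ^ p ^ (n + 1 - i) := by
        rw [Function.iterate_succ_apply', ← hx n le_rfl, ghostComponent_eq_sum, map_sum,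
          ← Finset.sum_sub_distrib]
        refine Finset.dvd_sum fun i hi => ?_
        have hi' : i ≤ n := by have := Finset.mem_range.1 hi; omega
        rw [map_mul, map_pow, map_pow, map_natCast, ← mul_sub]
        have h3 := dvd_sub_pow_of_dvd_sub (hσ (x.coeff i)) (n - i)
        rw [← pow_mul, ← pow_succ', show n - i + 1 = n + 1 - i by omega] at h3
        calc (p : A) ^ (n + 1) = (p : A) ^ i * (p : A) ^ (n + 1 - i) := by
              rw [← pow_add]; congr 1; omega
          _ ∣ _ := mul_dvd_mul_left _ h3
      obtain ⟨c, hc⟩ := hdvd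
      refine ⟨WittVector.mk p (Function.update x.coeff (n + 1) c), fun i hi => ?_⟩
      rcases Nat.lt_or_ge i (n + 1) with hlt | hge
      · rw [← hx i (by omega), ghostComponent_eq_sum, ghostComponent_eq_sum]
        refine Finset.sum_congr rfl fun j hj => ?_
        have : j ≠ n + 1 := by have := Finset.mem_range.1 hj; omega
        rw [WittVector.coeff_mk, Function.update_of_ne this]
      · obtain rfl : i = n + 1 := by omega
        rw [ghostComponent_eq_sum, Finset.sum_range_succ, WittVector.coeff_mk,
          Function.update_self]
        rw [Finset.sum_congr rfl (fun j hj => by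
          rw [Function.update_of_ne (by have := Finset.mem_range.1 hj; omega)])]
        simp only [Nat.sub_self, pow_zero, pow_one]
        rw [← hc]; ring
  choose X hX using fin
  refine ⟨WittVector.mk p fun n => (X n).coeff n, fun n => ?_⟩
  rw [← hX n n le_rfl, ghostComponent_eq_sum, ghostComponent_eq_sum]
  refine Finset.sum_congr rfl fun i hi => ?_
  have hi' : i ≤ n := by have := Finset.mem_range.1 hi; omega
  rw [WittVector.coeff_mk, coeff_eq_of_ghost htf (X i) (X n) i
    (fun j hj => by rw [hX i j hj, hX n j (by omega)]) i le_rfl]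

/-- For a `p`-torsion free ring `A` with Frobenius lift `σ`, the ring homomorphism
`δ : A → W(A)` whose `n`-th ghost component is `σ^n`. -/
noncomputable def deltaHom {A : Type*} [CommRing A] (htf : ∀ a : A, (p : A) * a = 0 → a = 0)
    (σ : A →+* A) (hσ : ∀ a, (p : A) ∣ σ a - a ^ p) : A →+* WittVector p A where
  toFun a := (exists_ghost htf σ hσ a).choose
  map_one' := eq_of_ghost htf _ _ fun n => by
    rw [(exists_ghost htf σ hσ 1).choose_spec n, map_one, iterate_map_one]
  map_zero' := eq_of_ghost htf _ _ fun n => by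
    rw [(exists_ghost htf σ hσ 0).choose_spec n, map_zero, iterate_map_zero]
  map_mul' a b := eq_of_ghost htf _ _ fun n => by
    rw [map_mul, (exists_ghost htf σ hσ (a * b)).choose_spec n,
      (exists_ghost htf σ hσ a).choose_spec n, (exists_ghost htf σ hσ b).choose_spec n,
      iterate_map_mul]
  map_add' a b := eq_of_ghost htf _ _ fun n => by
    rw [map_add, (exists_ghost htf σ hσ (a + b)).choose_spec n,
      (exists_ghost htf σ hσ a).choose_spec n, (exists_ghost htf σ hσ b).choose_spec n,
      iterate_map_add]

theorem ghost_deltaHom {A : Type*} [CommRing A] (htf : ∀ a : A, (p : A) * a = 0 → a = 0)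
    (σ : A →+* A) (hσ : ∀ a, (p : A) ∣ σ a - a ^ p) (a : A) (n : ℕ) :
    WittVector.ghostComponent n (deltaHom htf σ hσ a) = σ^[n] a :=
  (exists_ghost htf σ hσ a).choose_spec n

variable {R : Type u} [CommRing R]

theorem verschiebung_shift_one (x : WittVector p R) (h : x.coeff 0 = 0) :
    WittVector.verschiebung (x.shift 1) = x :=
  (WittVector.eq_iterate_verschiebung (n := 1)
    (fun i hi => by obtain rfl : i = 0 := by omega
                    exact h)).symm

theorem frobenius_teichmuller_pow (r : R) :
    WittVector.frobenius (WittVector.teichmuller p r) = WittVector.teichmuller p (r ^ p) := by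
  have h : WittVector.frobenius (WittVector.teichmuller p (MvPolynomial.X r : MvPolynomial R ℤ)) =
      WittVector.teichmuller p ((MvPolynomial.X r : MvPolynomial R ℤ) ^ p) := by
    refine eq_of_ghost (fun a ha => ?_) _ _ fun n => ?_
    · have hp0 : (p : MvPolynomial R ℤ) ≠ 0 := by exact_mod_cast hp.out.ne_zero
      exact (mul_eq_zero.1 ha).resolve_left hp0
    · rw [WittVector.ghostComponent_frobenius, WittVector.ghostComponent_teichmuller,
        WittVector.ghostComponent_teichmuller, ← pow_mul, pow_succ']
  have h2 := congrArg (WittVector.map (MvPolynomial.eval₂Hom (Int.castRingHom R) id)) h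
  rw [WittVector.map_teichmuller, map_pow] at h2
  have h3 : ∀ y : WittVector p (MvPolynomial R ℤ), ∀ f : MvPolynomial R ℤ →+* R,
      WittVector.map f (WittVector.frobenius y) = WittVector.frobenius (WittVector.map f y) := by
    intro y f
    exact WittVector.frobenius_isPoly p |>.map f y
  rw [h3, WittVector.map_teichmuller] at h2
  simpa using h2

theorem verschiebung_mul_verschiebung (x y : WittVector p R) :
    WittVector.verschiebung x * WittVector.verschiebung y =
      (p : WittVector p R) * WittVector.verschiebung (x * y) := by
  rw [← WittVector.verschiebung_mul_frobenius, WittVector.frobenius_verschiebung, ← mul_assoc,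
    mul_comm _ (p : WittVector p R), ← nsmul_eq_mul, map_nsmul, nsmul_eq_mul]

theorem frobenius_sub_pow (a : WittVector p R) :
    (p : WittVector p R) ∣ WittVector.frobenius a - a ^ p := by
  obtain ⟨t, b, rfl⟩ : ∃ (t : R) (b : WittVector p R),
      a = WittVector.teichmuller p t + WittVector.verschiebung b := by
    refine ⟨a.coeff 0, (a - WittVector.teichmuller p (a.coeff 0)).shift 1, ?_⟩
    rw [verschiebung_shift_one, add_sub_cancel]
    have h0 := map_sub (WittVector.constantCoeff (p := p) (R := R)) a
      (WittVector.teichmuller p (a.coeff 0))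
    simp only [WittVector.constantCoeff_apply, WittVector.teichmuller_coeff_zero, sub_self] at h0
    exact h0
  obtain ⟨c, hc⟩ := exists_add_pow_prime_eq hp.out (WittVector.teichmuller p t)
    (WittVector.verschiebung b)
  obtain ⟨m, hm⟩ : ∃ m, p = m + 2 := ⟨p - 2, by have := hp.out.two_le; omega⟩
  have hV : (p : WittVector p R) ∣ WittVector.verschiebung b ^ p := by
    rw [show WittVector.verschiebung b ^ p = WittVector.verschiebung b ^ (m + 2) by rw [← hm],
      pow_add, pow_two, verschiebung_mul_verschiebung]
    exact Dvd.dvd.mul_left (dvd_mul_right _ _) _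
  rw [hc, map_add, frobenius_teichmuller_pow, WittVector.frobenius_verschiebung, map_pow]
  obtain ⟨d, hd⟩ := hV
  rw [hd]
  exact ⟨b - d - WittVector.teichmuller p t * WittVector.verschiebung b * c, by ring⟩

theorem iterate_verschiebung_mul_self (x y : WittVector p R) (n : ℕ) :
    WittVector.verschiebung^[n] x * WittVector.verschiebung^[n] y =
      WittVector.verschiebung^[n] (p ^ n • (x * y)) := by
  induction n with
  | zero => simp
  | succ n ih =>
    rw [Function.iterate_succ_apply', Function.iterate_succ_apply',
      verschiebung_mul_verschiebung, ih, ← nsmul_eq_mul, ← map_nsmul,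
      Function.iterate_succ_apply', ← iterate_map_nsmul, smul_smul, pow_succ']

theorem mem_ker_truncate_iff (n : ℕ) (x : WittVector p R) :
    x ∈ RingHom.ker (WittVector.truncate (p := p) (R := R) n) ↔
      ∃ c, x = WittVector.verschiebung^[n] c := by
  rw [WittVector.mem_ker_truncate]
  constructor
  · exact fun h => ⟨_, WittVector.eq_iterate_verschiebung h⟩
  · rintro ⟨c, rfl⟩ i hi
    exact WittVector.iterate_verschiebung_coeff_eq_zero c hi

theorem isUnit_of_isUnit_coeff_zero (hp1 : ∀ a : R, IsUnit (1 + (p : R) * a))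
    (w : WittVector p R) (hw : IsUnit (w.coeff 0)) : IsUnit w := by
  let K : ℕ → Ideal (WittVector p R) := fun n => RingHom.ker (WittVector.truncate n)
  have step : ∀ n : ℕ, ∀ v : WittVector p R, w * v - 1 ∈ K (n + 1) →
      ∃ v' : WittVector p R, w * v' - 1 ∈ K (n + 2) ∧ v' - v ∈ K (n + 1) := by
    intro n v hv
    obtain ⟨c, hc⟩ := (mem_ker_truncate_iff _ _).1 hv
    obtain ⟨e, he⟩ := hp1 (p ^ n * c.coeff 0)
    set d : R := -(c.coeff 0 * ((e⁻¹ : Rˣ) : R)) with hd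
    set y := WittVector.teichmuller p d with hy
    have h0 : (c + y + p ^ (n + 1) • (c * y)).coeff 0 = 0 := by
      have h1 : WittVector.constantCoeff (c + y + p ^ (n + 1) • (c * y)) =
          c.coeff 0 + d + p ^ (n + 1) * (c.coeff 0 * d) := by
        rw [map_add, map_add, map_nsmul, map_mul]
        simp [hy, WittVector.constantCoeff_apply, WittVector.teichmuller_coeff_zero]
      rw [← WittVector.constantCoeff_apply, h1]
      have h2 : (e : R) * ((e⁻¹ : Rˣ) : R) = 1 := e.mul_inv
      rw [he] at h2
      rw [hd]
      linear_combination (-(c.coeff 0)) * h2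
    refine ⟨v * (1 + WittVector.verschiebung^[n + 1] y), ?_, ?_⟩
    · rw [mem_ker_truncate_iff]
      refine ⟨(c + y + p ^ (n + 1) • (c * y)).shift 1, ?_⟩
      have h1 := iterate_verschiebung_mul_self c y (n + 1)
      rw [Function.iterate_succ_apply _ (n + 1), verschiebung_shift_one _ h0, iterate_map_add,
        iterate_map_add, ← h1, ← hc]
      ring
    · rw [show v * (1 + WittVector.verschiebung^[n + 1] y) - v =
        v * WittVector.verschiebung^[n + 1] y by ring]
      exact Ideal.mul_mem_left _ _ ((mem_ker_truncate_iff _ _).2 ⟨y, rfl⟩)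
  obtain ⟨e, he⟩ := hw
  have base : w * WittVector.teichmuller p ((e⁻¹ : Rˣ) : R) - 1 ∈ K 1 := by
    refine (WittVector.mem_ker_truncate _ _).2 fun i hi => ?_
    obtain rfl : i = 0 := by omega
    rw [← WittVector.constantCoeff_apply, map_sub, map_mul, map_one,
      WittVector.constantCoeff_apply, WittVector.constantCoeff_apply,
      WittVector.teichmuller_coeff_zero, ← he, e.mul_inv, sub_self]
  let V : (n : ℕ) → {v : WittVector p R // w * v - 1 ∈ K (n + 1)} := fun n =>
    Nat.rec ⟨_, base⟩ (fun n v => ⟨(step n v.1 v.2).choose, (step n v.1 v.2).choose_spec.1⟩) n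
  have hV : ∀ n, (V (n + 1)).1 - (V n).1 ∈ K (n + 1) := fun n =>
    (step n (V n).1 (V n).2).choose_spec.2
  have hV' : ∀ n i, i ≤ n → (V n).1.coeff i = (V i).1.coeff i := by
    intro n i hin
    induction n, hin using Nat.le_induction with
    | base => rfl
    | succ n hin ih =>
      rw [← ih]
      exact WittVector.le_coeff_eq_iff_le_sub_coeff_eq_zero.2
        ((WittVector.mem_ker_truncate _ _).1 (hV n)) i (by omega)
  let v : WittVector p R := WittVector.mk p fun i => (V i).1.coeff i
  have hv : ∀ n, v - (V n).1 ∈ K (n + 1) := fun n =>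
    (WittVector.mem_ker_truncate _ _).2 (WittVector.le_coeff_eq_iff_le_sub_coeff_eq_zero.1
      fun i hi => (hV' n i (by omega)).symm)
  refine IsUnit.of_mul_eq_one v ?_
  rw [← sub_eq_zero]
  ext n
  have h : w * v - 1 ∈ K (n + 1) := by
    rw [show w * v - 1 = w * (v - (V n).1) + (w * (V n).1 - 1) by ring]
    exact Ideal.add_mem _ (Ideal.mul_mem_left _ _ (hv n)) (V n).2
  rw [WittVector.zero_coeff]
  exact (WittVector.mem_ker_truncate _ _).1 h n (by omega)

end WittLemmas

section WittFrame

open IsLocalRing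

theorem natCast_mem_maximalIdeal (p : ℕ) (R : Type u) [CommRing R] [IsLocalRing R]
    [CharP (ResidueField R) p] : (p : R) ∈ maximalIdeal R := by
  rw [← residue_eq_zero_iff, map_natCast, CharP.cast_eq_zero]

variable (p : ℕ) [hp : Fact p.Prime] (R : Type u) [CommRing R] [IsLocalRing R]
  [CharP (ResidueField R) p]

/-- `W(R)` is local, and its maximal ideal is the inverse image of that of `R`. -/
theorem isUnit_wittVector_iff {p : ℕ} [Fact p.Prime] {R : Type u} [CommRing R] [IsLocalRing R]
    [CharP (ResidueField R) p] (w : WittVector p R) : IsUnit w ↔ IsUnit (w.coeff 0) := by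
  refine ⟨fun h => h.map WittVector.constantCoeff, isUnit_of_isUnit_coeff_zero (fun a => ?_) w⟩
  by_contra h
  have h1 : (p : R) * a ∈ maximalIdeal R :=
    Ideal.mul_mem_right _ _ (natCast_mem_maximalIdeal p R)
  have h2 := Ideal.sub_mem _ ((mem_maximalIdeal _).2 h) h1
  rw [add_sub_cancel_right] at h2
  exact (Ideal.ne_top_iff_one _).1 (maximalIdeal.isMaximal R).ne_top h2

instance : IsLocalRing (WittVector p R) :=
  haveI : IsLocalHom (WittVector.constantCoeff (p := p) (R := R)) :=
    ⟨fun w hw => (isUnit_wittVector_iff w).2 hw⟩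
  RingHom.domain_isLocalRing (WittVector.constantCoeff (p := p) (R := R))

/-- The Witt frame `(W(R), I_R, R, f, f₁)`: `I_R` is the kernel of `W(R) → R`, `f` is the Frobenius,
and `f₁` (dropping the zeroth component) is the inverse of the Verschiebung `W(R) → I_R`.
Its windows are the displays over `R`. -/
noncomputable def wittFrame : Frame p (WittVector p R) where
  I := RingHom.ker (WittVector.constantCoeff (p := p) (R := R))
  σ := WittVector.frobenius
  σ₁ :=
    { toFun := fun x => (x : WittVector p R).shift 1
      map_add' := fun x y => WittVector.verschiebung_injective p R (by
        have hx : (x : WittVector p R).coeff 0 = 0 := x.2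
        have hy : (y : WittVector p R).coeff 0 = 0 := y.2
        have hxy : ((x + y : _) : WittVector p R).coeff 0 = 0 := (x + y).2
        rw [map_add, verschiebung_shift_one _ hx, verschiebung_shift_one _ hy,
          verschiebung_shift_one _ hxy, Submodule.coe_add])
      map_smul' := fun c x => WittVector.verschiebung_injective p R (by
        have hx : (x : WittVector p R).coeff 0 = 0 := x.2
        have hcx : ((c • x : _) : WittVector p R).coeff 0 = 0 := (c • x).2
        rw [verschiebung_shift_one _ hcx, smul_eq_mul, mul_comm,
          WittVector.verschiebung_mul_frobenius, verschiebung_shift_one _ hx, mul_comm]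
        rfl) }
  le_rad := by
    rw [IsLocalRing.jacobson_eq_maximalIdeal _ bot_ne_top]
    refine sup_le (fun x hx => ?_) ((Ideal.span_singleton_le_iff_mem _).2 ?_)
    · rw [mem_maximalIdeal, mem_nonunits_iff, isUnit_wittVector_iff]
      have hx' : x.coeff 0 = 0 := hx
      rw [hx']
      exact not_isUnit_zero
    · rw [mem_maximalIdeal, mem_nonunits_iff, isUnit_wittVector_iff,
        ← WittVector.constantCoeff_apply, map_natCast]
      exact natCast_mem_maximalIdeal p R
  frob := fun a => Ideal.mem_span_singleton.2 (frobenius_sub_pow a)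
  span_σ₁ := by
    rw [Ideal.eq_top_iff_one]
    refine Submodule.subset_span ⟨⟨WittVector.verschiebung (1 : WittVector p R),
      WittVector.verschiebung_coeff_zero (1 : WittVector p R)⟩, ?_⟩
    refine WittVector.verschiebung_injective p R ?_
    exact verschiebung_shift_one (p := p) (R := R) _ (WittVector.verschiebung_coeff_zero (1 : WittVector p R))

end WittFrame

section MainFrame

open IsLocalRing

/-- A `p`-ring: a complete discrete valuation ring with maximal ideal generated by `p`. -/
class IsPRing (p : ℕ) (C : Type u) [CommRing C] [IsDomain C] [IsDiscreteValuationRing C] :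
    Prop where
  maximalIdeal_eq : maximalIdeal C = Ideal.span {(p : C)}
  isAdicComplete : IsAdicComplete (maximalIdeal C) C

/-- The choices for a complete regular local ring `R` of dimension `r`: a surjection
`π : C[[x₁,…,x_r]] → R` sending the variables to a regular system of parameters (so that `π`
identifies the residue fields of `C` and `R`), a power series `E` with constant term `p`
generating the kernel of `π`, and an endomorphism `σ` of `C[[x₁,…,x_r]]` which induces the
Frobenius modulo `p` and preserves the ideal `(x₁,…,x_r)`. -/
structure MainDatum (p : ℕ) (C R : Type u) [CommRing C] [CommRing R] [IsLocalRing R]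
    (r : ℕ) where
  ringKrullDim_eq : ringKrullDim R = r
  π : MvPowerSeries (Fin r) C →+* R
  π_surjective : Function.Surjective π
  span_π_X : Ideal.span (Set.range fun i => π (MvPowerSeries.X i)) = maximalIdeal R
  E : MvPowerSeries (Fin r) C
  constantCoeff_E : MvPowerSeries.constantCoeff E = (p : C)
  ker_π : RingHom.ker π = Ideal.span {E}
  σ : MvPowerSeries (Fin r) C →+* MvPowerSeries (Fin r) C
  σ_frob : ∀ a, σ a - a ^ p ∈ Ideal.span {(p : MvPowerSeries (Fin r) C)}
  σ_J : ∀ a ∈ Ideal.span (Set.range (MvPowerSeries.X : Fin r → MvPowerSeries (Fin r) C)),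
    σ a ∈ Ideal.span (Set.range (MvPowerSeries.X : Fin r → MvPowerSeries (Fin r) C))

theorem mem_span_X_of_constantCoeff_eq_zero {C : Type u} [CommRing C] {r : ℕ}
    (f : MvPowerSeries (Fin r) C) (hf : MvPowerSeries.constantCoeff f = 0) :
    f ∈ Ideal.span (Set.range (MvPowerSeries.X : Fin r → MvPowerSeries (Fin r) C)) := by
  have key : ∀ (t : Finset (Fin r)) (g : MvPowerSeries (Fin r) C),
      (∀ m : Fin r →₀ ℕ, (∀ i ∈ t, m i = 0) → MvPowerSeries.coeff m g = 0) →
      g ∈ Ideal.span (Set.range (MvPowerSeries.X : Fin r → MvPowerSeries (Fin r) C)) := by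
    intro t
    induction t using Finset.induction_on with
    | empty =>
      intro g hg
      have : g = 0 := MvPowerSeries.ext fun m => hg m (by simp)
      rw [this]; exact Ideal.zero_mem _
    | insert s t hs ih =>
      intro g hg
      let g1 : MvPowerSeries (Fin r) C := fun m => if m s = 0 then 0 else MvPowerSeries.coeff m g
      let g2 : MvPowerSeries (Fin r) C := fun m => if m s = 0 then MvPowerSeries.coeff m g else 0
      have e1 : ∀ m, MvPowerSeries.coeff m g1 = if m s = 0 then 0 else MvPowerSeries.coeff m g :=
        fun _ => rfl
      have e2 : ∀ m, MvPowerSeries.coeff m g2 = if m s = 0 then MvPowerSeries.coeff m g else 0 :=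
        fun _ => rfl
      have hg12 : g = g1 + g2 := by
        ext m
        rw [map_add, e1, e2]
        split_ifs <;> simp
      rw [hg12]
      refine Ideal.add_mem _ ?_ (ih g2 fun m hm => ?_)
      · obtain ⟨c, hc⟩ := (MvPowerSeries.X_dvd_iff (s := s) (φ := g1)).2
          (fun m hm => by rw [e1, if_pos hm])
        rw [hc]
        exact Ideal.mul_mem_right _ _ (Ideal.subset_span ⟨s, rfl⟩)
      · rw [e2]
        split_ifs with h
        · exact hg m (by
            intro i hi
            rcases Finset.mem_insert.1 hi with rfl | hi
            · exact h
            · exact hm i hi)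
        · rfl
  refine key Finset.univ f fun m hm => ?_
  have : m = 0 := Finsupp.ext fun i => hm i (Finset.mem_univ i)
  rw [this]
  simpa using hf

theorem constantCoeff_eq_zero_of_mem_span_X {C : Type u} [CommRing C] {r : ℕ}
    {f : MvPowerSeries (Fin r) C}
    (hf : f ∈ Ideal.span (Set.range (MvPowerSeries.X : Fin r → MvPowerSeries (Fin r) C))) :
    MvPowerSeries.constantCoeff f = 0 := by
  have : Ideal.span (Set.range (MvPowerSeries.X : Fin r → MvPowerSeries (Fin r) C)) ≤
      RingHom.ker MvPowerSeries.constantCoeff :=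
    Ideal.span_le.2 (by rintro _ ⟨i, rfl⟩; exact MvPowerSeries.constantCoeff_X i)
  exact this hf

namespace MainDatum

variable {p : ℕ} [hp : Fact p.Prime] {C R : Type u} [CommRing C] [IsDomain C]
  [IsDiscreteValuationRing C] [CommRing R] [IsLocalRing R] {r : ℕ}

theorem natCast_mem [IsPRing p C] : (p : C) ∈ maximalIdeal C := by
  rw [IsPRing.maximalIdeal_eq (p := p)]
  exact Ideal.mem_span_singleton_self _

theorem natCast_ne_zero [IsPRing p C] : (p : C) ≠ 0 := fun h =>
  IsDiscreteValuationRing.not_a_field C (by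
    rw [IsPRing.maximalIdeal_eq (p := p), h, Ideal.span_singleton_eq_bot])

theorem torsionFree [IsPRing p C] (a : MvPowerSeries (Fin r) C)
    (h : (p : MvPowerSeries (Fin r) C) * a = 0) : a = 0 := by
  refine (mul_eq_zero.1 h).resolve_left fun h0 => natCast_ne_zero (p := p) (C := C) ?_
  have := congrArg (MvPowerSeries.constantCoeff (σ := Fin r) (R := C)) h0
  rwa [map_natCast, map_zero] at this

theorem mem_maximalIdeal_of_constantCoeff (f : MvPowerSeries (Fin r) C)
    (hf : MvPowerSeries.constantCoeff f ∈ maximalIdeal C) :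
    f ∈ maximalIdeal (MvPowerSeries (Fin r) C) := by
  rw [mem_maximalIdeal, mem_nonunits_iff] at hf ⊢
  exact fun h => hf (h.map MvPowerSeries.constantCoeff)

variable [IsPRing p C] (D : MainDatum p C R r)

theorem E_ne_zero : D.E ≠ 0 := fun h => natCast_ne_zero (p := p) (C := C) (by
  rw [← D.constantCoeff_E, h, map_zero])

/-- The quotient `y` of `a = y * E` by `E`. -/
noncomputable def divE (a : Ideal.span {D.E}) : MvPowerSeries (Fin r) C :=
  (Ideal.mem_span_singleton'.1 a.2).choose

theorem divE_mul (a : Ideal.span {D.E}) : D.divE a * D.E = a :=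
  (Ideal.mem_span_singleton'.1 a.2).choose_spec

theorem divE_eq (a : Ideal.span {D.E}) (y : MvPowerSeries (Fin r) C) (h : y * D.E = a) :
    D.divE a = y :=
  mul_right_cancel₀ D.E_ne_zero ((D.divE_mul a).trans h.symm)

/-- The frame `(𝔖, E𝔖, R, σ, σ₁)` on `𝔖 = C[[x₁,…,x_r]]` with `σ₁ (y * E) = σ y`. -/
noncomputable def frame : Frame p (MvPowerSeries (Fin r) C) where
  I := Ideal.span {D.E}
  σ := D.σ
  σ₁ :=
    { toFun := fun a => D.σ (D.divE a)
      map_add' := fun a b => by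
        rw [← map_add, D.divE_eq (a + b) (D.divE a + D.divE b)
          (by rw [add_mul, divE_mul, divE_mul, Submodule.coe_add])]
      map_smul' := fun c a => by
        rw [smul_eq_mul, ← map_mul, D.divE_eq (c • a) (c * D.divE a)
          (by rw [mul_assoc, divE_mul]; rfl)] }
  le_rad := by
    rw [IsLocalRing.jacobson_eq_maximalIdeal _ bot_ne_top]
    refine sup_le ((Ideal.span_singleton_le_iff_mem _).2 ?_)
      ((Ideal.span_singleton_le_iff_mem _).2 ?_)
    · refine mem_maximalIdeal_of_constantCoeff _ ?_
      rw [D.constantCoeff_E]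
      exact natCast_mem
    · refine mem_maximalIdeal_of_constantCoeff _ ?_
      rw [map_natCast]
      exact natCast_mem
  frob := D.σ_frob
  span_σ₁ := by
    rw [Ideal.eq_top_iff_one]
    refine Submodule.subset_span ⟨⟨D.E, Ideal.mem_span_singleton_self _⟩, ?_⟩
    change D.σ (D.divE _) = 1
    rw [D.divE_eq _ 1 (one_mul _), map_one]

/-- The ring homomorphism `δ : 𝔖 → W(𝔖)` with ghost components `σ^n`. -/
noncomputable def delta : MvPowerSeries (Fin r) C →+* WittVector p (MvPowerSeries (Fin r) C) :=
  deltaHom torsionFree D.σ fun a => Ideal.mem_span_singleton.1 (D.σ_frob a)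

theorem ghostComponent_delta (a : MvPowerSeries (Fin r) C) (n : ℕ) :
    WittVector.ghostComponent n (D.delta a) = D.σ^[n] a :=
  ghost_deltaHom _ _ _ a n

/-- The ring homomorphism `ϰ : 𝔖 → W(𝔖) → W(R)`. -/
noncomputable def kappaRingHom : MvPowerSeries (Fin r) C →+* WittVector p R :=
  (WittVector.map D.π).comp D.delta

theorem delta_coeff_zero (a : MvPowerSeries (Fin r) C) : (D.delta a).coeff 0 = a := by
  have h := D.ghostComponent_delta a 0
  rw [ghostComponent_eq_sum] at h
  simpa using h

theorem frobenius_delta (a : MvPowerSeries (Fin r) C) :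
    WittVector.frobenius (D.delta a) = D.delta (D.σ a) :=
  eq_of_ghost torsionFree _ _ fun n => by
    rw [WittVector.ghostComponent_frobenius, ghostComponent_delta, ghostComponent_delta,
      Function.iterate_succ_apply]

theorem kappa_coeff_zero (a : MvPowerSeries (Fin r) C) : (D.kappaRingHom a).coeff 0 = D.π a := by
  change D.π ((D.delta a).coeff 0) = _
  rw [delta_coeff_zero]

theorem frobenius_kappa (a : MvPowerSeries (Fin r) C) :
    WittVector.frobenius (D.kappaRingHom a) = D.kappaRingHom (D.σ a) := by
  change WittVector.frobenius (WittVector.map D.π (D.delta a)) = WittVector.map D.π _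
  rw [← frobenius_delta, (WittVector.frobenius_isPoly p).map D.π]

theorem kappa_E_coeff_zero : (D.kappaRingHom D.E).coeff 0 = 0 := by
  rw [kappa_coeff_zero]
  have : D.E ∈ RingHom.ker D.π := by rw [D.ker_π]; exact Ideal.mem_span_singleton_self _
  exact this

theorem isUnit_delta_E_coeff_one : IsUnit ((D.delta D.E).coeff 1) := by
  have h := D.ghostComponent_delta D.E 1
  rw [ghostComponent_eq_sum, Finset.sum_range_succ, Finset.sum_range_one, delta_coeff_zero] at h
  simp only [pow_zero, one_mul, Nat.sub_zero, pow_one, Nat.sub_self, Function.iterate_one] at h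
  have hσE : MvPowerSeries.constantCoeff (D.σ D.E) = (p : C) := by
    have h1 := D.σ_J (D.E - p) (mem_span_X_of_constantCoeff_eq_zero _ (by
      rw [map_sub, D.constantCoeff_E, map_natCast, sub_self]))
    have h2 := constantCoeff_eq_zero_of_mem_span_X h1
    rw [map_sub, map_natCast, map_sub, map_natCast, sub_eq_zero] at h2
    exact h2
  have h3 := congrArg (MvPowerSeries.constantCoeff (σ := Fin r) (R := C)) h
  rw [map_add, map_pow, map_mul, map_natCast, D.constantCoeff_E, hσE] at h3
  set c := MvPowerSeries.constantCoeff ((D.delta D.E).coeff 1) with hc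
  obtain ⟨m, hm⟩ : ∃ m, p = m + 2 := ⟨p - 2, by have := hp.out.two_le; omega⟩
  have h4 : (p : C) ^ p = p * (p * (p : C) ^ m) := by
    rw [show (p : C) ^ p = (p : C) ^ (m + 2) by rw [← hm]]; ring
  have h5 : c = 1 - p * (p : C) ^ m := by
    refine mul_left_cancel₀ (natCast_ne_zero (p := p) (C := C)) ?_
    rw [h4] at h3
    linear_combination h3
  rw [MvPowerSeries.isUnit_iff_constantCoeff, ← hc, h5]
  by_contra hu
  have h6 := Ideal.add_mem _ ((mem_maximalIdeal _).2 hu)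
    (Ideal.mul_mem_right ((p : C) ^ m) _ (natCast_mem (p := p) (C := C)))
  rw [sub_add_cancel] at h6
  exact (Ideal.ne_top_iff_one _).1 (maximalIdeal.isMaximal C).ne_top h6

variable [CharP (ResidueField R) p]

theorem isUnit_u : IsUnit ((D.kappaRingHom D.E).shift 1) := by
  rw [isUnit_wittVector_iff]
  exact (D.isUnit_delta_E_coeff_one).map D.π

/-- The homomorphism of frames `ϰ`, with the unit `u = f₁ (ϰ E)`. -/
noncomputable def kappa : FrameHom D.frame (wittFrame p R) where
  toRingHom := D.kappaRingHom
  u := D.isUnit_u.unit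
  map_I := fun a ha => by
    obtain ⟨y, rfl⟩ := Ideal.mem_span_singleton'.1 ha
    change WittVector.constantCoeff _ = 0
    rw [map_mul, map_mul, WittVector.constantCoeff_apply (D.kappaRingHom D.E),
      kappa_E_coeff_zero, mul_zero]
  map_σ := D.frobenius_kappa
  map_σ₁ := fun a => WittVector.verschiebung_injective p R (by
    have h0 : (D.kappaRingHom a).coeff 0 = 0 := by
      rw [← D.divE_mul a, ← WittVector.constantCoeff_apply, map_mul, map_mul,
        WittVector.constantCoeff_apply (D.kappaRingHom D.E), kappa_E_coeff_zero, mul_zero]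
    change WittVector.verschiebung ((D.kappaRingHom a).shift 1) =
      WittVector.verschiebung ((D.kappaRingHom D.E).shift 1 * D.kappaRingHom (D.σ (D.divE a)))
    rw [verschiebung_shift_one _ h0, ← frobenius_kappa, WittVector.verschiebung_mul_frobenius,
      verschiebung_shift_one _ D.kappa_E_coeff_zero, ← map_mul, mul_comm]
    exact congrArg D.kappaRingHom (D.divE_mul a).symm)

end MainDatum

end MainFrame

end WindowTheory

/-! Nilpotence of `V♯` acts as a contraction. Let `T` be a module with a `σ`-linear endomorphism
`φ`, and let `g : P → T` be linear with `g ∘ F₁ = φ ∘ g`. Then `g` factors through every iterate of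
`V♯` (`twistLift_iterV_eq`), so for nilpotent `P` it takes values in `𝔪^j T` for all `j`
(`map_mem_pow_smul_top`). For the same reason the equation `Y ∘ F₁ = D ∘ F₁ + φ ∘ Y` is solved by a
convergent series when `T` is complete (`exists_map_F₁_eq`).

Full faithfulness. Write `j` for the map `x ↦ 1 ⊗ x` from a window to its base change. As `ker π =
E𝔖`, the kernel of `j` lies in `Q` and is stable under `F₁`. Two homomorphisms with the same base
change differ by a map into this kernel that commutes with `F₁`, hence vanishes. Conversely let `ψ`
be a homomorphism between base changes `P₁'` and `P₂'`. Since `P₂' = Q₂' + j(P₂)`, the map `u⁻¹F₁'`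
induces a `σ`-linear endomorphism of `P₂'/j(P₂)`, so `ψ ∘ j` is topologically zero modulo `j(P₂)`.
The image of `ϰ` is closed by linear compactness of `𝔖` (`mem_range_kappa`), hence `ψ ∘ j` takes
values in `j(P₂)` and `ψ` lifts to a linear map `P₁ → P₂`. The defect of this lift with respect to
`F₁` lies in `ker j` and is removed by solving the equation above.

Essential surjectivity. In a basis adapted to a normal decomposition a window is an invertible
matrix. Descending a nilpotent window over `W(R)` then amounts to solving `κ(B) X Ψ = Φ(X)` with `B`
invertible over `𝔖` and `X ≡ 1` modulo `I_R` (`exists_solution`). Here `Φ(X) = 1 + κ(D) g(X - 1)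
κ(D')` is multiplicative, `g = u⁻¹f₁`, and `D' D = θ`. Starting from a lift of `Ψ` modulo `I_R`,
each stage applies `g` to the error, absorbs the part coming from `𝔖` into `B`, and carries the
remainder in `I_R` along. The remainder is multiplied by a growing product of Frobenius twists of
matrices which modulo `𝔪` represent `V♯`, so it tends to zero. Convergence in `W(R)` is measured by
the kernels of `W(R) → W_i(R/𝔪^i)`. -/

namespace WindowTheory

open IsLocalRing

/-! ### Linear compactness of complete noetherian local rings -/

section LinearlyCompact

/-- A complete noetherian local ring is linearly compact: a descending sequence of cosets of ideals
has a common point, up to closure. -/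
theorem exists_sub_mem_sup_pow {A : Type*} [CommRing A] [IsLocalRing A] [IsNoetherianRing A]
    [IsAdicComplete (maximalIdeal A) A] (B : ℕ → Ideal A) (hB : Antitone B) (s : ℕ → A)
    (hs : ∀ n m, n ≤ m → s m - s n ∈ B n) :
    ∃ t, ∀ n j, t - s n ∈ B n ⊔ maximalIdeal A ^ j := by
  -- The ring `A / 𝔪^j` is Artinian, so the images of the ideals `B n` in it are eventually
  -- constant.
  have stab : ∀ j, ∃ k, ∀ n, k ≤ n → B k ≤ B n ⊔ maximalIdeal A ^ j := by
    intro j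
    rcases Nat.eq_zero_or_pos j with rfl | hj
    · exact ⟨0, fun n _ => by simp⟩
    have hart : IsArtinianRing (A ⧸ maximalIdeal A ^ j) := by
      have : IsLocalRing (A ⧸ maximalIdeal A ^ j) :=
        haveI : Nontrivial (A ⧸ maximalIdeal A ^ j) := Ideal.Quotient.nontrivial_iff.2 fun h =>
          (maximalIdeal.isMaximal A).ne_top (top_le_iff.1 (h ▸ Ideal.pow_le_self hj.ne'))
        IsLocalRing.of_surjective' (Ideal.Quotient.mk _) Ideal.Quotient.mk_surjective
      refine (isArtinianRing_iff_isNilpotent_maximalIdeal _).2 ⟨j, ?_⟩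
      have h1 : maximalIdeal (A ⧸ maximalIdeal A ^ j) ≤
          (maximalIdeal A).map (Ideal.Quotient.mk (maximalIdeal A ^ j)) := by
        intro x hx
        obtain ⟨a, rfl⟩ := Ideal.Quotient.mk_surjective x
        refine Ideal.mem_map_of_mem _ ?_
        rw [mem_maximalIdeal, mem_nonunits_iff] at hx ⊢
        exact fun h => hx (h.map _)
      rw [Ideal.zero_eq_bot, eq_bot_iff]
      refine (Ideal.pow_right_mono h1 j).trans ?_
      rw [← Ideal.map_pow, Ideal.map_quotient_self]
    obtain ⟨k, hk⟩ := IsArtinian.monotone_stabilizes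
      (R := A ⧸ maximalIdeal A ^ j) (M := A ⧸ maximalIdeal A ^ j)
      ⟨fun n => OrderDual.toDual ((B n).map (Ideal.Quotient.mk (maximalIdeal A ^ j))),
        fun n m h => Ideal.map_mono (hB h)⟩
    refine ⟨k, fun n hn x hx => ?_⟩
    have h2 : (B k).map (Ideal.Quotient.mk (maximalIdeal A ^ j)) =
        (B n).map (Ideal.Quotient.mk (maximalIdeal A ^ j)) := hk n hn
    have h3 := Ideal.mem_map_of_mem (Ideal.Quotient.mk (maximalIdeal A ^ j)) hx
    rw [h2] at h3
    have h4 : x ∈ ((B n).map (Ideal.Quotient.mk (maximalIdeal A ^ j))).comap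
      (Ideal.Quotient.mk (maximalIdeal A ^ j)) := h3
    rwa [Ideal.comap_map_of_surjective' _ Ideal.Quotient.mk_surjective, Ideal.mk_ker] at h4
  choose k hk using stab
  -- An increasing sequence with `K j ≥ k j`; the summand `j` makes it unbounded, so that every `B
  -- n` is eventually reached.
  let K : ℕ → ℕ := fun j => j + ∑ i ∈ Finset.range (j + 1), k i
  have hKmono : ∀ j, K j ≤ K (j + 1) := fun j => by
    simp only [K]; rw [Finset.sum_range_succ _ (j + 1)]; omega
  have hKk : ∀ j, k j ≤ K j := fun j => by
    simp only [K]
    have := Finset.single_le_sum (f := k) (fun i _ => Nat.zero_le _)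
      (Finset.mem_range.2 (show j < j + 1 by omega))
    omega
  -- A point of one coset moves into the next at the cost of an element of `𝔪^j` only: the
  -- difference to `s (K (j + 1))` lies in `B (k j)`, and its component in `B (K (j + 1))` can be
  -- subtracted.
  have step : ∀ j (t : {t // t - s (K j) ∈ B (K j)}),
      ∃ t' : {t // t - s (K (j + 1)) ∈ B (K (j + 1))}, t'.1 - t.1 ∈ maximalIdeal A ^ j := by
    rintro j ⟨t, ht⟩
    have h1 : s (K (j + 1)) - t ∈ B (k j) := by
      have := Ideal.sub_mem _ (hs _ _ (hKmono j)) ht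
      rw [sub_sub_sub_cancel_right] at this
      exact hB (hKk j) this
    obtain ⟨b, hb, c, hc, hbc⟩ := Submodule.mem_sup.1 (hk j (K (j + 1))
      ((hKk j).trans (hKmono j)) h1)
    refine ⟨⟨s (K (j + 1)) - b, by rw [sub_sub_cancel_left]; exact neg_mem hb⟩, ?_⟩
    have : s (K (j + 1)) - b - t = c := by linear_combination -hbc
    simpa [this] using hc
  choose nx hnx using step
  let T : (j : ℕ) → {t // t - s (K j) ∈ B (K j)} := fun j =>
    Nat.rec ⟨s (K 0), by simp⟩ (fun j t => nx j t) j
  have hT : ∀ j, (T (j + 1)).1 - (T j).1 ∈ maximalIdeal A ^ j := fun j => hnx j (T j)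
  have hT' : ∀ m n, m ≤ n → (T n).1 - (T m).1 ∈ maximalIdeal A ^ m := by
    intro m n hmn
    induction n, hmn using Nat.le_induction with
    | base => simp
    | succ n hn ih =>
      rw [← sub_add_sub_cancel _ (T n).1]
      exact Ideal.add_mem _ (Ideal.pow_le_pow_right hn (hT n)) ih
  obtain ⟨L, hL⟩ := IsPrecomplete.prec (I := maximalIdeal A) (M := A) inferInstance
    (f := fun j => (T j).1) (fun {m n} hmn => by
      rw [SModEq.sub_mem, smul_eq_mul, Ideal.mul_top, ← neg_sub]
      exact neg_mem (hT' m n hmn))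
  refine ⟨L, fun n j => ?_⟩
  let i := max n j
  have h1 : L - (T i).1 ∈ maximalIdeal A ^ j := by
    have := hL i
    rw [SModEq.sub_mem, smul_eq_mul, Ideal.mul_top, ← neg_sub] at this
    exact Ideal.pow_le_pow_right (le_max_right n j) (neg_mem_iff.1 this)
  have hn : n ≤ K i := (le_max_left n j).trans (Nat.le_add_right _ _)
  have h2 : (T i).1 - s n ∈ B n := by
    rw [← sub_add_sub_cancel _ (s (K i))]
    exact Ideal.add_mem _ (hB hn (T i).2) (hs _ _ hn)
  rw [← sub_add_sub_cancel _ (T i).1, add_comm]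
  exact Submodule.add_mem_sup h2 h1

end LinearlyCompact

/-! ### Completeness of power series rings for the maximal ideal -/

section PowerSeries

variable {C : Type u} [CommRing C] {r : ℕ}

theorem coeff_eq_zero_of_mem_span_X_pow (n : ℕ) {f : MvPowerSeries (Fin r) C}
    (hf : f ∈ Ideal.span (Set.range (MvPowerSeries.X : Fin r → MvPowerSeries (Fin r) C)) ^ n) :
    ∀ d : Fin r →₀ ℕ, d.degree < n → MvPowerSeries.coeff d f = 0 := by
  induction n generalizing f with
  | zero => intro d hd; omega
  | succ n ih =>
    rw [pow_succ] at hf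
    refine Submodule.mul_induction_on hf (fun a ha b hb d hd => ?_) (fun a b ha hb d hd => ?_)
    · rw [MvPowerSeries.coeff_mul]
      refine Finset.sum_eq_zero fun x hx => ?_
      have hx' := Finset.HasAntidiagonal.mem_antidiagonal.1 hx
      by_cases h : x.1.degree < n
      · rw [ih ha _ h, zero_mul]
      · have h2 : x.1.degree + x.2.degree = d.degree := by rw [← hx', map_add]
        have h3 : x.2 = 0 := (Finsupp.degree_eq_zero_iff _).1 (by omega)
        have h4 := constantCoeff_eq_zero_of_mem_span_X hb
        rw [h3, MvPowerSeries.coeff_zero_eq_constantCoeff_apply, h4, mul_zero]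
    · rw [map_add, ha d hd, hb d hd, add_zero]

/-- A power series is the limit of its truncations for the `(X)`-adic topology: the truncations form
a Cauchy sequence, and comparing coefficients identifies the limit. If the low coefficients vanish,
the truncation at `n` is zero and `f` equals its own error term. -/
theorem mem_span_X_pow_of_coeff_eq_zero (n : ℕ) {f : MvPowerSeries (Fin r) C}
    (hf : ∀ d : Fin r →₀ ℕ, d.degree < n → MvPowerSeries.coeff d f = 0) :
    f ∈ Ideal.span (Set.range (MvPowerSeries.X : Fin r → MvPowerSeries (Fin r) C)) ^ n := by
  set J := Ideal.span (Set.range (MvPowerSeries.X : Fin r → MvPowerSeries (Fin r) C)) with hJ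
  have hcoe : ∀ k (g : MvPolynomial (Fin r) C), g ∈ MvPolynomial.idealOfVars (Fin r) C ^ k →
      (g : MvPowerSeries (Fin r) C) ∈ J ^ k := by
    intro k g hg
    have h1 := Ideal.mem_map_of_mem (MvPolynomial.coeToMvPowerSeries.ringHom) hg
    have h2 : Ideal.map MvPolynomial.coeToMvPowerSeries.ringHom
        (MvPolynomial.idealOfVars (Fin r) C) ≤ J := by
      rw [Ideal.map_span, Ideal.span_le]
      rintro _ ⟨_, ⟨i, rfl⟩, rfl⟩
      refine Ideal.subset_span ⟨i, ?_⟩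
      exact (MvPolynomial.coe_X i).symm
    rw [Ideal.map_pow] at h1
    exact Ideal.pow_right_mono h2 k h1
  obtain ⟨L, hL⟩ := IsPrecomplete.prec (I := J) (M := MvPowerSeries (Fin r) C) inferInstance
    (f := fun k => ((MvPowerSeries.truncTotal k f : MvPolynomial (Fin r) C) :
      MvPowerSeries (Fin r) C)) (fun {m k} hmk => by
      rw [SModEq.sub_mem, smul_eq_mul, Ideal.mul_top]
      have h := map_sub (MvPolynomial.coeToMvPowerSeries.ringHom (σ := Fin r) (R := C))
        (MvPowerSeries.truncTotal m f) (MvPowerSeries.truncTotal k f)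
      simp only [MvPolynomial.coeToMvPowerSeries.ringHom_apply] at h
      rw [← h]
      exact hcoe _ _ (MvPowerSeries.truncTotal_sub_truncTotal_mem_pow_idealOfVars le_rfl hmk f))
  have hL' : ∀ k, ((MvPowerSeries.truncTotal k f : MvPolynomial (Fin r) C) :
      MvPowerSeries (Fin r) C) - L ∈ J ^ k := fun k => by
    have := hL k
    rwa [SModEq.sub_mem, smul_eq_mul, Ideal.mul_top] at this
  have hLf : L = f := by
    ext d
    have h1 := coeff_eq_zero_of_mem_span_X_pow _ (hL' (d.degree + 1)) d (Nat.lt_succ_self _)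
    rw [map_sub, MvPolynomial.coeff_coe, MvPowerSeries.coeff_truncTotal _ (Nat.lt_succ_self _),
      sub_eq_zero] at h1
    exact h1.symm
  have h2 := hL' n
  rw [hLf] at h2
  have h3 : MvPowerSeries.truncTotal n f = 0 := by
    ext d
    rw [MvPolynomial.coeff_zero]
    rcases lt_or_ge d.degree n with h | h
    · rw [MvPowerSeries.coeff_truncTotal _ h, hf d h]
    · rw [MvPowerSeries.coeff_truncTotal_eq_zero _ h]
  rw [h3, MvPolynomial.coe_zero, zero_sub] at h2
  exact neg_mem_iff.1 h2

variable [IsLocalRing C] {c : C}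

theorem maximalIdeal_mvPowerSeries (hc : maximalIdeal C = Ideal.span {c}) :
    maximalIdeal (MvPowerSeries (Fin r) C) = Ideal.span {MvPowerSeries.C c} ⊔
      Ideal.span (Set.range (MvPowerSeries.X : Fin r → MvPowerSeries (Fin r) C)) := by
  apply le_antisymm
  · intro f hf
    have h1 : MvPowerSeries.constantCoeff f ∈ maximalIdeal C := by
      rw [mem_maximalIdeal, mem_nonunits_iff] at hf ⊢
      rwa [MvPowerSeries.isUnit_iff_constantCoeff] at hf
    rw [hc] at h1
    obtain ⟨b, hb⟩ := Ideal.mem_span_singleton'.1 h1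
    rw [← sub_add_cancel f (MvPowerSeries.C (MvPowerSeries.constantCoeff f)), add_comm]
    refine Submodule.add_mem_sup ?_ (mem_span_X_of_constantCoeff_eq_zero _ (by simp))
    rw [← hb, map_mul]
    exact Ideal.mul_mem_left _ _ (Ideal.mem_span_singleton_self _)
  · refine sup_le (Ideal.span_le.2 ?_) (Ideal.span_le.2 ?_)
    · rintro _ rfl
      rw [SetLike.mem_coe, mem_maximalIdeal, mem_nonunits_iff,
        MvPowerSeries.isUnit_iff_constantCoeff, MvPowerSeries.constantCoeff_C,
        ← mem_nonunits_iff, ← mem_maximalIdeal, hc]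
      exact Ideal.mem_span_singleton_self _
    · rintro _ ⟨i, rfl⟩
      rw [SetLike.mem_coe, mem_maximalIdeal, mem_nonunits_iff,
        MvPowerSeries.isUnit_iff_constantCoeff, MvPowerSeries.constantCoeff_X]
      exact not_isUnit_zero

/-- A product of `2n` generators contains `n` factors `c` or `n` variables. Thus the powers of `𝔪`
are cofinal with the ideals `(c)^n + (X)^n`, which are described by conditions on coefficients. -/
theorem maximalIdeal_pow_two_mul_le (hc : maximalIdeal C = Ideal.span {c}) (n : ℕ) :
    maximalIdeal (MvPowerSeries (Fin r) C) ^ (2 * n) ≤ Ideal.span {MvPowerSeries.C c} ^ n ⊔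
      Ideal.span (Set.range (MvPowerSeries.X : Fin r → MvPowerSeries (Fin r) C)) ^ n := by
  rw [maximalIdeal_mvPowerSeries hc, two_mul]
  exact Ideal.sup_pow_add_le_pow_sup_pow

theorem coeff_mem_of_mem_sup {n : ℕ} {f : MvPowerSeries (Fin r) C}
    (hf : f ∈ Ideal.span {MvPowerSeries.C c} ^ n ⊔
      Ideal.span (Set.range (MvPowerSeries.X : Fin r → MvPowerSeries (Fin r) C)) ^ n)
    (d : Fin r →₀ ℕ) (hd : d.degree < n) :
    MvPowerSeries.coeff d f ∈ Ideal.span {c} ^ n := by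
  obtain ⟨a, ha, b, hb, rfl⟩ := Submodule.mem_sup.1 hf
  rw [map_add, coeff_eq_zero_of_mem_span_X_pow n hb d hd, add_zero]
  rw [Ideal.span_singleton_pow] at ha ⊢
  obtain ⟨g, rfl⟩ := Ideal.mem_span_singleton'.1 ha
  rw [← map_pow, MvPowerSeries.coeff_mul_C]
  exact Ideal.mul_mem_left _ _ (Ideal.mem_span_singleton_self _)

theorem mem_sup_of_coeff_mem {n : ℕ} {f : MvPowerSeries (Fin r) C}
    (hf : ∀ d : Fin r →₀ ℕ, d.degree < n → MvPowerSeries.coeff d f ∈ Ideal.span {c} ^ n) :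
    f ∈ Ideal.span {MvPowerSeries.C c} ^ n ⊔
      Ideal.span (Set.range (MvPowerSeries.X : Fin r → MvPowerSeries (Fin r) C)) ^ n := by
  have h : ∀ d : Fin r →₀ ℕ, ∃ b, d.degree < n → b * c ^ n = MvPowerSeries.coeff d f := by
    intro d
    by_cases hd : d.degree < n
    · have := hf d hd
      rw [Ideal.span_singleton_pow] at this
      obtain ⟨b, hb⟩ := Ideal.mem_span_singleton'.1 this
      exact ⟨b, fun _ => hb⟩
    · exact ⟨0, fun h => absurd h hd⟩
  choose g hg using h
  let G : MvPowerSeries (Fin r) C := g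
  rw [← add_sub_cancel (G * MvPowerSeries.C (c ^ n)) f]
  refine Submodule.add_mem_sup ?_ (mem_span_X_pow_of_coeff_eq_zero n fun d hd => ?_)
  · rw [Ideal.span_singleton_pow, ← map_pow]
    exact Ideal.mul_mem_left _ _ (Ideal.mem_span_singleton_self _)
  · rw [map_sub, MvPowerSeries.coeff_mul_C, ← hg d hd]
    exact sub_self _

/-- Power series over a complete local ring with principal maximal ideal form a complete local
ring. -/
theorem isAdicComplete_mvPowerSeries (hc : maximalIdeal C = Ideal.span {c})
    [IsAdicComplete (maximalIdeal C) C] :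
    IsAdicComplete (maximalIdeal (MvPowerSeries (Fin r) C)) (MvPowerSeries (Fin r) C) where
  haus' f hf := by
    ext d
    rw [map_zero]
    refine IsHausdorff.haus (I := maximalIdeal C) inferInstance _ fun n => ?_
    -- The index must exceed the degree of `d` for the coefficient to be controlled, and be at least
    -- `n` for the required power of `c`.
    have h1 := hf (2 * (n + d.degree + 1))
    rw [SModEq.sub_mem, smul_eq_mul, Ideal.mul_top, sub_zero] at h1 ⊢
    have h2 := coeff_mem_of_mem_sup (maximalIdeal_pow_two_mul_le hc _ h1) d (by omega)
    rw [hc]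
    exact Ideal.pow_le_pow_right (by omega) h2
  prec' f hf := by
    have hf' : ∀ m n, m ≤ n → f m - f n ∈ maximalIdeal (MvPowerSeries (Fin r) C) ^ m := by
      intro m n h
      have := hf h
      rwa [SModEq.sub_mem, smul_eq_mul, Ideal.mul_top] at this
    -- The limit is formed coefficientwise in `C`, along the even-indexed subsequence.
    have key : ∀ d : Fin r →₀ ℕ, ∃ L : C, ∀ n, d.degree < n →
        MvPowerSeries.coeff d (f (2 * n)) - L ∈ Ideal.span {c} ^ n := by
      intro d
      have hd : ∀ m n, d.degree < m → m ≤ n → MvPowerSeries.coeff d (f (2 * m)) -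
          MvPowerSeries.coeff d (f (2 * n)) ∈ Ideal.span {c} ^ m := by
        intro m n hm hmn
        rw [← map_sub]
        exact coeff_mem_of_mem_sup (maximalIdeal_pow_two_mul_le hc _ (hf' _ _ (by omega))) d hm
      obtain ⟨L, hL⟩ := IsPrecomplete.prec (I := maximalIdeal C) (M := C) inferInstance
        (f := fun n => MvPowerSeries.coeff d (f (2 * (n + d.degree + 1)))) (fun {m n} hmn => by
          rw [SModEq.sub_mem, smul_eq_mul, Ideal.mul_top, hc]
          exact Ideal.pow_le_pow_right (by omega) (hd _ _ (by omega) (by omega)))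
      refine ⟨L, fun n hn => ?_⟩
      have h1 := hL n
      rw [SModEq.sub_mem, smul_eq_mul, Ideal.mul_top, hc] at h1
      rw [← sub_add_sub_cancel]
      exact Ideal.add_mem _ (hd _ _ hn (by omega)) h1
    choose L hL using key
    let L' : MvPowerSeries (Fin r) C := L
    refine ⟨L', fun n => ?_⟩
    rw [SModEq.sub_mem, smul_eq_mul, Ideal.mul_top]
    rw [← sub_add_sub_cancel _ (f (2 * n))]
    refine Ideal.add_mem _ (hf' _ _ (by omega)) ?_
    have h1 : f (2 * n) - L' ∈ Ideal.span {MvPowerSeries.C c} ^ n ⊔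
      Ideal.span (Set.range (MvPowerSeries.X : Fin r → MvPowerSeries (Fin r) C)) ^ n :=
      mem_sup_of_coeff_mem fun d hd => by
        rw [map_sub]
        exact hL d n hd
    have h2 := maximalIdeal_mvPowerSeries (r := r) hc
    have h3 : Ideal.span {MvPowerSeries.C c} ^ n ⊔
        Ideal.span (Set.range (MvPowerSeries.X : Fin r → MvPowerSeries (Fin r) C)) ^ n ≤
        maximalIdeal (MvPowerSeries (Fin r) C) ^ n :=
      sup_le (Ideal.pow_right_mono (h2 ▸ le_sup_left) n)
        (Ideal.pow_right_mono (h2 ▸ le_sup_right) n)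
    exact h3 h1

end PowerSeries

/-! ### The topology of `W(R)` given by the kernels of `W(R) → W_i(R/𝔪^i)` -/

section WittFiltration

variable {p : ℕ} [hp : Fact p.Prime] {R : Type u} [CommRing R] [IsLocalRing R]

/-- The kernel of `W(R) → W_i(R / 𝔪^i)`, where `𝔪` is the maximal ideal of `R`. -/
noncomputable def wittFil (p : ℕ) [Fact p.Prime] (R : Type u) [CommRing R] [IsLocalRing R] (i : ℕ) :
    Ideal (WittVector p R) :=
  RingHom.ker ((WittVector.truncate (p := p) (R := R ⧸ maximalIdeal R ^ i) i).comp
    (WittVector.map (Ideal.Quotient.mk (maximalIdeal R ^ i))))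

theorem mem_wittFil_iff {i : ℕ} {w : WittVector p R} :
    w ∈ wittFil p R i ↔ ∀ j < i, w.coeff j ∈ maximalIdeal R ^ i := by
  have h : w ∈ wittFil p R i ↔ WittVector.map (Ideal.Quotient.mk (maximalIdeal R ^ i)) w ∈
    RingHom.ker (WittVector.truncate (p := p) (R := R ⧸ maximalIdeal R ^ i) i) := Iff.rfl
  rw [h, WittVector.mem_ker_truncate]
  simp only [WittVector.map_coeff, Ideal.Quotient.eq_zero_iff_mem]

/-- Subtraction of Witt vectors is not componentwise, but congruence modulo the kernel of a
truncation means equality of the first `i` components over `R/𝔪^i`. -/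
theorem sub_mem_wittFil_iff {i : ℕ} {w v : WittVector p R} :
    w - v ∈ wittFil p R i ↔ ∀ j < i, w.coeff j - v.coeff j ∈ maximalIdeal R ^ i := by
  have h : w - v ∈ wittFil p R i ↔ WittVector.map (Ideal.Quotient.mk (maximalIdeal R ^ i)) (w - v) ∈
    RingHom.ker (WittVector.truncate (p := p) (R := R ⧸ maximalIdeal R ^ i) i) := Iff.rfl
  rw [h, WittVector.mem_ker_truncate, map_sub, ← WittVector.le_coeff_eq_iff_le_sub_coeff_eq_zero]
  simp only [WittVector.map_coeff, Ideal.Quotient.eq]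

theorem wittFil_antitone : Antitone (wittFil p R) := fun _ _ h _ hw =>
  mem_wittFil_iff.2 fun j hj =>
    Ideal.pow_le_pow_right h (mem_wittFil_iff.1 hw j (hj.trans_le h))

theorem eq_zero_of_mem_wittFil [IsAdicComplete (maximalIdeal R) R] {w : WittVector p R}
    (h : ∀ i, w ∈ wittFil p R i) : w = 0 := by
  ext j
  rw [WittVector.zero_coeff]
  refine IsHausdorff.haus (I := maximalIdeal R) inferInstance _ fun n => ?_
  rw [SModEq.sub_mem, smul_eq_mul, Ideal.mul_top, sub_zero]
  exact Ideal.pow_le_pow_right (by omega) (mem_wittFil_iff.1 (h (n + j + 1)) j (by omega))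

theorem shift_mem_wittFil {i : ℕ} {w : WittVector p R} (h : w ∈ wittFil p R (i + 1)) :
    w.shift 1 ∈ wittFil p R i :=
  mem_wittFil_iff.2 fun j hj => by
    rw [WittVector.shift_coeff]
    exact Ideal.pow_le_pow_right (Nat.le_succ i) (mem_wittFil_iff.1 h (1 + j) (by omega))

/-- Congruences modulo the filtration can be read off componentwise, so the limit is assembled from
limits of components in `R`, along the subsequence `K` whose terms from the `m`-th on agree modulo
the `m`-th step. -/
theorem exists_limit_wittFil [IsAdicComplete (maximalIdeal R) R] (w : ℕ → WittVector p R)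
    (h : ∀ i, ∃ n₀, ∀ n ≥ n₀, w (n + 1) - w n ∈ wittFil p R i) :
    ∃ L, ∀ i, ∃ n₀, ∀ n ≥ n₀, w n - L ∈ wittFil p R i := by
  choose k hk using h
  have hk' : ∀ i m n, k i ≤ m → m ≤ n → w n - w m ∈ wittFil p R i := by
    intro i m n hm hmn
    induction n, hmn using Nat.le_induction with
    | base => simp
    | succ n hn ih =>
      rw [← sub_add_sub_cancel _ (w n)]
      exact Ideal.add_mem _ (hk i n (hm.trans hn)) ih
  let K : ℕ → ℕ := fun j => ∑ i ∈ Finset.range (j + 1), k i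
  have hkK : ∀ j, k j ≤ K j := fun j =>
    Finset.single_le_sum (f := k) (fun i _ => Nat.zero_le _)
      (Finset.mem_range.2 (show j < j + 1 by omega))
  have hK : Monotone K := fun a b hab =>
    Finset.sum_le_sum_of_subset (Finset.range_mono (by omega))
  have hv : ∀ m n, m ≤ n → w (K n) - w (K m) ∈ wittFil p R m := fun m n hmn =>
    hk' m _ _ (hkK m) (hK hmn)
  have hL : ∀ j, ∃ l : R, ∀ m, j < m → (w (K m)).coeff j - l ∈ maximalIdeal R ^ m := by
    intro j
    have hc : ∀ m n, j < m → m ≤ n → (w (K m)).coeff j - (w (K n)).coeff j ∈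
        maximalIdeal R ^ m := fun m n hj hmn => by
      have := sub_mem_wittFil_iff.1 (hv m n hmn) j hj
      rw [← neg_sub]
      exact neg_mem this
    obtain ⟨l, hl⟩ := IsPrecomplete.prec (I := maximalIdeal R) (M := R) inferInstance
      (f := fun n => (w (K (n + j + 1))).coeff j) (fun {m n} hmn => by
        rw [SModEq.sub_mem, smul_eq_mul, Ideal.mul_top]
        exact Ideal.pow_le_pow_right (by omega) (hc _ _ (by omega) (by omega)))
    refine ⟨l, fun m hm => ?_⟩
    have h1 := hl m
    rw [SModEq.sub_mem, smul_eq_mul, Ideal.mul_top] at h1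
    rw [← sub_add_sub_cancel]
    exact Ideal.add_mem _ (hc m (m + j + 1) hm (by omega)) h1
  choose l hl using hL
  refine ⟨WittVector.mk p l, fun i => ⟨K i, fun n hn => ?_⟩⟩
  rw [← sub_add_sub_cancel _ (w (K i))]
  refine Ideal.add_mem _ (hk' i _ _ (hkK i) hn) (sub_mem_wittFil_iff.2 fun j hj => ?_)
  rw [WittVector.coeff_mk]
  exact hl j i hj

/-- Powers of `z` are pushed up the Verschiebung filtration. If `zⁿ ≡ V^(j+1) c`, the relation `V^m
x · V^m y = V^m (p^m x y)` makes the `(i+1)`-st power of the right side equal to `V^(j+1)` of a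
multiple of `p^i`. Its leading component lies in `𝔪^i` and can be dropped, which gains one more `V`.
-/
theorem exists_pow_mem_wittFil (hpR : (p : R) ∈ maximalIdeal R) (z : WittVector p R)
    (hz : z.coeff 0 ∈ maximalIdeal R) (i : ℕ) : ∃ n, z ^ n ∈ wittFil p R i := by
  have teich : ∀ (j : ℕ) (y : WittVector p R), y.coeff 0 ∈ maximalIdeal R ^ i →
      ∃ c, WittVector.verschiebung^[j] y - WittVector.verschiebung^[j + 1] c ∈ wittFil p R i := by
    intro j y hy
    refine ⟨(y - WittVector.teichmuller p (y.coeff 0)).shift 1, ?_⟩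
    have h0 := map_sub (WittVector.constantCoeff (p := p) (R := R)) y
      (WittVector.teichmuller p (y.coeff 0))
    simp only [WittVector.constantCoeff_apply, WittVector.teichmuller_coeff_zero, sub_self] at h0
    rw [Function.iterate_succ_apply, verschiebung_shift_one _ h0, iterate_map_sub, sub_sub_cancel]
    refine mem_wittFil_iff.2 fun k _ => ?_
    rcases lt_trichotomy k j with h | h | h
    · rw [WittVector.iterate_verschiebung_coeff_eq_zero _ h]
      exact Ideal.zero_mem _
    · have := WittVector.iterate_verschiebung_coeff (WittVector.teichmuller p (y.coeff 0)) j 0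
      rw [zero_add] at this
      rw [h, this, WittVector.teichmuller_coeff_zero]
      exact hy
    · obtain ⟨m, rfl⟩ : ∃ m, k = (m + 1) + j := ⟨k - j - 1, by omega⟩
      rw [WittVector.iterate_verschiebung_coeff, WittVector.teichmuller_coeff_pos _ _ _ (by omega)]
      exact Ideal.zero_mem _
  have key : ∀ j, ∃ n c, z ^ n - WittVector.verschiebung^[j + 1] c ∈ wittFil p R i := by
    intro j
    induction j with
    | zero =>
      obtain ⟨c, hc⟩ := teich 0 (z ^ i) (by
        rw [← WittVector.constantCoeff_apply, map_pow]
        exact Ideal.pow_mem_pow hz i)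
      exact ⟨i, c, hc⟩
    | succ j ih =>
      obtain ⟨n, c, hc⟩ := ih
      have hpow : ∀ m, ∃ d : WittVector p R, (WittVector.verschiebung^[j + 1] c) ^ (m + 1) =
          WittVector.verschiebung^[j + 1] ((p : WittVector p R) ^ m * d) := by
        intro m
        induction m with
        | zero => exact ⟨c, by simp⟩
        | succ m ih =>
          obtain ⟨d, hd⟩ := ih
          refine ⟨p ^ j * (d * c), ?_⟩
          rw [pow_succ, hd, iterate_verschiebung_mul_self, nsmul_eq_mul]
          congr 1
          push_cast
          ring
      obtain ⟨d, hd⟩ := hpow i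
      obtain ⟨e, he⟩ := teich (j + 1) ((p : WittVector p R) ^ i * d) (by
        rw [← WittVector.constantCoeff_apply, map_mul, map_pow, map_natCast]
        exact Ideal.mul_mem_right _ _ (Ideal.pow_mem_pow hpR i))
      refine ⟨n * (i + 1), e, ?_⟩
      rw [← sub_add_sub_cancel _ ((WittVector.verschiebung^[j + 1] c) ^ (i + 1))]
      refine Ideal.add_mem _ ?_ (hd ▸ he)
      rw [pow_mul]
      exact Ideal.mem_of_dvd _ (sub_dvd_pow_sub_pow _ _ _) hc
  obtain ⟨n, c, hc⟩ := key i
  refine ⟨n, ?_⟩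
  rw [← sub_add_cancel (z ^ n) (WittVector.verschiebung^[i + 1] c)]
  refine Ideal.add_mem _ hc (mem_wittFil_iff.2 fun j hj => ?_)
  rw [WittVector.iterate_verschiebung_coeff_eq_zero _ (by omega)]
  exact Ideal.zero_mem _

/-- Elements of `J` become nilpotent modulo each step of the filtration; as `J` is finitely
generated, its image there is a nilpotent ideal. This yields the continuity of `ϰ`. -/
theorem exists_map_pow_mem_wittFil (hpR : (p : R) ∈ maximalIdeal R) {A : Type*} [CommRing A]
    (J : Ideal A) (hJ : J.FG) (f : A →+* WittVector p R)
    (hf : ∀ a ∈ J, (f a).coeff 0 ∈ maximalIdeal R) (i : ℕ) :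
    ∃ q, ∀ a ∈ J ^ q, f a ∈ wittFil p R i := by
  let g : A →+* WittVector p R ⧸ wittFil p R i := (Ideal.Quotient.mk _).comp f
  have h1 : IsNilpotent (J.map g) := by
    rw [Ideal.FG.isNilpotent_iff_le_nilradical (hJ.map g), Ideal.map_le_iff_le_comap]
    intro a ha
    obtain ⟨n, hn⟩ := exists_pow_mem_wittFil hpR (f a) (hf a ha) i
    refine ⟨n, ?_⟩
    change (Ideal.Quotient.mk _ (f a)) ^ n = 0
    rw [← map_pow, Ideal.Quotient.eq_zero_iff_mem]
    exact hn
  obtain ⟨q, hq⟩ := h1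
  refine ⟨q, fun a ha => Ideal.Quotient.eq_zero_iff_mem.1 ?_⟩
  have h2 := Ideal.mem_map_of_mem g ha
  rw [Ideal.map_pow, hq] at h2
  exact h2

end WittFiltration

/-- The module is a quotient of `S^k`, and the `n`-th difference of a Cauchy sequence lifts to a
vector with entries in `J^n`. The lifted series converges coordinatewise. -/
theorem isPrecomplete_of_finite {S : Type*} [CommRing S] (J : Ideal S) [IsPrecomplete J S]
    (T : Type*) [AddCommGroup T] [Module S T] [Module.Finite S T] : IsPrecomplete J T where
  prec' f hf := by
    obtain ⟨k, π, hπ⟩ := Module.Finite.exists_fin' S T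
    have hd : ∀ n, ∃ d ∈ J ^ n • (⊤ : Submodule S (Fin k → S)), π d = f (n + 1) - f n := by
      intro n
      have h1 : f (n + 1) - f n ∈ J ^ n • (⊤ : Submodule S T) :=
        SModEq.sub_mem.1 (hf (Nat.le_succ n)).symm
      rw [← LinearMap.range_eq_top.2 hπ, LinearMap.range_eq_map, ← Submodule.map_smul''] at h1
      exact h1
    choose d hd hd' using hd
    have hcoord : ∀ n, ∀ x ∈ J ^ n • (⊤ : Submodule S (Fin k → S)), ∀ i, x i ∈ J ^ n := by
      intro n x hx i
      refine Submodule.smul_induction_on hx (fun a ha y _ => ?_) (fun y z hy hz => ?_)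
      · exact Ideal.mul_mem_right _ _ ha
      · exact Ideal.add_mem _ hy hz
    have hsum : ∀ i m n, m ≤ n → ∑ l ∈ Finset.range m, d l i - ∑ l ∈ Finset.range n, d l i
        ∈ J ^ m := by
      intro i m n hmn
      rw [← neg_sub, neg_mem_iff, ← Finset.sum_Ico_eq_sub _ hmn]
      refine Ideal.sum_mem _ fun l hl => ?_
      exact Ideal.pow_le_pow_right (Finset.mem_Ico.1 hl).1 (hcoord _ _ (hd l) i)
    have hlim : ∀ i, ∃ L : S, ∀ n, ∑ l ∈ Finset.range n, d l i - L ∈ J ^ n := by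
      intro i
      obtain ⟨L, hL⟩ := IsPrecomplete.prec (I := J) (M := S) inferInstance
        (f := fun n => ∑ l ∈ Finset.range n, d l i) (fun {m n} hmn => by
          rw [SModEq.sub_mem, smul_eq_mul, Ideal.mul_top]
          exact hsum i m n hmn)
      refine ⟨L, fun n => ?_⟩
      have := hL n
      rwa [SModEq.sub_mem, smul_eq_mul, Ideal.mul_top] at this
    choose L hL using hlim
    refine ⟨f 0 + π L, fun n => ?_⟩
    have h1 : f n = f 0 + π (∑ l ∈ Finset.range n, d l) := by
      rw [map_sum, Finset.sum_congr rfl fun l _ => hd' l, Finset.sum_range_sub]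
      abel
    rw [SModEq.sub_mem, h1, add_sub_add_left_eq_sub, ← map_sub]
    have h2 : ∑ l ∈ Finset.range n, d l - L ∈ J ^ n • (⊤ : Submodule S (Fin k → S)) := by
      rw [pi_eq_sum_univ' (∑ l ∈ Finset.range n, d l - L)]
      refine Submodule.sum_mem _ fun i _ => Submodule.smul_mem_smul ?_ trivial
      rw [Pi.sub_apply, Finset.sum_apply]
      exact hL i n
    have h3 := Submodule.mem_map_of_mem (f := π) h2
    rw [Submodule.map_smul''] at h3
    exact Submodule.smul_mono le_rfl le_top h3

/-! ### Iterates of `V♯` as a contraction -/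

namespace Window

open CategoryTheory ChangeOfRings TensorProduct

variable {p : ℕ} {S : Type u} [CommRing S] {F : Frame p S}

section linearize

variable {A B : Type u} [CommRing A] [CommRing B] (f : A →+* B) {M N : ModuleCat.{u} A}

/-- The pure tensor `b ⊗ x` in the extension of scalars of `M` along `f`. -/
noncomputable def tw (b : B) (x : M) : (ModuleCat.extendScalars f).obj M := b ⊗ₜ[A, f] x

theorem tw_add (b : B) (x y : M) : tw f b (x + y) = tw f b x + tw f b y := by
  let := Module.compHom B f
  exact TensorProduct.tmul_add (R := A) b x y

theorem smul_tw (b c : B) (x : M) : b • tw f c x = tw f (b * c) x := rfl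

theorem tw_smul (b : B) (a : A) (x : M) : tw f b (a • x) = tw f (b * f a) x := by
  let := Module.compHom B f
  rw [mul_comm]
  exact (TensorProduct.smul_tmul (R := A) a b x).symm

theorem map_tw (g : M ⟶ N) (b : B) (x : M) :
    ((ModuleCat.extendScalars f).map g).hom (tw f b x) = tw f b (g.hom x) := rfl

variable {f} in
theorem tw_induction {C : (ModuleCat.extendScalars f).obj M → Prop} (h0 : C 0)
    (ht : ∀ (b : B) (x : M), C (tw f b x)) (ha : ∀ x y, C x → C y → C (x + y)) (z) : C z := by
  exact TensorProduct.induction_on (R := A)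
    (M := (ModuleCat.restrictScalars f).obj (ModuleCat.of B B)) (N := M) (motive := C) z h0 ht ha

variable {f} {T : Type u} [AddCommGroup T] [Module B T]

/-- The linear map `B ⊗ M → T`, `b ⊗ x ↦ b • h x`, attached to a semilinear map `h`. -/
noncomputable def linearize (h : M →ₛₗ[f] T) : (ModuleCat.extendScalars f).obj M →ₗ[B] T :=
  (ModuleCat.ExtendRestrictScalarsAdj.HomEquiv.fromExtendScalars f (X := M) (Y := ModuleCat.of B T)
    (ModuleCat.ofHom (Y := (ModuleCat.restrictScalars f).obj (ModuleCat.of B T))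
      { toFun := h, map_add' := map_add h, map_smul' := h.map_smulₛₗ })).hom

theorem linearize_tw (h : M →ₛₗ[f] T) (b : B) (x : M) : linearize h (tw f b x) = b • h x := rfl

theorem linearize_map (g : M ⟶ N) (h : N →ₛₗ[f] T) (z : (ModuleCat.extendScalars f).obj M) :
    linearize h (((ModuleCat.extendScalars f).map g).hom z) = linearize (h.comp g.hom) z := by
  refine tw_induction (M := M) (C := fun z => linearize h (((ModuleCat.extendScalars f).map g).hom z) =
    linearize (h.comp g.hom) z) ?_ (fun s x => ?_) (fun x y hx hy => ?_) z
  · rw [map_zero, map_zero, map_zero]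
  · rfl
  · rw [map_add, map_add, map_add, hx, hy]

end linearize

section iterLin

variable (P : Window F) (V : P.twist 0 ⟶ P.twist 1)

/-- The linear map `V♯`. -/
noncomputable def vLin : P.P →ₗ[S] (ModuleCat.extendScalars F.σ).obj (ModuleCat.of S P.P) := V.hom

/-- The iterate `(V♯)^n` as a linear map. -/
noncomputable def iterLin (n : ℕ) : P.P →ₗ[S] P.twist n := (P.iterV V n).hom

theorem isVSharp_iff : P.IsVSharp V ↔
    ∀ x : P.Q, P.vLin V (P.F₁ x) = tw (M := ModuleCat.of S P.P) F.σ 1 (x : P.P) := Iff.rfl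

theorem iterLin_succ (n : ℕ) (x : P.P) : P.iterLin V (n + 1) x =
    ((ModuleCat.extendScalars F.σ).map (ModuleCat.ofHom (P.iterLin V n))).hom (P.vLin V x) := rfl

end iterLin

section twistLift

variable (P : Window F) {T : Type u} [AddCommGroup T] [Module S T] (φ : T →ₛₗ[F.σ] T)

/-- The extension of a linear map `g : P → T` to the twists of `P`, along a `σ`-linear
endomorphism `φ` of `T`: on `P^(σ^n)` it is `s₁ ⊗ ⋯ ⊗ sₙ ⊗ x ↦ s₁ • φ (s₂ • ⋯ φ (g x))`. -/
noncomputable def twistLift (g : P.P →ₗ[S] T) : (n : ℕ) → (P.twist n →ₗ[S] T)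
  | 0 => g
  | n + 1 => linearize (φ.comp (twistLift g n))

theorem twistLift_succ_tw (g : P.P →ₗ[S] T) (n : ℕ) (s : S) (x : P.twist n) :
    P.twistLift φ g (n + 1) (tw F.σ s x) = s • φ (P.twistLift φ g n x) := rfl

theorem twistLift_iterLin_succ (V : P.twist 0 ⟶ P.twist 1) (g : P.P →ₗ[S] T) (n : ℕ) (x : P.P) :
    P.twistLift φ g (n + 1) (P.iterLin V (n + 1) x) = linearize (M := ModuleCat.of S P.P)
      (φ.comp ((P.twistLift φ g n).comp (P.iterLin V n))) (P.vLin V x) := by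
  rw [iterLin_succ]
  exact linearize_map _ _ _

variable {P φ}

theorem map_mem_pow_smul {J : Ideal S} (hJ : ∀ a ∈ J, F.σ a ∈ J) (j : ℕ) {t : T}
    (ht : t ∈ J ^ j • (⊤ : Submodule S T)) : φ t ∈ J ^ j • (⊤ : Submodule S T) := by
  have h : J ^ j ≤ (J ^ j).comap F.σ := by
    rw [← Ideal.map_le_iff_le_comap, Ideal.map_pow]
    exact Ideal.pow_right_mono (Ideal.map_le_iff_le_comap.2 hJ) j
  refine Submodule.smul_induction_on ht (fun a ha t _ => ?_) (fun x y hx hy => ?_)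
  · rw [φ.map_smulₛₗ]
    exact Submodule.smul_mem_smul (h ha) trivial
  · rw [map_add]; exact Submodule.add_mem _ hx hy

theorem twistLift_mem {J : Ideal S} (hJ : ∀ a ∈ J, F.σ a ∈ J) {g : P.P →ₗ[S] T} {j : ℕ}
    (hg : ∀ x, g x ∈ J ^ j • (⊤ : Submodule S T)) (n : ℕ) (z : P.twist n) :
    P.twistLift φ g n z ∈ J ^ j • (⊤ : Submodule S T) := by
  induction n with
  | zero => exact hg z
  | succ n ih =>
    refine tw_induction (M := P.twist n)
      (C := fun z => linearize (φ.comp (P.twistLift φ g n)) z ∈ J ^ j • (⊤ : Submodule S T)) ?_ (fun s x => ?_) (fun x y hx hy => ?_) z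
    · rw [map_zero]; exact Submodule.zero_mem _
    · rw [linearize_tw]
      exact Submodule.smul_mem _ _ (map_mem_pow_smul hJ j (ih x))
    · rw [map_add]; exact Submodule.add_mem _ hx hy

/-- The contraction estimate: the extension of `g` to the twist still has values in `J^j T`, and
`(V♯)^n` contributes a further factor `J`. -/
theorem twistLift_iterV_mem {J : Ideal S} (hJ : ∀ a ∈ J, F.σ a ∈ J) {g : P.P →ₗ[S] T} {j : ℕ}
    (hg : ∀ x, g x ∈ J ^ j • (⊤ : Submodule S T)) {V : P.twist 0 ⟶ P.twist 1} {n : ℕ}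
    (hV : ∀ x, P.iterLin V n x ∈ J • (⊤ : Submodule S (P.twist n))) (x : P.P) :
    P.twistLift φ g n (P.iterLin V n x) ∈ J ^ (j + 1) • (⊤ : Submodule S T) := by
  have h1 := Submodule.mem_map_of_mem (f := P.twistLift φ g n) (hV x)
  rw [Submodule.map_smul''] at h1
  rw [pow_succ', Submodule.mul_smul]
  refine Submodule.smul_mono le_rfl ?_ h1
  rintro _ ⟨z, -, rfl⟩
  exact twistLift_mem hJ hg n z

/-- Compatibility with `F₁` says that `g` is a fixed point of the operator that extends a map to
`P^(σ)` along `φ` and composes with `V♯`; this is checked on the generators `F₁ q`, where `V♯ (F₁ q)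
= 1 ⊗ q`. -/
theorem twistLift_iterV_eq {V : P.twist 0 ⟶ P.twist 1} (hV : P.IsVSharp V) {g : P.P →ₗ[S] T}
    (hg : ∀ q : P.Q, g (P.F₁ q) = φ (g q)) (n : ℕ) (x : P.P) :
    P.twistLift φ g n (P.iterLin V n x) = g x := by
  induction n generalizing x with
  | zero => rfl
  | succ n ih =>
    rw [twistLift_iterLin_succ]
    have hx : x ∈ Submodule.span S (Set.range P.F₁) := by rw [P.span_F₁]; trivial
    induction hx using Submodule.span_induction with
    | mem y hy =>
      obtain ⟨q, rfl⟩ := hy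
      rw [(P.isVSharp_iff V).1 hV q, linearize_tw, one_smul, LinearMap.comp_apply, LinearMap.comp_apply, ih, hg]
    | zero => rw [map_zero, map_zero, map_zero]
    | add y z _ _ hy hz => rw [map_add, map_add, map_add, hy, hz]
    | smul c y _ hy => rw [map_smul, map_smul, map_smul, hy]

/-- A linear map from a nilpotent window compatible with `F₁` and a `σ`-linear endomorphism of the
target is topologically zero. -/
theorem map_mem_pow_smul_top {J : Ideal S} (hJ : ∀ a ∈ J, F.σ a ∈ J) (hP : IsNilpotent J P)
    {g : P.P →ₗ[S] T} (hg : ∀ q : P.Q, g (P.F₁ q) = φ (g q)) (j : ℕ) (x : P.P) :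
    g x ∈ J ^ j • (⊤ : Submodule S T) := by
  obtain ⟨V, hV, N, hN⟩ := hP
  induction j generalizing x with
  | zero => simp
  | succ j ih =>
    rw [← twistLift_iterV_eq hV hg N x]
    exact twistLift_iterV_mem hJ ih (hN N le_rfl) x

/-- Over a nilpotent window the equation `Y ∘ F₁ = D ∘ F₁ + φ ∘ Y` is solvable with values in a
complete module. -/
theorem exists_map_F₁_eq {J : Ideal S} (hJ : ∀ a ∈ J, F.σ a ∈ J) (hP : IsNilpotent J P)
    [IsAdicComplete J T] (D : P.P →ₗ[S] T) :
    ∃ Y : P.P →ₗ[S] T, ∀ q : P.Q, Y (P.F₁ q) = D (P.F₁ q) + φ (Y q) := by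
  obtain ⟨V, hV, N, hN⟩ := hP
  -- The terms of the solution `Y = ∑ U n`: one has `U 0 = D` and `U (n + 1) ∘ F₁ = φ ∘ U n`, so
  -- applying `φ` shifts the series by one.
  let U : ℕ → P.P →ₗ[S] T := fun n => (P.twistLift φ D n).comp (P.iterLin V n)
  have hU : ∀ n (q : P.Q), U (n + 1) (P.F₁ q) = φ (U n q) := by
    intro n q
    change P.twistLift φ D (n + 1) (P.iterLin V (n + 1) (P.F₁ q)) = _
    rw [twistLift_iterLin_succ, (P.isVSharp_iff V).1 hV q, linearize_tw, one_smul]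
    rfl
  have hspan : ∀ x : P.P, x ∈ Submodule.span S (Set.range P.F₁) := fun x => by
    rw [P.span_F₁]; trivial
  -- Passing from `U n` to `U (n + N)` is again an extension composed with `(V♯)^N`, so every `N`
  -- steps gain a power of `J`.
  have hUN : ∀ n x, U (n + N) x = P.twistLift φ (U n) N (P.iterLin V N x) := by
    intro n
    have : ∀ m x, U (n + m) x = P.twistLift φ (U n) m (P.iterLin V m x) := by
      intro m
      induction m with
      | zero => intro x; rfl
      | succ m ih =>
        intro x
        rw [twistLift_iterLin_succ]
        have hx := hspan x
        induction hx using Submodule.span_induction with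
        | mem y hy =>
          obtain ⟨q, rfl⟩ := hy
          rw [(P.isVSharp_iff V).1 hV q, linearize_tw, one_smul]
          change U (n + m + 1) (P.F₁ q) = φ (P.twistLift φ (U n) m (P.iterLin V m q))
          rw [← ih, ← hU]
        | zero => rw [map_zero, map_zero, map_zero]
        | add y z _ _ hy hz => rw [map_add, map_add, map_add, hy, hz]
        | smul c y _ hy => rw [map_smul, map_smul, map_smul, hy]
    exact this N
  have hmem : ∀ j n x, j * N ≤ n → U n x ∈ J ^ j • (⊤ : Submodule S T) := by
    intro j
    induction j with
    | zero => intro n x _; simp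
    | succ j ih =>
      intro n x hn
      rw [add_mul, one_mul] at hn
      obtain ⟨m, rfl⟩ : ∃ m, n = m + N := ⟨n - N, by omega⟩
      rw [hUN]
      exact twistLift_iterV_mem hJ (fun x => ih m x (by omega)) (hN N le_rfl) x
  let y : ℕ → P.P →ₗ[S] T := fun n => ∑ k ∈ Finset.range n, U k
  have hy : ∀ n (q : P.Q), y (n + 1) (P.F₁ q) = D (P.F₁ q) + φ (y n q) := by
    intro n q
    simp only [y, Finset.sum_range_succ', map_sum, LinearMap.add_apply, LinearMap.sum_apply]
    rw [add_comm]
    congr 1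
    exact Finset.sum_congr rfl fun k _ => hU k q
  have hdiff : ∀ j m n x, j * N ≤ m → m ≤ n → y m x - y n x ∈ J ^ j • (⊤ : Submodule S T) := by
    intro j m n x hm hmn
    simp only [y, LinearMap.sum_apply]
    rw [← neg_sub, neg_mem_iff, ← Finset.sum_Ico_eq_sub _ hmn]
    exact Submodule.sum_mem _ fun k hk => hmem j k x (hm.trans (Finset.mem_Ico.1 hk).1)
  have hlim : ∀ x, ∃ L : T, ∀ j n, j * N ≤ n → y n x - L ∈ J ^ j • (⊤ : Submodule S T) := by
    intro x
    obtain ⟨L, hL⟩ := IsPrecomplete.prec (I := J) (M := T) inferInstance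
      (f := fun j => y (j * N) x) (fun {m n} hmn => SModEq.sub_mem.2
        (hdiff m _ _ x le_rfl (Nat.mul_le_mul_right N hmn)))
    refine ⟨L, fun j n hn => ?_⟩
    rw [← sub_add_sub_cancel _ (y (j * N) x), ← neg_sub (y (j * N) x)]
    exact Submodule.add_mem _ (neg_mem (hdiff j _ _ x le_rfl hn)) (SModEq.sub_mem.1 (hL j))
  choose L hL using hlim
  have huniq : ∀ a b : T, (∀ j, a - b ∈ J ^ j • (⊤ : Submodule S T)) → a = b := fun a b h =>
    IsHausdorff.eq_iff_smodEq (I := J).2 fun j => SModEq.sub_mem.2 (h j)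
  refine ⟨{ toFun := L, map_add' := fun a b => huniq _ _ fun j => ?_,
            map_smul' := fun c a => huniq _ _ fun j => ?_ }, fun q => huniq _ _ fun j => ?_⟩
  · have := Submodule.sub_mem _ (Submodule.add_mem _ (hL a j _ le_rfl) (hL b j _ le_rfl))
      (hL (a + b) j _ le_rfl)
    rw [map_add] at this
    convert this using 1
    abel
  · have := Submodule.sub_mem _ (Submodule.smul_mem _ c (hL a j _ le_rfl)) (hL (c • a) j _ le_rfl)
    rw [map_smul, smul_sub, sub_sub_sub_cancel_left] at this
    exact this
  · change L (P.F₁ q) - (D (P.F₁ q) + φ (L q)) ∈ _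
    have h1 := hL (P.F₁ q) j (j * N + 1) (by omega)
    rw [hy] at h1
    have h2 := map_mem_pow_smul (φ := φ) hJ j (hL (q : P.P) j (j * N) le_rfl)
    rw [map_sub] at h2
    have := Submodule.sub_mem _ h2 h1
    convert this using 1
    abel

end twistLift

end Window

/-! ### Adapted bases and the universal property of `F₁` -/

namespace Window

open CategoryTheory ChangeOfRings TensorProduct

variable {p : ℕ} {S : Type u} [CommRing S] {F : Frame p S}

/-- A basis of `P` adapted to a normal decomposition: the `b i` with `ε i` span `L`, the others span
`T`. -/
structure AdaptedBasis (P : Window F) (ι : Type u) where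
  b : Module.Basis ι S P.P
  ε : ι → Prop
  mem_Q : ∀ x, x ∈ P.Q ↔ ∀ i, ¬ ε i → b.repr x i ∈ F.I

/-- Both summands of a normal decomposition are finitely generated projective, hence free over a
local ring; the union of their bases is adapted. -/
theorem exists_adaptedBasis [IsLocalRing S] (P : Window F) :
    ∃ (ι : Type u) (_ : Fintype ι), Nonempty (P.AdaptedBasis ι) := by
  classical
  obtain ⟨L, T, hLT, hQ⟩ := P.normal
  have free : ∀ A B : Submodule S P.P, IsCompl A B → Module.Finite S A ∧ Module.Free S A := by
    intro A B h
    have h1 : (A.projectionOnto B h) ∘ₗ A.subtype = LinearMap.id :=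
      LinearMap.ext fun x => Submodule.projectionOnto_apply_left h x
    have hfin : Module.Finite S A := Module.Finite.of_surjective (A.projectionOnto B h)
      (fun x => ⟨x, LinearMap.congr_fun h1 x⟩)
    have hproj : Module.Projective S A := Module.Projective.of_split _ _ h1
    exact ⟨hfin, Module.free_of_flat_of_isLocalRing⟩
  obtain ⟨hL1, hL2⟩ := free L T hLT
  obtain ⟨hT1, hT2⟩ := free T L hLT.symm
  let bL := Module.Free.chooseBasis S L
  let bT := Module.Free.chooseBasis S T
  let b := (bL.prod bT).map (Submodule.prodEquivOfIsCompl L T hLT)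
  refine ⟨Module.Free.ChooseBasisIndex S L ⊕ Module.Free.ChooseBasisIndex S T, inferInstance,
    ⟨⟨b, fun i => i.isLeft, fun x => ⟨fun hx i hi => ?_, fun hx => ?_⟩⟩⟩⟩
  · have h1 : P.Q ≤ Submodule.comap (b.coord i) F.I := by
      rw [hQ]
      refine sup_le (fun l hl => ?_) (Submodule.smul_le.2 fun a ha t _ => ?_)
      · obtain ⟨j, rfl⟩ : ∃ j, i = Sum.inr j := by
          rcases i with i | j
          · exact absurd rfl hi
          · exact ⟨j, rfl⟩
        have h2 : (Submodule.prodEquivOfIsCompl L T hLT).symm l = (⟨l, hl⟩, 0) :=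
          Submodule.prodEquivOfIsCompl_symm_apply_left L T hLT ⟨l, hl⟩
        have h3 : b.coord (Sum.inr j) l = 0 := by
          simp only [b, Module.Basis.coord_apply, Module.Basis.map_repr, LinearEquiv.trans_apply, h2,
            Module.Basis.prod_repr_inr, map_zero, Finsupp.zero_apply]
        rw [Submodule.mem_comap, h3]
        exact F.I.zero_mem
      · rw [Submodule.mem_comap, map_smul]
        exact Ideal.mul_mem_right _ _ ha
    exact h1 hx
  · rw [← b.sum_repr x, hQ]
    refine Submodule.sum_mem _ fun i _ => ?_
    rcases i with i | j
    · refine Submodule.mem_sup_left (Submodule.smul_mem _ _ ?_)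
      simp [b]
    · refine Submodule.mem_sup_right (Submodule.smul_mem_smul (hx _ (by simp)) ?_)
      simp [b]

namespace AdaptedBasis

variable {P : Window F} {ι : Type u} [Fintype ι] (B : P.AdaptedBasis ι)

theorem b_mem (i : ι) (hi : B.ε i) : B.b i ∈ P.Q := by
  classical
  refine (B.mem_Q _).2 fun j hj => ?_
  rw [B.b.repr_self, Finsupp.single_apply, if_neg (fun h : i = j => hj (h ▸ hi))]
  exact F.I.zero_mem

open Classical in
/-- The value on `b i` of a pair of `σ`-linear maps `h₁` on `Q` and `h` on `P`: `h₁ (b i)` on the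
basis of `L`, and `h (b i)` on the basis of `T`. -/
noncomputable def val {N : Type u} [AddCommGroup N] [Module S N] (h₁ : P.Q →ₛₗ[F.σ] N)
    (h : P.P →ₛₗ[F.σ] N) (i : ι) : N :=
  if hi : B.ε i then h₁ ⟨B.b i, B.b_mem i hi⟩ else h (B.b i)

open Classical in
/-- The coefficients of `F₁ q` with respect to `val F₁ Fr`. -/
noncomputable def coef (q : P.Q) (i : ι) : S :=
  if hi : B.ε i then F.σ (B.b.repr q i) else F.σ₁ ⟨B.b.repr q i, (B.mem_Q q).1 q.2 i hi⟩

/-- The coefficients depend on `q` alone and not on the pair `(h₁, h)`. Hence such a pair is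
determined by its values on the basis, and can be compared with the pair `(F₁, Fr)`. -/
theorem apply_eq_sum {N : Type u} [AddCommGroup N] [Module S N] (h₁ : P.Q →ₛₗ[F.σ] N)
    (h : P.P →ₛₗ[F.σ] N)
    (hh : ∀ (a : F.I) (x : P.P), h₁ ⟨(a : S) • x, P.smul_mem_Q a x⟩ = F.σ₁ a • h x) (q : P.Q) :
    h₁ q = ∑ i, B.coef q i • B.val h₁ h i := by
  have hmem : ∀ i, B.b.repr q i • B.b i ∈ P.Q := by
    intro i
    by_cases hi : B.ε i
    · exact P.Q.smul_mem _ (B.b_mem i hi)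
    · exact P.smul_mem_Q ⟨_, (B.mem_Q q).1 q.2 i hi⟩ _
  have hq : q = ∑ i, (⟨B.b.repr q i • B.b i, hmem i⟩ : P.Q) := by
    apply Subtype.ext
    rw [Submodule.coe_sum]
    exact (B.b.sum_repr q).symm
  conv_lhs => rw [hq]
  rw [map_sum]
  refine Finset.sum_congr rfl fun i _ => ?_
  by_cases hi : B.ε i
  · rw [coef, val, dif_pos hi, dif_pos hi, ← h₁.map_smulₛₗ]
    rfl
  · rw [coef, val, dif_neg hi, dif_neg hi]
    exact hh ⟨_, (B.mem_Q q).1 q.2 i hi⟩ _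

/-- The basis of `P` consisting of the `F₁ (b i)` for `b i` in `L` and the `Fr (b i)` for `b i` in
`T`. -/
theorem exists_basis_val : ∃ c : Module.Basis ι S P.P, ∀ i, c i = B.val P.F₁ P.Fr i := by
  have hs : Function.Surjective (B.b.constr S (B.val P.F₁ P.Fr)) := by
    rw [← LinearMap.range_eq_top, eq_top_iff, ← P.span_F₁, Submodule.span_le]
    rintro _ ⟨q, rfl⟩
    rw [B.apply_eq_sum P.F₁ P.Fr (fun a x => P.F₁_smul a x _)]
    exact Submodule.sum_mem _ fun i _ => Submodule.smul_mem _ _ ⟨B.b i, B.b.constr_basis S _ i⟩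
  -- The endomorphism sending the basis to these values is surjective because `F₁(Q)` generates `P`;
  -- on a finitely generated module it is then injective.
  refine ⟨B.b.map (LinearEquiv.ofBijective (B.b.constr S (B.val P.F₁ P.Fr))
    ⟨OrzechProperty.injective_of_surjective_endomorphism _ hs, hs⟩), fun i => ?_⟩
  rw [Module.Basis.map_apply]
  exact B.b.constr_basis S _ i

end AdaptedBasis

/-- The universal property of the linearisation of `F₁`. -/
theorem exists_linear_of_F₁ [IsLocalRing S] (P : Window F) {N : Type u} [AddCommGroup N]
    [Module S N] (h₁ : P.Q →ₛₗ[F.σ] N) (h : P.P →ₛₗ[F.σ] N)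
    (hh : ∀ (a : F.I) (x : P.P), h₁ ⟨(a : S) • x, P.smul_mem_Q a x⟩ = F.σ₁ a • h x) :
    ∃ Z : P.P →ₗ[S] N, ∀ q, Z (P.F₁ q) = h₁ q := by
  obtain ⟨ι, _, ⟨B⟩⟩ := P.exists_adaptedBasis
  obtain ⟨c, hc⟩ := B.exists_basis_val
  have hZ : ∀ i, c.constr S (B.val h₁ h) (B.val P.F₁ P.Fr i) = B.val h₁ h i := fun i => by
    rw [← hc]
    exact c.constr_basis _ _ i
  refine ⟨c.constr S (B.val h₁ h), fun q => ?_⟩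
  rw [B.apply_eq_sum h₁ h hh, B.apply_eq_sum P.F₁ P.Fr (fun a x => P.F₁_smul a x _), map_sum]
  exact Finset.sum_congr rfl fun i _ => by rw [map_smul, hZ]

/-- The `σ`-linear map `x ↦ 1 ⊗ x`. -/
noncomputable def oneTw {A B : Type u} [CommRing A] [CommRing B] (f : A →+* B) (M : ModuleCat.{u} A) :
    M →ₛₗ[f] (ModuleCat.extendScalars f).obj M where
  toFun x := tw f 1 x
  map_add' x y := tw_add f 1 x y
  map_smul' a x := (tw_smul f 1 a x).trans (congrArg (fun b => tw f b x) (mul_comm _ _))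

/-- A linear map between modules as a morphism in `ModuleCat`. -/
def homOfLinear {M N : ModuleCat.{u} S} (Z : M →ₗ[S] N) : M ⟶ N := ModuleCat.ofHom Z

/-- The universal property of `F₁` applies to `q ↦ 1 ⊗ q` on `Q`, with companion `x ↦ θ (1 ⊗ x)` on
`P`; the compatibility of the two is `σ a = θ σ₁ a`. -/
theorem exists_isVSharp [IsLocalRing S] (P : Window F) :
    ∃ V : P.twist 0 ⟶ P.twist 1, P.IsVSharp V := by
  obtain ⟨Z, hZ⟩ := P.exists_linear_of_F₁ ((oneTw F.σ (ModuleCat.of S P.P)).comp P.Q.subtype)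
    (F.theta • oneTw F.σ (ModuleCat.of S P.P)) (fun a x => by
      have h := (oneTw F.σ (ModuleCat.of S P.P)).map_smulₛₗ (a : S) x
      rw [F.sigma_eq_theta, mul_comm, mul_smul] at h
      exact h)
  let V : ModuleCat.of S P.P ⟶ (ModuleCat.extendScalars F.σ).obj (ModuleCat.of S P.P) :=
    homOfLinear Z
  exact ⟨V, hZ⟩

theorem isVSharp_unique (P : Window F) {V V' : P.twist 0 ⟶ P.twist 1} (hV : P.IsVSharp V)
    (hV' : P.IsVSharp V') : V = V' := by
  apply ModuleCat.hom_ext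
  have h : Submodule.span S (Set.range P.F₁) ≤ LinearMap.eqLocus (P.vLin V) (P.vLin V') := by
    rw [Submodule.span_le]
    rintro _ ⟨q, rfl⟩
    exact ((P.isVSharp_iff V).1 hV q).trans ((P.isVSharp_iff V').1 hV' q).symm
  rw [P.span_F₁] at h
  exact LinearMap.ext fun x => h (Submodule.mem_top (x := x))

end Window

/-! ### Base change of `V♯` and of nilpotence -/

namespace Window

open CategoryTheory ChangeOfRings TensorProduct

section extSemi

variable {A A' B B' : Type u} [CommRing A] [CommRing A'] [CommRing B] [CommRing B']
  {f : A →+* B} {f' : A' →+* B'} {α : A →+* A'} {β : B →+* B'}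
  {M : ModuleCat.{u} A} {M' : ModuleCat.{u} A'}

/-- The semilinear map `b ⊗ x ↦ β b ⊗ h x` between extensions of scalars. -/
noncomputable def extSemi (hc : ∀ a, β (f a) = f' (α a)) (h : M →ₛₗ[α] M') :
    (ModuleCat.extendScalars f).obj M →ₛₗ[β] (ModuleCat.extendScalars f').obj M' :=
  let N := (ModuleCat.extendScalars f').obj M'
  let l : (ModuleCat.extendScalars f).obj M →ₗ[B] (ModuleCat.restrictScalars β).obj N :=
    linearize (T := (ModuleCat.restrictScalars β).obj N)
      { toFun := fun x => tw f' 1 (h x)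
        map_add' := fun x y => (congrArg (tw f' 1) (map_add h x y)).trans (tw_add f' 1 _ _)
        map_smul' := fun a x => by
          refine (congrArg (tw f' 1) (h.map_smulₛₗ a x)).trans ((tw_smul f' 1 _ _).trans ?_)
          refine (congrArg (fun b => tw f' b (h x)) ?_).trans (smul_tw f' (β (f a)) 1 (h x)).symm
          rw [hc, mul_comm] }
  { toFun := l
    map_add' := map_add l
    map_smul' := l.map_smul }

theorem extSemi_tw (hc : ∀ a, β (f a) = f' (α a)) (h : M →ₛₗ[α] M') (b : B) (x : M) :
    extSemi hc h (tw f b x) = tw f' (β b) (h x) := by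
  refine Eq.trans (b := β b • tw f' 1 (h x)) rfl ?_
  rw [smul_tw, mul_one]

theorem map_extSemi {N : ModuleCat.{u} A} {N' : ModuleCat.{u} A'} (hc : ∀ a, β (f a) = f' (α a))
    {h : M →ₛₗ[α] M'} {k : N →ₛₗ[α] N'} {g : M ⟶ N} {g' : M' ⟶ N'} {c : A'}
    (hg : ∀ x, g'.hom (h x) = c • k (g.hom x)) (z : (ModuleCat.extendScalars f).obj M) :
    ((ModuleCat.extendScalars f').map g').hom (extSemi hc h z) =
      f' c • extSemi hc k (((ModuleCat.extendScalars f).map g).hom z) := by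
  refine tw_induction (M := M) (C := fun z => ((ModuleCat.extendScalars f').map g').hom
    (extSemi hc h z) = f' c • extSemi hc k (((ModuleCat.extendScalars f).map g).hom z)) ?_
    (fun b x => ?_) (fun x y hx hy => ?_) z
  · rw [map_zero, map_zero, map_zero, map_zero, smul_zero]
  · rw [extSemi_tw, map_tw, map_tw, extSemi_tw, hg, tw_smul, smul_tw, mul_comm]
  · rw [map_add, map_add, map_add, map_add, smul_add, hx, hy]

end extSemi

variable {p : ℕ} {S S' : Type u} [CommRing S] [CommRing S'] {F : Frame p S} {F' : Frame p S'}

/-- A semilinear map `P → P'` along a homomorphism of frames that exhibits the window `P'` as the base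
change of `P`. -/
structure BaseChangeMap (α : FrameHom F F') (P : Window F) (P' : Window F') where
  j : P.P →ₛₗ[α.toRingHom] P'.P
  map_Q : ∀ q ∈ P.Q, j q ∈ P'.Q
  map_Fr : ∀ x, P'.Fr (j x) = j (P.Fr x)
  map_F₁ : ∀ q : P.Q, P'.F₁ ⟨j q, map_Q q q.2⟩ = (α.u : S') • j (P.F₁ q)
  exists_basis : ∀ {ι : Type u} (b : Module.Basis ι S P.P),
    ∃ b' : Module.Basis ι S' P'.P, ∀ i, b' i = j (b i)
  Q_eq : P'.Q = Submodule.span S' (Set.range fun q : P.Q => j q) ⊔ F'.I • ⊤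
  span_j : Submodule.span S' (Set.range j) = ⊤

/-- The map `x ↦ 1 ⊗ x`. -/
noncomputable def baseChangeMap (α : FrameHom F F') (P : Window F) :
    BaseChangeMap α P (α.baseChange.obj P) :=
  letI := α.toRingHom.toAlgebra
  { j :=
      { toFun := fun x => ((1 : S') ⊗ₜ[S] x : S' ⊗[S] P.P)
        map_add' := fun x y => TensorProduct.tmul_add (1 : S') x y
        map_smul' := fun a x => (TensorProduct.tmul_smul (R := S) a (1 : S') x).trans
          (algebraMap_smul S' a ((1 : S') ⊗ₜ[S] x)).symm }
    map_Q := fun q hq => BaseChange.tmul_mem_Q (F' := F') P ⟨q, hq⟩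
    map_Fr := fun x => (BaseChange.semi_tmul F.σ F'.σ α.map_σ P.Fr (1 : S') x).trans
      (congrArg (fun s : S' => (s ⊗ₜ[S] P.Fr x : S' ⊗[S] P.P)) (map_one F'.σ))
    map_F₁ := fun q => BaseChange.window_F₁_tmul α.map_I α.map_σ α.u α.map_σ₁ P q
    exists_basis := fun b =>
      ⟨b.baseChange S', fun i => b.baseChange_apply S' i⟩
    Q_eq := rfl
    span_j := by
      rw [eq_top_iff]
      intro x _
      refine TensorProduct.induction_on (motive := fun x : S' ⊗[S] P.P => x ∈ Submodule.span S'
        (Set.range fun y : P.P => (1 : S') ⊗ₜ[S] y)) x (Submodule.zero_mem _) (fun s y => ?_)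
        (fun y z hy hz => Submodule.add_mem _ hy hz)
      have h := Submodule.smul_mem (Submodule.span S'
        (Set.range fun y : P.P => (1 : S') ⊗ₜ[S] y)) s (Submodule.subset_span ⟨y, rfl⟩)
      rwa [TensorProduct.smul_tmul', smul_eq_mul, mul_one] at h }

theorem baseChange_map_toLin (α : FrameHom F F') {P₁ P₂ : Window F} (g : P₁ ⟶ P₂) (x : P₁.P) :
    Hom.toLin (α.baseChange.map g) ((baseChangeMap α P₁).j x) =
      (baseChangeMap α P₂).j (Hom.toLin g x) := rfl

namespace BaseChangeMap

variable {α : FrameHom F F'} {P : Window F} {P' : Window F'} (B : BaseChangeMap α P P')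

/-- The maps induced on the Frobenius twists. -/
noncomputable def twistMap : (n : ℕ) → (P.twist n →ₛₗ[α.toRingHom] P'.twist n)
  | 0 => B.j
  | n + 1 => extSemi (M := P.twist n) (M' := P'.twist n) (fun a => (α.map_σ a).symm) (twistMap n)

theorem twistMap_mem (n : ℕ) {J : Ideal S} {J' : Ideal S'} (hJ : ∀ a ∈ J, α.toRingHom a ∈ J')
    {z : P.twist n} (hz : z ∈ J • (⊤ : Submodule S (P.twist n))) :
    B.twistMap n z ∈ J' • (⊤ : Submodule S' (P'.twist n)) := by
  refine Submodule.smul_induction_on hz (fun a ha t _ => ?_) (fun x y hx hy => ?_)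
  · rw [LinearMap.map_smulₛₗ]
    exact Submodule.smul_mem_smul (hJ a ha) trivial
  · rw [map_add]; exact Submodule.add_mem _ hx hy

/-- The map `P^(σ) → P'^(σ)`. -/
noncomputable def twistOne : (ModuleCat.extendScalars F.σ).obj (ModuleCat.of S P.P) →ₛₗ[α.toRingHom]
    (ModuleCat.extendScalars F'.σ).obj (ModuleCat.of S' P'.P) :=
  extSemi (M := ModuleCat.of S P.P) (M' := ModuleCat.of S' P'.P) (fun a => (α.map_σ a).symm) B.j

/-- The base change of `F₁` involves the unit `u`, so `V♯`, which inverts `F₁`, acquires `u⁻¹`. -/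
theorem vLin_j {V : P.twist 0 ⟶ P.twist 1} (hV : P.IsVSharp V) {V' : P'.twist 0 ⟶ P'.twist 1}
    (hV' : P'.IsVSharp V') (y : P.P) :
    P'.vLin V' (B.j y) = ((α.u⁻¹ : S'ˣ) : S') • B.twistOne (P.vLin V y) := by
  have hy : y ∈ Submodule.span S (Set.range P.F₁) := by rw [P.span_F₁]; trivial
  induction hy using Submodule.span_induction with
  | mem y hy =>
    obtain ⟨q, rfl⟩ := hy
    have h1 := (P'.isVSharp_iff V').1 hV' ⟨B.j q, B.map_Q q q.2⟩
    rw [B.map_F₁, map_smul] at h1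
    have h2 : B.twistOne (P.vLin V (P.F₁ q)) =
        tw (M := ModuleCat.of S' P'.P) F'.σ 1 (B.j q) := by
      rw [(P.isVSharp_iff V).1 hV q]
      refine (extSemi_tw (M := ModuleCat.of S P.P) (M' := ModuleCat.of S' P'.P) _ _ _ _).trans ?_
      rw [map_one]
    rw [h2]
    refine Eq.trans ?_ (congrArg (fun z => ((α.u⁻¹ : S'ˣ) : S') • z) h1)
    rw [smul_smul, Units.inv_mul, one_smul]
  | zero => rw [map_zero, map_zero, map_zero, map_zero, smul_zero]
  | add y z _ _ hy hz => rw [map_add, map_add, map_add, map_add, smul_add, hy, hz]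
  | smul c y _ hy =>
    rw [LinearMap.map_smulₛₗ, map_smul, map_smul, LinearMap.map_smulₛₗ, hy, smul_comm]

/-- Iterating multiplies the scalars by Frobenius twists of one another. Their precise value is
irrelevant for membership in `J'` times the twist. -/
theorem exists_iterLin_j {V : P.twist 0 ⟶ P.twist 1} (hV : P.IsVSharp V)
    {V' : P'.twist 0 ⟶ P'.twist 1} (hV' : P'.IsVSharp V') (n : ℕ) :
    ∃ c : S', ∀ y : P.P, P'.iterLin V' n (B.j y) = c • B.twistMap n (P.iterLin V n y) := by
  induction n with
  | zero => exact ⟨1, fun y => (one_smul _ _).symm⟩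
  | succ n ih =>
    obtain ⟨c, hc⟩ := ih
    refine ⟨((α.u⁻¹ : S'ˣ) : S') * F'.σ c, fun y => ?_⟩
    rw [iterLin_succ, B.vLin_j hV hV', map_smul]
    refine (congrArg (fun z => ((α.u⁻¹ : S'ˣ) : S') • z) (map_extSemi (M := ModuleCat.of S P.P)
      (M' := ModuleCat.of S' P'.P) (N := P.twist n) (N' := P'.twist n)
      (k := B.twistMap n) (g := ModuleCat.ofHom (P.iterLin V n))
      (fun a => (α.map_σ a).symm) hc (P.vLin V y))).trans ?_
    exact smul_smul _ _ _

theorem isNilpotent (B : BaseChangeMap α P P') [IsLocalRing S'] {J : Ideal S} {J' : Ideal S'}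
    (hJ : ∀ a ∈ J, α.toRingHom a ∈ J') (hP : IsNilpotent J P) : IsNilpotent J' P' := by
  obtain ⟨V, hV, N, hN⟩ := hP
  obtain ⟨V', hV'⟩ := P'.exists_isVSharp
  refine ⟨V', hV', N, fun n hn => ?_⟩
  obtain ⟨c, hc⟩ := B.exists_iterLin_j hV hV' n
  have h : Submodule.span S' (Set.range B.j) ≤
      (J' • (⊤ : Submodule S' (P'.twist n))).comap (P'.iterLin V' n) := by
    rw [Submodule.span_le]
    rintro _ ⟨y, rfl⟩
    change P'.iterLin V' n (B.j y) ∈ J' • (⊤ : Submodule S' (P'.twist n))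
    rw [hc]
    exact Submodule.smul_mem _ _ (B.twistMap_mem n hJ (hN n hn y))
  rw [B.span_j] at h
  exact fun x => h (Submodule.mem_top (x := x))

end BaseChangeMap

end Window

/-! ### Full faithfulness on nilpotent windows -/

namespace Window

open CategoryTheory

variable {p : ℕ} {S S' : Type u} [CommRing S] [CommRing S'] {F : Frame p S} {F' : Frame p S'}
  {α : FrameHom F F'}

/-- A linear map compatible with `Q` and `F₁` is a homomorphism of windows. -/
theorem map_Fr_of_map_F₁ {P₁ P₂ : Window F} (X : P₁.P →ₗ[S] P₂.P) (hQ : ∀ x ∈ P₁.Q, X x ∈ P₂.Q)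
    (h : ∀ q : P₁.Q, X (P₁.F₁ q) = P₂.F₁ ⟨X q, hQ q q.2⟩) (x : P₁.P) :
    X (P₁.Fr x) = P₂.Fr (X x) := by
  have key : ∀ y ∈ Submodule.span S (Set.range F.σ₁), y • (X (P₁.Fr x) - P₂.Fr (X x)) = 0 := by
    intro y hy
    induction hy using Submodule.span_induction with
    | mem y hy =>
      obtain ⟨a, rfl⟩ := hy
      have h1 := h ⟨(a : S) • x, P₁.smul_mem_Q a x⟩
      rw [P₁.F₁_smul, map_smul] at h1
      rw [smul_sub, h1, sub_eq_zero, ← P₂.F₁_smul a (X x) (P₂.smul_mem_Q a _)]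
      congr 1
      exact Subtype.ext (map_smul X _ _)
    | zero => simp
    | add y z _ _ hy hz => rw [add_smul, hy, hz, add_zero]
    | smul c y _ hy => rw [smul_eq_mul, mul_smul, hy, smul_zero]
  have h1 := key 1 (by rw [F.span_σ₁]; trivial)
  rwa [one_smul, sub_eq_zero] at h1

namespace BaseChangeMap

variable {P : Window F} {P' : Window F'}

theorem repr_apply {ι : Type u} [Fintype ι] (B : BaseChangeMap α P P') {b : Module.Basis ι S P.P}
    {b' : Module.Basis ι S' P'.P} (hb : ∀ i, b' i = B.j (b i)) (x : P.P) (i : ι) :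
    b'.repr (B.j x) i = α.toRingHom (b.repr x i) := by
  classical
  conv_lhs => rw [← b.sum_repr x]
  simp only [map_sum, LinearMap.map_smulₛₗ, ← hb, Finsupp.coe_finsetSum, Finset.sum_apply,
    map_smul, Finsupp.smul_apply, b'.repr_self, Finsupp.single_apply, smul_eq_mul, mul_ite,
    mul_one, mul_zero, Finset.sum_ite_eq', Finset.mem_univ, if_true]

/-- Membership in `Q` is a condition on coordinates in an adapted basis, which carries over to the
base change; by hypothesis `I` contains the inverse image of `I'`. In particular `ker j ⊆ Q`. -/
theorem mem_Q_of_map_mem [IsLocalRing S] (B : BaseChangeMap α P P')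
    (hI : ∀ a, α.toRingHom a ∈ F'.I → a ∈ F.I) {z : P.P} (hz : B.j z ∈ P'.Q) : z ∈ P.Q := by
  obtain ⟨ι, _, ⟨b⟩⟩ := P.exists_adaptedBasis
  obtain ⟨b', hb'⟩ := B.exists_basis b.b
  have hrepr := B.repr_apply hb'
  refine (b.mem_Q z).2 fun i hi => hI _ ?_
  rw [← hrepr]
  have h : P'.Q ≤ Submodule.comap (b'.coord i) F'.I := by
    rw [B.Q_eq]
    refine sup_le (Submodule.span_le.2 ?_) (Submodule.smul_le.2 fun a ha t _ => ?_)
    · rintro _ ⟨q, rfl⟩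
      change b'.repr (B.j q) i ∈ F'.I
      rw [hrepr]
      exact α.map_I _ ((b.mem_Q q).1 q.2 i hi)
    · rw [Submodule.mem_comap, map_smul]
      exact Ideal.mul_mem_right _ _ ha
  exact h hz

/-- Since `S → S'/I'` is surjective and `I' P' ⊆ Q'`, one has `P' = Q' + j(P)`. This lets `F₁'`,
defined on `Q'` only, act on all of `P'/j(P)`. -/
theorem exists_sub_mem_Q [IsLocalRing S] (B : BaseChangeMap α P P')
    (hs : ∀ w, ∃ a, w - α.toRingHom a ∈ F'.I) (y : P'.P) : ∃ z, y - B.j z ∈ P'.Q := by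
  have hy : y ∈ Submodule.span S' (Set.range B.j) := by rw [B.span_j]; trivial
  induction hy using Submodule.span_induction with
  | mem y hy =>
    obtain ⟨z, rfl⟩ := hy
    exact ⟨z, by rw [sub_self]; exact Submodule.zero_mem _⟩
  | zero => exact ⟨0, by rw [map_zero, sub_self]; exact Submodule.zero_mem _⟩
  | add x y _ _ hx hy =>
    obtain ⟨z, hz⟩ := hx
    obtain ⟨w, hw⟩ := hy
    exact ⟨z + w, by rw [map_add, add_sub_add_comm]; exact Submodule.add_mem _ hz hw⟩
  | smul c y _ hy =>
    obtain ⟨z, hz⟩ := hy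
    obtain ⟨a, ha⟩ := hs c
    refine ⟨a • z, ?_⟩
    rw [LinearMap.map_smulₛₗ, show c • y - α.toRingHom a • B.j z =
      (c - α.toRingHom a) • y + α.toRingHom a • (y - B.j z) by rw [sub_smul, smul_sub]; abel]
    exact Submodule.add_mem _ (P'.smul_mem_Q ⟨_, ha⟩ y) (Submodule.smul_mem _ _ hz)

/-- `F₁` on the kernel of `P → P'`. -/
theorem exists_F₁_ker [IsLocalRing S] (B : BaseChangeMap α P P')
    (hI : ∀ a, α.toRingHom a ∈ F'.I → a ∈ F.I) :
    ∃ φ : LinearMap.ker B.j →ₛₗ[F.σ] LinearMap.ker B.j,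
      ∀ (t : LinearMap.ker B.j) (h : (t : P.P) ∈ P.Q), (φ t : P.P) = P.F₁ ⟨t, h⟩ := by
  have hQ : ∀ t ∈ LinearMap.ker B.j, t ∈ P.Q := fun t ht =>
    B.mem_Q_of_map_mem hI (by rw [LinearMap.mem_ker.1 ht]; exact Submodule.zero_mem _)
  have hF : ∀ t (ht : t ∈ LinearMap.ker B.j), P.F₁ ⟨t, hQ t ht⟩ ∈ LinearMap.ker B.j := by
    intro t ht
    have h1 := B.map_F₁ ⟨t, hQ t ht⟩
    have h2 : (⟨B.j t, B.map_Q t (hQ t ht)⟩ : P'.Q) = 0 := Subtype.ext ht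
    rw [h2, map_zero] at h1
    have h3 := congrArg (fun z => ((α.u⁻¹ : S'ˣ) : S') • z) h1
    rw [smul_zero, smul_smul, Units.inv_mul, one_smul] at h3
    exact h3.symm
  exact ⟨{ toFun := fun t => ⟨P.F₁ ⟨t, hQ t t.2⟩, hF t t.2⟩
           map_add' := fun s t => Subtype.ext (map_add P.F₁ ⟨s, hQ s s.2⟩ ⟨t, hQ t t.2⟩)
           map_smul' := fun a t => Subtype.ext (P.F₁.map_smulₛₗ a ⟨t, hQ t t.2⟩) },
    fun t h => rfl⟩

variable {P₁ P₂ : Window F} {P₁' P₂' : Window F'}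

/-- The difference `f - g` maps into `ker j` and commutes with `F₁`, so it is topologically zero by
nilpotence. The kernel is a finitely generated module over a noetherian local ring, hence separated.
-/
theorem eq_of_map_eq [IsLocalRing S] [IsNoetherianRing S] (B₂ : BaseChangeMap α P₂ P₂')
    (hI : ∀ a, α.toRingHom a ∈ F'.I → a ∈ F.I) (hσ : ∀ a ∈ maximalIdeal S, F.σ a ∈ maximalIdeal S)
    (hP : IsNilpotent (maximalIdeal S) P₁) (f g : P₁.Hom P₂)
    (h : ∀ x, B₂.j (f.toLin x) = B₂.j (g.toLin x)) : f = g := by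
  obtain ⟨φ, hφ⟩ := B₂.exists_F₁_ker hI
  have hmem : ∀ x, (f.toLin - g.toLin) x ∈ LinearMap.ker B₂.j := fun x => by
    rw [LinearMap.mem_ker, LinearMap.sub_apply, map_sub, h, sub_self]
  let d : P₁.P →ₗ[S] LinearMap.ker B₂.j := (f.toLin - g.toLin).codRestrict _ hmem
  have hd : ∀ q : P₁.Q, d (P₁.F₁ q) = φ (d q) := by
    intro q
    apply Subtype.ext
    rw [hφ (d q) (P₂.Q.sub_mem (f.map_Q q q.2) (g.map_Q q q.2))]
    change f.toLin (P₁.F₁ q) - g.toLin (P₁.F₁ q) = _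
    rw [f.map_F₁, g.map_F₁, ← map_sub]
    rfl
  have hd0 : ∀ x, d x = 0 := fun x => by
    refine IsHausdorff.haus (I := maximalIdeal S) inferInstance _ fun n => ?_
    rw [SModEq.sub_mem, sub_zero]
    exact map_mem_pow_smul_top hσ hP hd n x
  ext x
  exact sub_eq_zero.1 (congrArg Subtype.val (hd0 x))

theorem repr_j {ι : Type u} [Fintype ι] (B : BaseChangeMap α P P') {b : Module.Basis ι S P.P}
    {b' : Module.Basis ι S' P'.P} (hb : ∀ i, b' i = B.j (b i)) (y : P'.P)
    (hy : ∀ i, b'.repr y i ∈ α.toRingHom.range) : ∃ x, y = B.j x := by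
  choose a ha using hy
  refine ⟨∑ i, a i • b i, ?_⟩
  rw [map_sum, ← b'.sum_repr y]
  exact Finset.sum_congr rfl fun i _ => by rw [LinearMap.map_smulₛₗ, ha, hb]

/-- The map `ψ ∘ j` followed by the projection to `P₂'/j(P₂)` is compatible with a `σ`-linear
endomorphism induced by `u⁻¹F₁'`, so nilpotence makes it topologically zero. The quotient is not
known to be separated; instead closedness of the image of `α` is used on coordinates. -/
theorem exists_map_j_eq [IsLocalRing S] (B₁ : BaseChangeMap α P₁ P₁') (B₂ : BaseChangeMap α P₂ P₂')
    (hI : ∀ a, α.toRingHom a ∈ F'.I → a ∈ F.I) (hs : ∀ w, ∃ a, w - α.toRingHom a ∈ F'.I)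
    (hσ : ∀ a ∈ maximalIdeal S, F.σ a ∈ maximalIdeal S)
    (hcl : ∀ w, (∀ n, ∃ a, w - α.toRingHom a ∈ (maximalIdeal S ^ n).map α.toRingHom) →
      w ∈ α.toRingHom.range)
    (hP : IsNilpotent (maximalIdeal S) P₁) (ψ : P₁'.Hom P₂') (x : P₁.P) :
    ∃ y, ψ.toLin (B₁.j x) = B₂.j y := by
  let _ : Module S P₂'.P := Module.compHom P₂'.P α.toRingHom
  let jl : P₂.P →ₗ[S] P₂'.P :=
    { toFun := B₂.j, map_add' := map_add B₂.j, map_smul' := B₂.j.map_smulₛₗ }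
  let mk := (LinearMap.range jl).mkQ
  have hmk : ∀ y z, mk y = mk z ↔ ∃ x, y - z = B₂.j x := fun y z => by
    change Submodule.Quotient.mk y = Submodule.Quotient.mk z ↔ _
    rw [Submodule.Quotient.eq]
    exact ⟨fun ⟨x, hx⟩ => ⟨x, hx.symm⟩, fun ⟨x, hx⟩ => ⟨x, hx.symm⟩⟩
  have hq : ∀ t, ∃ q : P₂'.Q, mk q = t := by
    intro t
    obtain ⟨y, rfl⟩ := (LinearMap.range jl).mkQ_surjective t
    obtain ⟨z, hz⟩ := B₂.exists_sub_mem_Q hs y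
    exact ⟨⟨_, hz⟩, (hmk _ _).2 ⟨-z, by rw [map_neg]; exact sub_sub_cancel_left _ _⟩⟩
  choose l hl using hq
  let v : S' := ((α.u⁻¹ : S'ˣ) : S')
  have hv : ∀ z : P₂'.P, v • (α.u : S') • z = z := fun z => by
    rw [smul_smul, Units.inv_mul, one_smul]
  -- Independence of the representative in `Q₂'`: two choices differ by some `j z` with `z ∈ Q₂`,
  -- and `u⁻¹F₁' (j z) = j (F₁ z)`.
  have key : ∀ q q' : P₂'.Q, mk q = mk q' → mk (v • P₂'.F₁ q) = mk (v • P₂'.F₁ q') := by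
    intro q q' h
    obtain ⟨z, hz⟩ := (hmk _ _).1 h
    have hzQ : z ∈ P₂.Q := B₂.mem_Q_of_map_mem hI (by
      rw [← hz]; exact Submodule.sub_mem _ q.2 q'.2)
    refine (hmk _ _).2 ⟨P₂.F₁ ⟨z, hzQ⟩, ?_⟩
    have h1 : q - q' = ⟨B₂.j z, B₂.map_Q z hzQ⟩ := Subtype.ext hz
    rw [← smul_sub, ← map_sub, h1, B₂.map_F₁ ⟨z, hzQ⟩, hv]
  let φ : (P₂'.P ⧸ LinearMap.range jl) →ₛₗ[F.σ] (P₂'.P ⧸ LinearMap.range jl) :=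
    { toFun := fun t => mk (v • P₂'.F₁ (l t))
      map_add' := fun s t => by
        rw [← map_add, ← smul_add, ← map_add]
        refine key _ _ ?_
        rw [hl, Submodule.coe_add, map_add, hl, hl]
      map_smul' := fun a t => by
        rw [← map_smul mk]
        have h1 : F.σ a • v • P₂'.F₁ (l t) = v • P₂'.F₁ (α.toRingHom a • l t) := by
          rw [P₂'.F₁.map_smulₛₗ, α.map_σ]
          exact smul_comm (α.toRingHom (F.σ a)) v _
        rw [h1]
        refine key _ _ ?_
        rw [hl]
        refine Eq.trans ?_ (map_smul mk a _).symm
        rw [hl] }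
  have hφ : ∀ q : P₂'.Q, φ (mk q) = mk (v • P₂'.F₁ q) := fun q => key _ _ (hl _)
  let g : P₁.P →ₗ[S] P₂'.P ⧸ LinearMap.range jl :=
    { toFun := fun x => mk (ψ.toLin (B₁.j x))
      map_add' := fun x y => by rw [map_add, map_add, map_add]
      map_smul' := fun a x => by
        rw [LinearMap.map_smulₛₗ, map_smul]
        exact map_smul mk a _ }
  have hg : ∀ q : P₁.Q, g (P₁.F₁ q) = φ (g q) := by
    intro q
    have h1 : φ (g q) = mk (v • P₂'.F₁ ⟨_, ψ.map_Q _ (B₁.map_Q q q.2)⟩) :=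
      hφ ⟨_, ψ.map_Q _ (B₁.map_Q q q.2)⟩
    have h2 := ψ.map_F₁ ⟨B₁.j q, B₁.map_Q q q.2⟩
    rw [B₁.map_F₁, map_smul] at h2
    rw [h1, ← h2, hv]
    rfl
  obtain ⟨ι, _, ⟨b⟩⟩ := P₂.exists_adaptedBasis
  obtain ⟨b', hb'⟩ := B₂.exists_basis b.b
  have hcoord : ∀ n, ∀ t ∈ maximalIdeal S ^ n • (⊤ : Submodule S (P₂'.P ⧸ LinearMap.range jl)),
      ∃ y, mk y = t ∧ ∀ i, b'.repr y i ∈ (maximalIdeal S ^ n).map α.toRingHom := by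
    intro n t ht
    refine Submodule.smul_induction_on ht (fun a ha t _ => ?_) (fun s t hs ht => ?_)
    · obtain ⟨y, rfl⟩ := (LinearMap.range jl).mkQ_surjective t
      refine ⟨α.toRingHom a • y, map_smul mk a y, fun i => ?_⟩
      rw [map_smul, Finsupp.smul_apply]
      exact Ideal.mul_mem_right _ _ (Ideal.mem_map_of_mem _ ha)
    · obtain ⟨y, rfl, hy⟩ := hs
      obtain ⟨z, rfl, hz⟩ := ht
      exact ⟨y + z, map_add mk y z, fun i => by
        rw [map_add]; exact Ideal.add_mem _ (hy i) (hz i)⟩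
  -- A class in `𝔪^n` times the quotient has a representative with coordinates in the ideal
  -- generated by `α(𝔪^n)`, so each coordinate is approximated by the image of `α`.
  refine B₂.repr_j hb' _ fun i => hcl _ fun n => ?_
  obtain ⟨y, hy, hy'⟩ := hcoord n _ (map_mem_pow_smul_top hσ hP hg n x)
  obtain ⟨z, hz⟩ := (hmk _ _).1 hy.symm
  refine ⟨b.b.repr z i, ?_⟩
  have h1 : ψ.toLin (B₁.j x) = y + B₂.j z := by rw [← hz]; abel
  rw [h1, map_add, Finsupp.add_apply, B₂.repr_apply hb', add_sub_cancel_right]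
  exact hy' i

/-- A linear lift `X₀` of `ψ` exists by lifting the values on a basis. Let `Z` be the linear map
with `Z ∘ F₁ = F₁ ∘ X₀`. Then `Z - X₀` has values in `ker j`, and a solution `Y` of `Y ∘ F₁ = (Z -
X₀) ∘ F₁ + F₁ ∘ Y` with values in that kernel makes `X₀ + Y` commute with `F₁` without changing its
base change. -/
theorem exists_hom [IsLocalRing S] [IsNoetherianRing S] [IsAdicComplete (maximalIdeal S) S]
    (B₁ : BaseChangeMap α P₁ P₁') (B₂ : BaseChangeMap α P₂ P₂')
    (hI : ∀ a, α.toRingHom a ∈ F'.I → a ∈ F.I) (hs : ∀ w, ∃ a, w - α.toRingHom a ∈ F'.I)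
    (hσ : ∀ a ∈ maximalIdeal S, F.σ a ∈ maximalIdeal S)
    (hcl : ∀ w, (∀ n, ∃ a, w - α.toRingHom a ∈ (maximalIdeal S ^ n).map α.toRingHom) →
      w ∈ α.toRingHom.range)
    (hP : IsNilpotent (maximalIdeal S) P₁) (ψ : P₁'.Hom P₂') :
    ∃ f : P₁.Hom P₂, ∀ x, ψ.toLin (B₁.j x) = B₂.j (f.toLin x) := by
  choose f₀ hf₀ using B₁.exists_map_j_eq B₂ hI hs hσ hcl hP ψ
  obtain ⟨ι, _, ⟨b⟩⟩ := P₁.exists_adaptedBasis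
  let X₀ : P₁.P →ₗ[S] P₂.P := b.b.constr S fun i => f₀ (b.b i)
  have hX₀ : ∀ x, B₂.j (X₀ x) = ψ.toLin (B₁.j x) := by
    have h : B₂.j.comp X₀ = ψ.toLin.comp B₁.j := by
      refine b.b.ext fun i => ?_
      rw [LinearMap.comp_apply, b.b.constr_basis, ← hf₀]
      rfl
    exact fun x => LinearMap.congr_fun h x
  have hX₀Q : ∀ x ∈ P₁.Q, X₀ x ∈ P₂.Q := fun x hx => B₂.mem_Q_of_map_mem hI (by
    rw [hX₀]; exact ψ.map_Q _ (B₁.map_Q x hx))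
  obtain ⟨Z, hZ⟩ := P₁.exists_linear_of_F₁ (P₂.F₁.comp (X₀.restrict hX₀Q)) (P₂.Fr.comp X₀)
    (fun a x => by
      rw [LinearMap.comp_apply, LinearMap.comp_apply,
        ← P₂.F₁_smul a (X₀ x) (P₂.smul_mem_Q a _)]
      congr 1
      exact Subtype.ext (map_smul X₀ _ _))
  have hker : ∀ x, (Z - X₀) x ∈ LinearMap.ker B₂.j := by
    intro x
    have hx : x ∈ Submodule.span S (Set.range P₁.F₁) := by rw [P₁.span_F₁]; trivial
    have hle : Submodule.span S (Set.range P₁.F₁) ≤ (LinearMap.ker B₂.j).comap (Z - X₀) := by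
      rw [Submodule.span_le]
      rintro _ ⟨q, rfl⟩
      change B₂.j (Z (P₁.F₁ q) - X₀ (P₁.F₁ q)) = 0
      have h1 := B₂.map_F₁ ⟨X₀ q, hX₀Q q q.2⟩
      have h2 := ψ.map_F₁ ⟨B₁.j q, B₁.map_Q q q.2⟩
      have h3 : (⟨B₂.j (X₀ q), B₂.map_Q _ (hX₀Q q q.2)⟩ : P₂'.Q) =
        ⟨_, ψ.map_Q _ (B₁.map_Q q q.2)⟩ := Subtype.ext (hX₀ q)
      rw [h3, ← h2, B₁.map_F₁, map_smul] at h1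
      have h4 := congrArg (fun z => ((α.u⁻¹ : S'ˣ) : S') • z) h1
      simp only [smul_smul, Units.inv_mul, one_smul] at h4
      rw [map_sub, hZ, hX₀, h4]
      exact sub_self _
    exact hle hx
  obtain ⟨φ, hφ⟩ := B₂.exists_F₁_ker hI
  have : IsPrecomplete (maximalIdeal S) (LinearMap.ker B₂.j) := isPrecomplete_of_finite _ _
  have : IsAdicComplete (maximalIdeal S) (LinearMap.ker B₂.j) := ⟨⟩
  obtain ⟨Y, hY⟩ := exists_map_F₁_eq hσ hP (φ := φ) ((Z - X₀).codRestrict _ hker)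
  have hYQ : ∀ x, (Y x : P₂.P) ∈ P₂.Q := fun x => B₂.mem_Q_of_map_mem hI (by
    rw [LinearMap.mem_ker.1 (Y x).2]; exact Submodule.zero_mem _)
  let X : P₁.P →ₗ[S] P₂.P := X₀ + (LinearMap.ker B₂.j).subtype.comp Y
  have hXQ : ∀ x ∈ P₁.Q, X x ∈ P₂.Q := fun x hx => Submodule.add_mem _ (hX₀Q x hx) (hYQ x)
  have hX : ∀ q : P₁.Q, X (P₁.F₁ q) = P₂.F₁ ⟨X q, hXQ q q.2⟩ := by
    intro q
    have h1 := congrArg Subtype.val (hY q)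
    rw [Submodule.coe_add, hφ _ (hYQ q)] at h1
    change X₀ (P₁.F₁ q) + (Y (P₁.F₁ q) : P₂.P) = _
    rw [h1]
    change X₀ (P₁.F₁ q) + (Z (P₁.F₁ q) - X₀ (P₁.F₁ q) + _) = _
    rw [hZ, ← add_assoc, add_sub_cancel, LinearMap.comp_apply, ← map_add]
    rfl
  refine ⟨⟨X, hXQ, map_Fr_of_map_F₁ X hXQ hX, hX⟩, fun x => ?_⟩
  change _ = B₂.j (X₀ x + Y x)
  rw [map_add, hX₀, LinearMap.mem_ker.1 (Y x).2, add_zero]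

end BaseChangeMap

end Window

/-! ### Matrices with entries in an ideal and limits of matrices -/

section MatrixIdeal

variable {ι A : Type u} [Fintype ι] [DecidableEq ι] [CommRing A]

/-- All entries of the matrix lie in the ideal. -/
def EntriesIn (I : Ideal A) (M : Matrix ι ι A) : Prop := ∀ i j, M i j ∈ I

namespace EntriesIn

variable {I J : Ideal A} {M M' : Matrix ι ι A}

theorem mono (h : I ≤ J) (hM : EntriesIn I M) : EntriesIn J M := fun i j => h (hM i j)

theorem zero : EntriesIn I (0 : Matrix ι ι A) := fun _ _ => I.zero_mem

theorem add (hM : EntriesIn I M) (hM' : EntriesIn I M') : EntriesIn I (M + M') := fun i j =>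
  I.add_mem (hM i j) (hM' i j)

theorem neg (hM : EntriesIn I M) : EntriesIn I (-M) := fun i j => I.neg_mem (hM i j)

theorem sub (hM : EntriesIn I M) (hM' : EntriesIn I M') : EntriesIn I (M - M') := fun i j =>
  I.sub_mem (hM i j) (hM' i j)

theorem mul_left (L : Matrix ι ι A) (hM : EntriesIn I M) : EntriesIn I (L * M) := fun i j => by
  rw [Matrix.mul_apply]
  exact I.sum_mem fun k _ => I.mul_mem_left _ (hM k j)

theorem mul_right (L : Matrix ι ι A) (hM : EntriesIn I M) : EntriesIn I (M * L) := fun i j => by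
  rw [Matrix.mul_apply]
  exact I.sum_mem fun k _ => I.mul_mem_right _ (hM i k)

theorem mul (hM : EntriesIn I M) (hM' : EntriesIn J M') : EntriesIn (I * J) (M * M') :=
  fun i j => by
    rw [Matrix.mul_apply]
    exact (I * J).sum_mem fun k _ => Ideal.mul_mem_mul (hM i k) (hM' k j)

theorem smul (hM : EntriesIn I M) (c : A) : EntriesIn I (c • M) := fun i j =>
  I.mul_mem_left c (hM i j)

theorem smul_of_mem {c : A} (hc : c ∈ I) (M : Matrix ι ι A) : EntriesIn I (c • M) := fun i j =>
  I.mul_mem_right (M i j) hc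

theorem map {A' : Type u} [CommRing A'] {I' : Ideal A'} (f : A →+* A') (hf : ∀ a ∈ I, f a ∈ I')
    (hM : EntriesIn I M) : EntriesIn I' (f.mapMatrix M) := fun i j => hf _ (hM i j)

end EntriesIn

/-- Invertibility of matrices over local rings only depends on the matrix modulo the maximal
ideal. -/
theorem isUnit_of_entriesIn_sub [IsLocalRing A] {M M' : Matrix ι ι A} (hM : IsUnit M)
    (h : EntriesIn (maximalIdeal A) (M' - M)) : IsUnit M' := by
  rw [Matrix.isUnit_iff_isUnit_det] at hM ⊢
  have h1 : (residue A).mapMatrix M' = (residue A).mapMatrix M := by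
    rw [← sub_eq_zero, ← map_sub]
    ext i j
    exact (residue_eq_zero_iff _).2 (h i j)
  refine isUnit_of_map_unit (residue A) _ ?_
  rw [RingHom.map_det, h1, ← RingHom.map_det]
  exact hM.map _

theorem exists_matrix_limit {N : ℕ → Ideal A}
    (hN : ∀ w : ℕ → A, (∀ i, ∃ n₀, ∀ n ≥ n₀, w (n + 1) - w n ∈ N i) →
      ∃ L, ∀ i, ∃ n₀, ∀ n ≥ n₀, w n - L ∈ N i) (X : ℕ → Matrix ι ι A)
    (hX : ∀ i, ∃ n₀, ∀ n ≥ n₀, EntriesIn (N i) (X (n + 1) - X n)) :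
    ∃ L, ∀ i, ∃ n₀, ∀ n ≥ n₀, EntriesIn (N i) (X n - L) := by
  have h : ∀ a b, ∃ L, ∀ i, ∃ n₀, ∀ n ≥ n₀, X n a b - L ∈ N i := fun a b =>
    hN _ fun i => (hX i).imp fun n₀ hn n hn' => hn n hn' a b
  choose L hL using h
  refine ⟨Matrix.of L, fun i => ?_⟩
  choose n₀ hn₀ using fun a b => hL a b i
  refine ⟨Finset.univ.sup fun a => Finset.univ.sup (n₀ a), fun n hn a b => hn₀ a b n ?_⟩
  exact ((Finset.le_sup (f := n₀ a) (Finset.mem_univ b)).trans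
    (Finset.le_sup (f := fun a => Finset.univ.sup (n₀ a)) (Finset.mem_univ a))).trans hn

theorem exists_limit_maximalIdeal_pow {J : Ideal A} [IsAdicComplete J A] (w : ℕ → A)
    (h : ∀ i, ∃ n₀, ∀ n ≥ n₀, w (n + 1) - w n ∈ J ^ i) :
    ∃ L, ∀ i, ∃ n₀, ∀ n ≥ n₀, w n - L ∈ J ^ i := by
  choose k hk using h
  have hk' : ∀ i m n, k i ≤ m → m ≤ n → w n - w m ∈ J ^ i := by
    intro i m n hm hmn
    induction n, hmn using Nat.le_induction with
    | base => rw [sub_self]; exact Ideal.zero_mem _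
    | succ n hmn ih =>
      rw [← sub_add_sub_cancel _ (w n)]
      exact Ideal.add_mem _ (hk i n (hm.trans hmn)) ih
  -- The running maximum of the moduli of convergence is monotone, so the subsequence along `K` is
  -- Cauchy in the normalised sense.
  let K : ℕ → ℕ := fun i => (Finset.range (i + 1)).sup k
  have hK : ∀ i, k i ≤ K i := fun i => Finset.le_sup (f := k) (by simp)
  have hKm : Monotone K := fun i j hij =>
    Finset.sup_mono (Finset.range_mono (Nat.succ_le_succ hij))
  obtain ⟨L, hL⟩ := IsPrecomplete.prec (I := J) (M := A) inferInstance (f := fun i => w (K i))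
    (fun {m n} hmn => by
      rw [SModEq.sub_mem, smul_eq_mul, Ideal.mul_top, ← neg_sub, neg_mem_iff]
      exact hk' m _ _ (hK m) (hKm hmn))
  refine ⟨L, fun i => ⟨K i, fun n hn => ?_⟩⟩
  have h1 := hL i
  rw [SModEq.sub_mem, smul_eq_mul, Ideal.mul_top] at h1
  rw [← sub_add_sub_cancel _ (w (K i))]
  exact Ideal.add_mem _ (hk' i _ _ (hK i) hn) h1

end MatrixIdeal

/-! ### Descent in matrix form: successive approximation -/

/-- The relation between the rings of two frames which is needed to descend windows along
`κ : S → W`: `g` is the normalised map `σ₁` on the ideal `I` of `W`, and `N` is a filtration of `W`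
by ideals for which `W` is complete and `κ` and `g` are continuous. -/
structure DescentData {S W : Type u} [CommRing S] [IsLocalRing S] [CommRing W] (σ : S →+* S) (θ : S)
    (κ : S →+* W) (f : W →+* W) (I : Ideal W) (g : W → W) (N : ℕ → Ideal W) : Prop where
  map_σ : ∀ a, f (κ a) = κ (σ a)
  σ_mem : ∀ a ∈ maximalIdeal S, σ a ∈ maximalIdeal S
  θ_mem : θ ∈ maximalIdeal S
  g_add : ∀ x ∈ I, ∀ y ∈ I, g (x + y) = g x + g y
  g_mul : ∀ w, ∀ x ∈ I, g (w * x) = f w * g x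
  f_eq : ∀ x ∈ I, f x = κ θ * g x
  exists_lift : ∀ w, ∃ a, w - κ a ∈ I
  g_mem : ∀ i, ∀ x ∈ I, x ∈ N (i + 1) → g x ∈ N i
  κ_mem : ∀ i, ∃ q, ∀ a ∈ maximalIdeal S ^ q, κ a ∈ N i
  antitone : Antitone N
  separated : ∀ w, (∀ i, w ∈ N i) → w = 0
  complete : ∀ w : ℕ → W, (∀ i, ∃ n₀, ∀ n ≥ n₀, w (n + 1) - w n ∈ N i) →
      ∃ L, ∀ i, ∃ n₀, ∀ n ≥ n₀, w n - L ∈ N i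
  closed : ∀ w, (∀ i, ∃ x ∈ I, w - x ∈ N i) → w ∈ I

namespace DescentData

variable {S W : Type u} [CommRing S] [IsLocalRing S] [CommRing W] {σ : S →+* S} {θ : S}
  {κ : S →+* W} {f : W →+* W} {I : Ideal W} {g : W → W} {N : ℕ → Ideal W}
  (H : DescentData σ θ κ f I g N) {ι : Type u} [Fintype ι] [DecidableEq ι]

theorem g_zero (H : DescentData σ θ κ f I g N) : g 0 = 0 := by
  simpa using H.g_add 0 I.zero_mem 0 I.zero_mem

theorem g_sum (H : DescentData σ θ κ f I g N) (s : Finset ι) (x : ι → W) (hx : ∀ k, x k ∈ I) :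
    g (∑ k ∈ s, x k) = ∑ k ∈ s, g (x k) := by
  classical
  induction s using Finset.induction_on with
  | empty => simpa using H.g_zero
  | insert k s hk ih =>
    rw [Finset.sum_insert hk, Finset.sum_insert hk, H.g_add _ (hx k) _ (I.sum_mem fun l _ => hx l),
      ih]

theorem map_g_add (H : DescentData σ θ κ f I g N) {Y Z : Matrix ι ι W} (hY : EntriesIn I Y)
    (hZ : EntriesIn I Z) : (Y + Z).map g = Y.map g + Z.map g := by
  ext i j
  exact H.g_add _ (hY i j) _ (hZ i j)

theorem map_g_mul_left (H : DescentData σ θ κ f I g N) (M : Matrix ι ι W) {Y : Matrix ι ι W}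
    (hY : EntriesIn I Y) : (M * Y).map g = f.mapMatrix M * Y.map g := by
  ext i j
  rw [Matrix.map_apply, Matrix.mul_apply, H.g_sum _ _ (fun k => I.mul_mem_left _ (hY k j)),
    Matrix.mul_apply]
  exact Finset.sum_congr rfl fun k _ => H.g_mul _ _ (hY k j)

theorem map_g_mul_right (H : DescentData σ θ κ f I g N) (M : Matrix ι ι W) {Y : Matrix ι ι W}
    (hY : EntriesIn I Y) : (Y * M).map g = Y.map g * f.mapMatrix M := by
  ext i j
  rw [Matrix.map_apply, Matrix.mul_apply, H.g_sum _ _ (fun k => I.mul_mem_right _ (hY i k)),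
    Matrix.mul_apply]
  refine Finset.sum_congr rfl fun k _ => ?_
  rw [mul_comm, H.g_mul _ _ (hY i k), mul_comm]
  rfl

theorem mapMatrix_f (H : DescentData σ θ κ f I g N) {Y : Matrix ι ι W} (hY : EntriesIn I Y) :
    f.mapMatrix Y = κ θ • Y.map g := by
  ext i j
  exact H.f_eq _ (hY i j)

theorem mapMatrix_f_κ (H : DescentData σ θ κ f I g N) (M : Matrix ι ι S) :
    f.mapMatrix (κ.mapMatrix M) = κ.mapMatrix (σ.mapMatrix M) := by
  ext i j
  exact H.map_σ _

theorem exists_lift_matrix (H : DescentData σ θ κ f I g N) (M : Matrix ι ι W) :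
    ∃ t : Matrix ι ι S, EntriesIn I (M - κ.mapMatrix t) := by
  choose a ha using H.exists_lift
  exact ⟨Matrix.of fun i j => a (M i j), fun i j => ha _⟩

variable (κ g) in
/-- The operator `X ↦ Φ(X)` on the matrices congruent to `1` modulo `I`, attached to matrices
`D` and `D'` with `D' D = θ`. -/
noncomputable def phi (D D' : Matrix ι ι S) (X : Matrix ι ι W) : Matrix ι ι W :=
  1 + κ.mapMatrix D * (X - 1).map g * κ.mapMatrix D'

/-- Expand `XZ - 1 = (X - 1) + (Z - 1) + (X - 1)(Z - 1)`. By semilinearity `g` sends the last term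
to `f(X - 1) g(Z - 1) = κ(θ) g(X - 1) g(Z - 1)`, and the same factor `κ(θ)` arises from `D' D` in
the product of the two values. -/
theorem phi_mul (H : DescentData σ θ κ f I g N) {D D' : Matrix ι ι S} (hD : D' * D = θ • 1)
    {X Z : Matrix ι ι W} (hX : EntriesIn I (X - 1)) (hZ : EntriesIn I (Z - 1)) :
    phi κ g D D' (X * Z) = phi κ g D D' X * phi κ g D D' Z := by
  have h1 : X * Z - 1 = (X - 1) + ((Z - 1) + (X - 1) * (Z - 1)) := by noncomm_ring
  have hXZ := hX.mul_right (Z - 1)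
  have h2 : κ.mapMatrix D' * κ.mapMatrix D = κ θ • 1 := by
    rw [← map_mul, hD]
    ext i j
    by_cases hij : i = j <;> simp [hij]
  rw [phi, h1, H.map_g_add hX (hZ.add hXZ), H.map_g_add hZ hXZ, H.map_g_mul_left _ hZ,
    H.mapMatrix_f hX, phi, phi]
  set a := (X - 1).map g
  set b := (Z - 1).map g
  set d := κ.mapMatrix D
  set d' := κ.mapMatrix D'
  have h3 : (1 + d * a * d') * (1 + d * b * d') =
      1 + d * a * d' + d * b * d' + d * a * (d' * d) * b * d' := by noncomm_ring
  rw [h3, h2, Matrix.smul_mul, Matrix.mul_add, Matrix.mul_add, Matrix.mul_smul, Matrix.add_mul,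
    Matrix.add_mul, Matrix.mul_smul, Matrix.smul_mul, Matrix.smul_mul, Matrix.smul_mul,
    Matrix.mul_one, ← Matrix.mul_assoc]
  simp only [add_assoc]

/-- A stage of the approximation process. -/
structure Stage (ι S W : Type u) where
  A : Matrix ι ι S
  B : Matrix ι ι S
  L : Matrix ι ι S
  R : Matrix ι ι S
  Θ : Matrix ι ι W
  X : Matrix ι ι W

/-- The correction factor of a stage. -/
noncomputable def Stage.factor (κ : S →+* W) (s : Stage ι S W) : Matrix ι ι W :=
  1 + κ.mapMatrix s.L * s.Θ * κ.mapMatrix s.R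

/-- The invariants of the approximation process. -/
structure Stage.Valid (κ : S →+* W) (I : Ideal W) (g : W → W) (D D' : Matrix ι ι S)
    (Ψ : Matrix ι ι W) (s : Stage ι S W) : Prop where
  mul_eq_one : s.A * s.B = 1
  Θ_mem : EntriesIn I s.Θ
  X_mem : EntriesIn I (s.X - 1)
  eq_phi : κ.mapMatrix s.B * (s.factor κ * s.X) * Ψ = phi κ g D D' s.X

/-- Moving `D` to the other side, the determinant equals that of `1 + θ s`, a matrix congruent to
`1` modulo `𝔪`. -/
theorem isUnit_one_add_mul (H : DescentData σ θ κ f I g N) {D D' : Matrix ι ι S}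
    (hD : D' * D = θ • 1) (s : Matrix ι ι S) : IsUnit (1 + D * s * D') := by
  have h1 : IsUnit (1 + θ • s) := isUnit_of_entriesIn_sub isUnit_one (by
    rw [add_sub_cancel_left]
    exact EntriesIn.smul_of_mem H.θ_mem s)
  rw [Matrix.isUnit_iff_isUnit_det] at h1 ⊢
  rwa [Matrix.mul_assoc, Matrix.det_one_add_mul_comm, Matrix.mul_assoc, hD, Matrix.mul_smul,
    Matrix.mul_one]

/-- Multiplying `X` by the correction factor `1 + κ(L) Θ κ(R)` multiplies the right side by `Φ` of
this factor, which involves `g(Θ)`. Write `g(Θ) = κ(t) + Θ'` with `Θ'` in `I`. The part from `S`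
gives an invertible matrix `G`, absorbed by replacing `B` with `G B`; the part with `Θ'` is the new
error. Its right-hand matrix is `σ(R) D' B`, so each stage adds one factor `D' B`, of the shape of a
matrix of `V♯`. -/
theorem exists_next (H : DescentData σ θ κ f I g N) {D D' : Matrix ι ι S} (hD : D' * D = θ • 1)
    {Ψ : Matrix ι ι W} (s : Stage ι S W) (hs : s.Valid κ I g D D' Ψ) :
    ∃ s' : Stage ι S W, s'.Valid κ I g D D' Ψ ∧
      (∃ t, s'.B = (1 + D * (t * σ.mapMatrix s.R) * D') * s.B) ∧
      s'.R = σ.mapMatrix s.R * D' * s.B ∧ s'.X = s.factor κ * s.X := by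
  obtain ⟨t, ht⟩ := H.exists_lift_matrix (s.Θ.map g)
  set Θ' := s.Θ.map g - κ.mapMatrix t with hΘ'
  set G := 1 + D * (σ.mapMatrix s.L * t * σ.mapMatrix s.R) * D' with hG
  obtain ⟨G', hG'⟩ := H.isUnit_one_add_mul hD (σ.mapMatrix s.L * t * σ.mapMatrix s.R)
  rw [← hG] at hG'
  have hGG : G * (↑G'⁻¹ : Matrix ι ι S) = 1 := by rw [← hG']; exact G'.mul_inv
  have hGG' : (↑G'⁻¹ : Matrix ι ι S) * G = 1 := by rw [← hG']; exact G'.inv_mul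
  have hΓ : EntriesIn I (κ.mapMatrix s.L * s.Θ * κ.mapMatrix s.R) :=
    (hs.Θ_mem.mul_left _).mul_right _
  have hfac : EntriesIn I (s.factor κ - 1) := by
    rw [Stage.factor, add_sub_cancel_left]
    exact hΓ
  have hBA : s.B * s.A = 1 := mul_eq_one_comm.1 hs.mul_eq_one
  refine ⟨⟨s.A * (↑G'⁻¹ : Matrix ι ι S), G * s.B,
    s.A * (↑G'⁻¹ : Matrix ι ι S) * D * σ.mapMatrix s.L, σ.mapMatrix s.R * D' * s.B, Θ',
    s.factor κ * s.X⟩, ⟨?_, ht, ?_, ?_⟩, ⟨σ.mapMatrix s.L * t, rfl⟩, rfl, rfl⟩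
  · change s.A * (↑G'⁻¹ : Matrix ι ι S) * (G * s.B) = 1
    rw [Matrix.mul_assoc, ← Matrix.mul_assoc _ G, hGG', Matrix.one_mul, hs.mul_eq_one]
  · change EntriesIn I (s.factor κ * s.X - 1)
    rw [show s.factor κ * s.X - 1 = (s.factor κ - 1) * s.X + (s.X - 1) by noncomm_ring]
    exact (hfac.mul_right _).add hs.X_mem
  · have h1 : phi κ g D D' (s.factor κ) = κ.mapMatrix G +
        κ.mapMatrix (D * σ.mapMatrix s.L) * Θ' * κ.mapMatrix (σ.mapMatrix s.R * D') := by
      rw [phi, Stage.factor, add_sub_cancel_left, H.map_g_mul_right _ (hs.Θ_mem.mul_left _),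
        H.map_g_mul_left _ hs.Θ_mem, H.mapMatrix_f_κ, H.mapMatrix_f_κ, hG, hΘ']
      simp only [map_add, map_mul, map_one]
      noncomm_ring
    rw [H.phi_mul hD hfac hs.X_mem, h1, ← hs.eq_phi]
    change κ.mapMatrix (G * s.B) * ((1 + κ.mapMatrix (s.A * (↑G'⁻¹ : Matrix ι ι S) * D *
      σ.mapMatrix s.L) * Θ' * κ.mapMatrix (σ.mapMatrix s.R * D' * s.B)) * (s.factor κ * s.X)) * Ψ = _
    clear h1
    simp only [map_mul]
    have h2 : κ.mapMatrix G * κ.mapMatrix (↑G'⁻¹ : Matrix ι ι S) = 1 := by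
      rw [← map_mul, hGG, map_one]
    have h3 : κ.mapMatrix s.B * κ.mapMatrix s.A = 1 := by rw [← map_mul, hBA, map_one]
    generalize κ.mapMatrix G = a at *
    generalize κ.mapMatrix (↑G'⁻¹ : Matrix ι ι S) = b at *
    generalize κ.mapMatrix s.A = c at *
    generalize κ.mapMatrix s.B = d at *
    generalize s.factor κ = e at *
    generalize κ.mapMatrix D = x
    generalize κ.mapMatrix D' = y
    have h4 : ∀ M, a * (d * (c * (b * M))) = M := fun M => by
      rw [← Matrix.mul_assoc d, h3, Matrix.one_mul, ← Matrix.mul_assoc, h2, Matrix.one_mul]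
    simp only [Matrix.mul_add, Matrix.add_mul, Matrix.one_mul, Matrix.mul_assoc, h4]

/-- As `D' D = θ` lies in `𝔪`, the matrices `D' B` of all stages agree modulo `𝔪`. Hence `k` further
stages multiply the twisted `R` by a matrix congruent to `v k`; once `v k` vanishes modulo `𝔪`,
every `k` stages gain a power of `𝔪`. -/
theorem exists_factor_R (H : DescentData σ θ κ f I g N) {D D' : Matrix ι ι S}
    (hD : D' * D = θ • 1) (s : ℕ → Stage ι S W)
    (hB : ∀ n, ∃ t, (s (n + 1)).B = (1 + D * (t * σ.mapMatrix (s n).R) * D') * (s n).B)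
    (hR : ∀ n, (s (n + 1)).R = σ.mapMatrix (s n).R * D' * (s n).B)
    (v : ℕ → Matrix ι ι S) (hv0 : v 0 = 1)
    (hv : ∀ n, v (n + 1) = σ.mapMatrix (v n) * (D' * (s 0).B)) (n k : ℕ) :
    EntriesIn (maximalIdeal S) (D' * (s n).B - D' * (s 0).B) ∧
    ∃ U, (s (n + k)).R = σ.mapMatrix^[k] (s n).R * U ∧ EntriesIn (maximalIdeal S) (U - v k) := by
  have h1 : ∀ n, EntriesIn (maximalIdeal S) (D' * (s n).B - D' * (s 0).B) := by
    intro n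
    induction n with
    | zero => rw [sub_self]; exact EntriesIn.zero
    | succ n ih =>
      obtain ⟨t, ht⟩ := hB n
      have h2 : D' * (s (n + 1)).B = D' * (s n).B +
          θ • (t * σ.mapMatrix (s n).R * (D' * (s n).B)) := by
        rw [ht]
        have h3 : D' * ((1 + D * (t * σ.mapMatrix (s n).R) * D') * (s n).B) = D' * (s n).B +
          (D' * D) * (t * σ.mapMatrix (s n).R * (D' * (s n).B)) := by noncomm_ring
        rw [h3, hD, Matrix.smul_mul, Matrix.one_mul]
      rw [h2, add_sub_right_comm]
      exact ih.add (EntriesIn.smul_of_mem H.θ_mem _)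
  refine ⟨h1 n, ?_⟩
  induction k with
  | zero =>
    refine ⟨1, by rw [Matrix.mul_one]; rfl, ?_⟩
    rw [hv0, sub_self]
    exact EntriesIn.zero
  | succ k ih =>
    obtain ⟨U, hU, hUv⟩ := ih
    refine ⟨σ.mapMatrix U * (D' * (s (n + k)).B), ?_, ?_⟩
    · rw [← add_assoc, hR, hU, map_mul, Function.iterate_succ_apply']
      simp only [Matrix.mul_assoc]
    · have h2 : σ.mapMatrix U * (D' * (s (n + k)).B) - v (k + 1) =
          σ.mapMatrix (U - v k) * (D' * (s (n + k)).B) +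
          σ.mapMatrix (v k) * (D' * (s (n + k)).B - D' * (s 0).B) := by
        rw [hv, map_sub, Matrix.sub_mul, Matrix.mul_sub]
        abel
      rw [h2]
      exact ((hUv.map σ H.σ_mem).mul_right _).add ((h1 _).mul_left _)

/-- The matrix form of the descent of windows: the equation `κ(B) X Ψ = Φ(X)` has a solution. -/
theorem exists_solution [IsAdicComplete (maximalIdeal S) S] (H : DescentData σ θ κ f I g N)
    {D D' : Matrix ι ι S} (hD : D' * D = θ • 1) {Ψ Ψ' : Matrix ι ι W} (hΨ : Ψ' * Ψ = 1)
    {A₀ B₀ : Matrix ι ι S} (hAB : A₀ * B₀ = 1) (hA₀ : EntriesIn I (κ.mapMatrix A₀ - Ψ))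
    (v : ℕ → Matrix ι ι S) (hv0 : v 0 = 1) (hv : ∀ n, v (n + 1) = σ.mapMatrix (v n) * (D' * B₀))
    {k : ℕ} (hk : EntriesIn (maximalIdeal S) (v k)) :
    ∃ (A B : Matrix ι ι S) (X : Matrix ι ι W), A * B = 1 ∧
      EntriesIn (maximalIdeal S) (D' * B - D' * B₀) ∧ EntriesIn I (X - 1) ∧
      κ.mapMatrix B * X * Ψ = phi κ g D D' X := by
  have hΨ' : Ψ * Ψ' = 1 := mul_eq_one_comm.1 hΨ
  have hBA : B₀ * A₀ = 1 := mul_eq_one_comm.1 hAB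
  -- With `X = 1` the correction factor is `κ(A₀) Ψ⁻¹`, so the invariant reads `κ(B₀) κ(A₀) Ψ⁻¹ Ψ =
  -- 1 = Φ(1)`.
  let s₀ : Stage ι S W := ⟨A₀, B₀, 1, 1, κ.mapMatrix A₀ * Ψ' - 1, 1⟩
  have hs₀ : s₀.Valid κ I g D D' Ψ := by
    refine ⟨hAB, ?_, ?_, ?_⟩
    · change EntriesIn I (κ.mapMatrix A₀ * Ψ' - 1)
      rw [← hΨ', ← Matrix.sub_mul]
      exact hA₀.mul_right _
    · change EntriesIn I (1 - 1)
      rw [sub_self]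
      exact EntriesIn.zero
    · change κ.mapMatrix B₀ * ((1 + κ.mapMatrix 1 * (κ.mapMatrix A₀ * Ψ' - 1) * κ.mapMatrix 1) * 1)
        * Ψ = phi κ g D D' 1
      have h1 : (0 : Matrix ι ι W).map g = 0 := by
        ext i j
        exact H.g_zero
      rw [phi, sub_self, h1, map_one, Matrix.one_mul, Matrix.mul_one, Matrix.mul_one,
        add_sub_cancel, ← Matrix.mul_assoc, ← map_mul, hBA, map_one, Matrix.one_mul, hΨ,
        Matrix.mul_zero, Matrix.zero_mul, add_zero]
  choose nxt hnxt using fun s : {s : Stage ι S W // s.Valid κ I g D D' Ψ} => H.exists_next hD s.1 s.2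
  let S' : ℕ → {s : Stage ι S W // s.Valid κ I g D D' Ψ} := fun n =>
    Nat.rec ⟨s₀, hs₀⟩ (fun _ s => ⟨nxt s, (hnxt s).1⟩) n
  let s : ℕ → Stage ι S W := fun n => (S' n).1
  have hs : ∀ n, (s n).Valid κ I g D D' Ψ := fun n => (S' n).2
  have hB : ∀ n, ∃ t, (s (n + 1)).B = (1 + D * (t * σ.mapMatrix (s n).R) * D') * (s n).B :=
    fun n => (hnxt (S' n)).2.1
  have hR : ∀ n, (s (n + 1)).R = σ.mapMatrix (s n).R * D' * (s n).B := fun n => (hnxt (S' n)).2.2.1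
  have hX : ∀ n, (s (n + 1)).X = (s n).factor κ * (s n).X := fun n => (hnxt (S' n)).2.2.2
  have hfac := H.exists_factor_R hD s hB hR v hv0 hv
  have hσpow : ∀ q, ∀ a ∈ maximalIdeal S ^ q, σ a ∈ maximalIdeal S ^ q := by
    intro q
    have h : (maximalIdeal S ^ q).map σ ≤ maximalIdeal S ^ q := by
      rw [Ideal.map_pow]
      exact Ideal.pow_right_mono (Ideal.map_le_iff_le_comap.2 H.σ_mem) q
    exact Ideal.map_le_iff_le_comap.1 h
  have hRmem : ∀ q n, q * k ≤ n → EntriesIn (maximalIdeal S ^ q) (s n).R := by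
    intro q
    induction q with
    | zero => intro n _ i j; simp
    | succ q ih =>
      intro n hn
      rw [add_mul, one_mul] at hn
      obtain ⟨m, rfl⟩ : ∃ m, n = m + k := ⟨n - k, by omega⟩
      obtain ⟨U, hU, hUv⟩ := (hfac m k).2
      have hU' : EntriesIn (maximalIdeal S) U := by
        have := hUv.add hk
        rwa [sub_add_cancel] at this
      rw [hU, pow_succ]
      refine EntriesIn.mul ?_ hU'
      have : ∀ l, EntriesIn (maximalIdeal S ^ q) (σ.mapMatrix^[l] (s m).R) := by
        intro l
        induction l with
        | zero => exact ih m (by omega)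
        | succ l hl =>
          rw [Function.iterate_succ_apply']
          exact hl.map σ (hσpow q)
      exact this k
  -- Successive `B` differ by `D t σ(R) D' B`, which tends to zero with `R`; the factors `X`
  -- converge likewise by continuity of `κ`.
  obtain ⟨B, hBlim⟩ := exists_matrix_limit (N := fun q => maximalIdeal S ^ q)
    exists_limit_maximalIdeal_pow (fun n => (s n).B) (fun q => ⟨q * k, fun n hn => by
      obtain ⟨t, ht⟩ := hB n
      rw [ht, show (1 + D * (t * σ.mapMatrix (s n).R) * D') * (s n).B - (s n).B =
        D * t * (σ.mapMatrix (s n).R) * (D' * (s n).B) by noncomm_ring]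
      exact (((hRmem q n hn).map σ (hσpow q)).mul_left _).mul_right _⟩)
  obtain ⟨X, hXlim⟩ := exists_matrix_limit H.complete (fun n => (s n).X) (fun i => by
    obtain ⟨q, hq⟩ := H.κ_mem i
    refine ⟨q * k, fun n hn => ?_⟩
    rw [hX, Stage.factor, Matrix.add_mul, Matrix.one_mul, add_sub_cancel_left]
    exact (((hRmem q n hn).map κ hq).mul_left _).mul_right _)
  obtain ⟨n₁, hn₁⟩ := hBlim 1
  simp only [pow_one] at hn₁
  have hBunit : IsUnit B := by
    refine isUnit_of_entriesIn_sub (M := (s n₁).B)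
      (IsUnit.of_mul_eq_one_right _ (hs n₁).mul_eq_one) ?_
    rw [← neg_sub]
    exact (hn₁ n₁ le_rfl).neg
  have hXI : EntriesIn I (X - 1) := fun i j => H.closed _ fun l => by
    obtain ⟨n, hn⟩ := hXlim l
    refine ⟨_, (hs n).X_mem i j, ?_⟩
    rw [← Matrix.sub_apply, sub_sub_sub_cancel_right, ← neg_sub]
    exact (hn n le_rfl).neg i j
  obtain ⟨⟨B', A, hB1, hB2⟩, rfl⟩ := hBunit
  refine ⟨A, B', X, hB2, ?_, hXI, ?_⟩
  · rw [show D' * B' - D' * B₀ = (D' * (s n₁).B - D' * B₀) - D' * ((s n₁).B - B') by noncomm_ring]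
    exact (hfac n₁ 0).1.sub ((hn₁ n₁ le_rfl).mul_left _)
  -- The limit satisfies the equation because both sides are continuous; `X` is approximated to
  -- order `i + 1`, since `g` loses one step of the filtration.
  · have hlim : ∀ i, EntriesIn (N i) (κ.mapMatrix B' * X * Ψ - phi κ g D D' X) := by
      intro i
      obtain ⟨q, hq⟩ := H.κ_mem i
      obtain ⟨n₂, hn₂⟩ := hBlim q
      obtain ⟨n₃, hn₃⟩ := hXlim (i + 1)
      let n := max n₂ n₃
      have e1 : κ.mapMatrix (s n).B * (s (n + 1)).X * Ψ = phi κ g D D' (s n).X := by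
        rw [hX]
        exact (hs n).eq_phi
      have e2 : phi κ g D D' X - phi κ g D D' (s n).X =
          κ.mapMatrix D * (X - (s n).X).map g * κ.mapMatrix D' := by
        have hXs : EntriesIn I (X - (s n).X) := by
          rw [← sub_sub_sub_cancel_right _ _ 1]
          exact hXI.sub (hs n).X_mem
        rw [phi, phi, add_sub_add_left_eq_sub, ← Matrix.sub_mul, ← Matrix.mul_sub]
        congr 2
        rw [← sub_add_sub_cancel X (s n).X 1, H.map_g_add hXs (hs n).X_mem, add_sub_cancel_right]
      have hXs : EntriesIn I (X - (s n).X) := by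
        rw [← sub_sub_sub_cancel_right _ _ 1]
        exact hXI.sub (hs n).X_mem
      have e3 : EntriesIn (N i) ((X - (s n).X).map g) := fun a b => by
        refine H.g_mem i _ (hXs a b) ?_
        rw [← neg_sub]
        exact (hn₃ n (le_max_right _ _)).neg a b
      have e4 : κ.mapMatrix B' * X * Ψ - phi κ g D D' X =
          -(κ.mapMatrix ((s n).B - B') * (X * Ψ)) -
          κ.mapMatrix (s n).B * ((s (n + 1)).X - X) * Ψ -
          (phi κ g D D' X - phi κ g D D' (s n).X) := by
        rw [← e1, map_sub]
        noncomm_ring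
      rw [e4, e2]
      refine ((((hn₂ n (le_max_left _ _)).map κ hq).mul_right _).neg.sub ?_).sub
        ((e3.mul_left _).mul_right _)
      exact (((hn₃ (n + 1) ((le_max_right _ _).trans (Nat.le_succ _))).mono
        (H.antitone (Nat.le_succ i))).mul_left _).mul_right _
    rw [← sub_eq_zero]
    ext a b
    exact H.separated _ fun i => hlim i a b

end DescentData

/-! ### Nilpotence in terms of matrices -/

section iterMatrix

variable {ι A A' : Type u} [Fintype ι] [DecidableEq ι] [CommRing A] [CommRing A']

/-- The products `σⁿ⁻¹(v) ⋯ σ(v) v`. -/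
def iterMatrix (σ : A →+* A) (v : Matrix ι ι A) : ℕ → Matrix ι ι A
  | 0 => 1
  | n + 1 => σ.mapMatrix (iterMatrix σ v n) * v

theorem map_iterMatrix {σ : A →+* A} {f : A' →+* A'} {κ : A →+* A'} (h : ∀ a, f (κ a) = κ (σ a))
    (v : Matrix ι ι A) (n : ℕ) :
    κ.mapMatrix (iterMatrix σ v n) = iterMatrix f (κ.mapMatrix v) n := by
  induction n with
  | zero => exact map_one _
  | succ n ih =>
    rw [iterMatrix, iterMatrix, map_mul, ← ih]
    congr 1
    ext i j
    exact (h _).symm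

theorem iterMatrix_sub_mem {σ : A →+* A} {J : Ideal A} (hJ : ∀ a ∈ J, σ a ∈ J)
    {v w : Matrix ι ι A} (h : EntriesIn J (v - w)) (n : ℕ) :
    EntriesIn J (iterMatrix σ v n - iterMatrix σ w n) := by
  induction n with
  | zero => rw [iterMatrix, iterMatrix, sub_self]; exact EntriesIn.zero
  | succ n ih =>
    rw [iterMatrix, iterMatrix, show σ.mapMatrix (iterMatrix σ v n) * v -
      σ.mapMatrix (iterMatrix σ w n) * w =
      σ.mapMatrix (iterMatrix σ v n - iterMatrix σ w n) * v +
        σ.mapMatrix (iterMatrix σ w n) * (v - w) by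
          rw [map_sub, Matrix.sub_mul, Matrix.mul_sub]; abel]
    exact ((ih.map σ hJ).mul_right _).add (h.mul_left _)

theorem exists_iterMatrix_smul (σ : A →+* A) (c : A) (v : Matrix ι ι A) (n : ℕ) :
    ∃ d : A, iterMatrix σ (c • v) n = d • iterMatrix σ v n := by
  induction n with
  | zero => exact ⟨1, (one_smul _ _).symm⟩
  | succ n ih =>
    obtain ⟨d, hd⟩ := ih
    refine ⟨σ d * c, ?_⟩
    rw [iterMatrix, hd, iterMatrix, show σ.mapMatrix (d • iterMatrix σ v n) =
      σ d • σ.mapMatrix (iterMatrix σ v n) by ext i j; simp, Matrix.smul_mul, Matrix.mul_smul,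
      smul_smul]

end iterMatrix

namespace Window

open CategoryTheory ChangeOfRings

variable {p : ℕ} {S : Type u} [CommRing S] {F : Frame p S} (P : Window F)

/-- Apply `V♯` to `σ₁(a) Fr x = F₁(a x)`: the result is `1 ⊗ a x = σ₁(a) (θ ⊗ x)`, and `σ₁(a)` can
be cancelled because `σ₁(I)` generates `S`. -/
theorem vLin_Fr {V : P.twist 0 ⟶ P.twist 1} (hV : P.IsVSharp V) (x : P.P) :
    P.vLin V (P.Fr x) = tw (M := ModuleCat.of S P.P) F.σ F.theta x := by
  have key : ∀ y ∈ Submodule.span S (Set.range F.σ₁),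
      y • P.vLin V (P.Fr x) = y • tw (M := ModuleCat.of S P.P) F.σ F.theta x := by
    intro y hy
    induction hy using Submodule.span_induction with
    | mem y hy =>
      obtain ⟨a, rfl⟩ := hy
      have h1 := (P.isVSharp_iff V).1 hV ⟨(a : S) • x, P.smul_mem_Q a x⟩
      rw [P.F₁_smul, map_smul] at h1
      rw [h1, smul_tw, mul_comm, ← F.sigma_eq_theta]
      refine (tw_smul (M := ModuleCat.of S P.P) F.σ 1 (a : S) x).trans ?_
      rw [one_mul]
    | zero => rw [zero_smul, zero_smul]
    | add y z _ _ hy hz => rw [add_smul, add_smul, hy, hz]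
    | smul c y _ hy => rw [smul_eq_mul, mul_smul, mul_smul, hy]
  simpa only [one_smul] using key 1 (by rw [F.span_σ₁]; trivial)

section basis

variable {P} {ι : Type u} [Fintype ι] [DecidableEq ι] (b : Module.Basis ι S P.P)

/-- The elements `1 ⊗ ⋯ ⊗ 1 ⊗ x` of the Frobenius twists. -/
noncomputable def oneTwist (x : P.P) : (n : ℕ) → P.twist n
  | 0 => x
  | n + 1 => tw (M := P.twist n) F.σ 1 (oneTwist x n)

theorem iterLin_basis {V : P.twist 0 ⟶ P.twist 1} {v : Matrix ι ι S}
    (hv : ∀ k, P.vLin V (b k) = ∑ j, tw (M := ModuleCat.of S P.P) F.σ (v j k) (b j)) (n : ℕ) (k : ι) :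
    P.iterLin V n (b k) = ∑ i, iterMatrix F.σ v n i k • oneTwist (b i) n := by
  induction n generalizing k with
  | zero =>
    rw [Finset.sum_eq_single k (fun i _ hik => by
      rw [iterMatrix, Matrix.one_apply_ne hik, zero_smul]) (fun h => absurd (Finset.mem_univ k) h)]
    rw [iterMatrix, Matrix.one_apply_eq, one_smul]
    rfl
  | succ n ih =>
    rw [iterLin_succ, hv, map_sum]
    have h1 : ∀ j, ((ModuleCat.extendScalars F.σ).map (ModuleCat.ofHom (P.iterLin V n))).hom
        (tw (M := ModuleCat.of S P.P) F.σ (v j k) (b j)) =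
        ∑ i, (v j k * F.σ (iterMatrix F.σ v n i j)) • tw (M := P.twist n) F.σ 1 (oneTwist (b i) n) := by
      intro j
      refine (map_tw (M := ModuleCat.of S P.P) (N := P.twist n) F.σ
        (ModuleCat.ofHom (P.iterLin V n)) (v j k) (b j)).trans ?_
      refine (congrArg (tw (M := P.twist n) F.σ (v j k)) (ih j)).trans ?_
      have h2 : ∀ (s : Finset ι) (y : ι → P.twist n), tw (M := P.twist n) F.σ (v j k) (∑ i ∈ s, y i) =
          ∑ i ∈ s, tw (M := P.twist n) F.σ (v j k) (y i) := fun s y =>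
        map_sum (AddMonoidHom.mk' (fun z : P.twist n => tw (M := P.twist n) F.σ (v j k) z)
          (fun a b => tw_add _ _ _ _)) y s
      rw [h2]
      refine Finset.sum_congr rfl fun i _ => ?_
      rw [tw_smul, smul_tw, mul_one]
    refine (Finset.sum_congr rfl fun j _ => h1 j).trans ?_
    rw [Finset.sum_comm]
    refine Finset.sum_congr rfl fun i _ => ?_
    rw [← Finset.sum_smul, iterMatrix, Matrix.mul_apply]
    refine congrArg (fun c => c • tw (M := P.twist n) F.σ 1 (oneTwist (b i) n)) ?_
    exact Finset.sum_congr rfl fun j _ => mul_comm _ _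

/-- Extending a coordinate function along `σ : S → S` gives a coordinate function on the twist. This
detects coefficients of `(V♯)^n` without constructing bases of the twists. -/
theorem twistLift_oneTwist (i j : ι) (n : ℕ) :
    P.twistLift (F.σ.toSemilinearMap) (b.coord i) n (oneTwist (b j) n) = (1 : Matrix ι ι S) i j := by
  induction n with
  | zero =>
    change b.repr (b j) i = _
    rw [b.repr_self, Finsupp.single_apply, Matrix.one_apply]
    simp only [eq_comm]
  | succ n ih =>
    refine (twistLift_succ_tw P _ _ n 1 _).trans ?_
    rw [ih, one_smul]
    change F.σ _ = _
    rw [Matrix.one_apply]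
    split_ifs
    · exact map_one _
    · exact map_zero _

theorem isNilpotent_iff_iterMatrix {V : P.twist 0 ⟶ P.twist 1} (hV : P.IsVSharp V)
    {v : Matrix ι ι S}
    (hv : ∀ k, P.vLin V (b k) = ∑ j, tw (M := ModuleCat.of S P.P) F.σ (v j k) (b j)) {J : Ideal S} :
    IsNilpotent J P ↔ ∃ N, ∀ n ≥ N, EntriesIn J (iterMatrix F.σ v n) := by
  constructor
  · rintro ⟨V', hV', N, hN⟩
    obtain rfl := P.isVSharp_unique hV hV'
    refine ⟨N, fun n hn i k => ?_⟩
    have h1 : P.iterLin V n (b k) ∈ J • (⊤ : Submodule S (P.twist n)) := hN n hn (b k)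
    have h2 := Submodule.mem_map_of_mem (f := P.twistLift (F.σ.toSemilinearMap) (b.coord i) n) h1
    rw [Submodule.map_smul''] at h2
    have h3 := Submodule.smul_mono le_rfl le_top h2
    rw [smul_eq_mul, Ideal.mul_top, iterLin_basis b hv, map_sum] at h3
    simp only [map_smul, twistLift_oneTwist, smul_eq_mul, Matrix.one_apply, mul_ite, mul_one,
      mul_zero, Finset.sum_ite_eq, Finset.mem_univ, if_true] at h3
    exact h3
  · rintro ⟨N, hN⟩
    refine ⟨V, hV, N, fun n hn => ?_⟩
    have h : (⊤ : Submodule S P.P) ≤ (J • (⊤ : Submodule S (P.twist n))).comap (P.iterLin V n) := by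
      rw [← b.span_eq, Submodule.span_le]
      rintro _ ⟨k, rfl⟩
      change P.iterLin V n (b k) ∈ J • (⊤ : Submodule S (P.twist n))
      rw [iterLin_basis b hv]
      exact Submodule.sum_mem _ fun i _ => Submodule.smul_mem_smul (hN n hn i k) trivial
    exact fun x => h (Submodule.mem_top (x := x))

end basis

namespace AdaptedBasis

variable {P} {ι : Type u} [Fintype ι] [DecidableEq ι] (B : P.AdaptedBasis ι)

open Classical in
/-- The diagonal matrix with entries `1` on `L` and `θ` on `T`. -/
noncomputable def coDiag (ε : ι → Prop) (θ : S) : Matrix ι ι S :=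
  Matrix.diagonal fun i => if ε i then 1 else θ

open Classical in
/-- The diagonal matrix with entries `θ` on `L` and `1` on `T`. -/
noncomputable def diag (ε : ι → Prop) (θ : S) : Matrix ι ι S :=
  Matrix.diagonal fun i => if ε i then θ else 1

theorem coDiag_mul_diag (ε : ι → Prop) (θ : S) : coDiag ε θ * diag ε θ = θ • 1 := by
  rw [coDiag, diag, Matrix.diagonal_mul_diagonal, Matrix.smul_one_eq_diagonal]
  congr 1
  ext i
  split_ifs <;> simp

/-- The matrix of the basis `val F₁ Fr`. -/
noncomputable def mat : Matrix ι ι S := Matrix.of fun i j => B.b.repr (B.val P.F₁ P.Fr j) i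

/-- On the basis `F₁ (b i)`, `Fr (b i)` the map `V♯` is diagonal, with entries `1` on `L` and `θ` on
`T`; changing to the basis `b` multiplies by the inverse of the matrix of the window. -/
theorem vLin_b {V : P.twist 0 ⟶ P.twist 1} (hV : P.IsVSharp V) {M' : Matrix ι ι S}
    (hM : B.mat * M' = 1) (k : ι) : P.vLin V (B.b k) =
      ∑ j, tw (M := ModuleCat.of S P.P) F.σ ((coDiag B.ε F.theta * M') j k) (B.b j) := by
  classical
  have h1 : ∀ j, P.vLin V (B.val P.F₁ P.Fr j) =
      tw (M := ModuleCat.of S P.P) F.σ (if B.ε j then 1 else F.theta) (B.b j) := by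
    intro j
    by_cases hj : B.ε j
    · rw [val, dif_pos hj, if_pos hj]
      exact (P.isVSharp_iff V).1 hV ⟨B.b j, B.b_mem j hj⟩
    · rw [val, dif_neg hj, if_neg hj]
      exact P.vLin_Fr hV _
  have h2 : B.b k = ∑ j, M' j k • B.val P.F₁ P.Fr j := by
    apply B.b.repr.injective
    ext i
    rw [map_sum, Finsupp.coe_finsetSum, Finset.sum_apply, B.b.repr_self, Finsupp.single_apply]
    have h3 := congrFun (congrFun hM i) k
    rw [Matrix.mul_apply, Matrix.one_apply] at h3
    simp only [eq_comm (a := k)]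
    rw [← h3]
    refine Finset.sum_congr rfl fun j _ => ?_
    rw [map_smul, Finsupp.smul_apply, smul_eq_mul, mul_comm]
    rfl
  rw [h2, map_sum]
  refine Finset.sum_congr rfl fun j _ => ?_
  rw [map_smul, h1, smul_tw, coDiag, Matrix.diagonal_mul, mul_comm]

theorem isNilpotent_iff [IsLocalRing S] {M' : Matrix ι ι S} (hM : B.mat * M' = 1) {J : Ideal S} :
    IsNilpotent J P ↔
      ∃ N, ∀ n ≥ N, EntriesIn J (iterMatrix F.σ (coDiag B.ε F.theta * M') n) := by
  obtain ⟨V, hV⟩ := P.exists_isVSharp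
  exact isNilpotent_iff_iterMatrix B.b hV (B.vLin_b hV hM)

theorem isUnit_mat : IsUnit B.mat := by
  obtain ⟨c, hc⟩ := B.exists_basis_val
  refine IsUnit.of_mul_eq_one (c.toMatrix B.b) ?_
  have h : B.mat = B.b.toMatrix c := by
    ext i j
    rw [Module.Basis.toMatrix_apply, hc]
    rfl
  rw [h, B.b.toMatrix_mul_toMatrix_flip]

end AdaptedBasis

end Window

/-! ### Windows given by matrices and their isomorphisms -/

namespace Window

open CategoryTheory
open scoped Matrix

variable {p : ℕ} {S : Type u} [CommRing S] {F : Frame p S}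

section ofMatrix

variable {ι : Type u} [Fintype ι] [DecidableEq ι]

/-- The submodule of the vectors whose entries outside `ε` lie in `I`. -/
def coordQ (I : Ideal S) (ε : ι → Prop) : Submodule S (ι → S) where
  carrier := {x | ∀ i, ¬ ε i → x i ∈ I}
  zero_mem' := fun _ _ => I.zero_mem
  add_mem' := fun hx hy i hi => I.add_mem (hx i hi) (hy i hi)
  smul_mem' := fun c _ hx i hi => I.mul_mem_left c (hx i hi)

variable (F) (ε : ι → Prop)

open Classical in
/-- The map `F₁` in coordinates. -/
noncomputable def coordF₁ : coordQ F.I ε →ₛₗ[F.σ] (ι → S) where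
  toFun x i := if hi : ε i then F.σ (x.1 i) else F.σ₁ ⟨x.1 i, x.2 i hi⟩
  map_add' x y := by
    ext i
    rw [Pi.add_apply]
    split_ifs with hi
    · exact map_add _ _ _
    · exact map_add F.σ₁ ⟨x.1 i, x.2 i hi⟩ ⟨y.1 i, y.2 i hi⟩
  map_smul' c x := by
    ext i
    rw [Pi.smul_apply]
    split_ifs with hi
    · exact map_mul _ _ _
    · exact F.σ₁.map_smulₛₗ c ⟨x.1 i, x.2 i hi⟩

open Classical in
/-- The map `Fr` in coordinates. -/
noncomputable def coordFr : (ι → S) →ₛₗ[F.σ] (ι → S) where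
  toFun x i := (if ε i then F.theta else 1) * F.σ (x i)
  map_add' x y := by
    ext i
    simp only [Pi.add_apply, map_add, mul_add]
  map_smul' c x := by
    ext i
    simp only [Pi.smul_apply, smul_eq_mul, map_mul]
    ring

theorem coordF₁_smul (a : F.I) (x : ι → S) (h : (a : S) • x ∈ coordQ F.I ε) :
    coordF₁ F ε ⟨(a : S) • x, h⟩ = F.σ₁ a • coordFr F ε x := by
  classical
  ext i
  change (if hi : ε i then F.σ ((a : S) * x i) else F.σ₁ ⟨(a : S) * x i, h i hi⟩) =
    F.σ₁ a * ((if ε i then F.theta else 1) * F.σ (x i))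
  split_ifs with hi
  · rw [map_mul, F.sigma_eq_theta]
    ring
  · have h1 := F.σ₁.map_smulₛₗ (x i) a
    rw [smul_eq_mul, mul_comm] at h1
    rw [one_mul, ← h1]
    congr 1
    exact Subtype.ext (mul_comm _ _)

theorem single_mem_coordQ {i : ι} (hi : ε i) : (Pi.single i 1 : ι → S) ∈ coordQ F.I ε :=
  fun j hj => by
    rw [Pi.single_eq_of_ne (fun h => hj (by rwa [h]))]
    exact F.I.zero_mem

theorem coordF₁_single {i : ι} (hi : ε i) :
    coordF₁ F ε ⟨Pi.single i 1, single_mem_coordQ F ε hi⟩ = Pi.single i 1 := by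
  classical
  ext j
  by_cases hij : j = i
  · subst hij
    refine (dif_pos hi).trans ?_
    change F.σ ((Pi.single j 1 : ι → S) j) = _
    rw [Pi.single_eq_same, map_one]
  · have h0 : (Pi.single i 1 : ι → S) j = 0 := Pi.single_eq_of_ne hij _
    rw [h0]
    by_cases hj : ε j
    · exact (dif_pos hj).trans ((congrArg F.σ h0).trans (map_zero _))
    · exact (dif_neg hj).trans ((congrArg F.σ₁ (Subtype.ext h0 : _ = (0 : F.I))).trans (map_zero _))

theorem coordFr_single {i : ι} (hi : ¬ ε i) : coordFr F ε (Pi.single i 1) = Pi.single i 1 := by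
  classical
  ext j
  change (if ε j then F.theta else 1) * F.σ ((Pi.single i 1 : ι → S) j) = _
  by_cases hij : j = i
  · subst hij
    rw [if_neg hi, Pi.single_eq_same, map_one, mul_one]
  · rw [Pi.single_eq_of_ne hij, map_zero, mul_zero]

/-- The window on `S^ι` in which `L` and `T` are spanned by basis vectors and `F₁`, `Fr` send the
basis of `L`, respectively of `T`, to the columns of an invertible matrix. -/
noncomputable def ofMatrix (A : Matrix ι ι S) (hA : IsUnit A) : Window F where
  P := ι → S
  Q := coordQ F.I ε
  Fr := A.mulVecLin.comp (coordFr F ε)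
  F₁ := A.mulVecLin.comp (coordF₁ F ε)
  normal := by
    classical
    refine ⟨coordQ ⊥ ε, coordQ ⊥ fun i => ¬ ε i, IsCompl.of_eq ?_ ?_, le_antisymm ?_ (sup_le ?_ ?_)⟩
    · rw [eq_bot_iff]
      rintro x ⟨h1, h2⟩
      refine (Submodule.mem_bot S).2 (funext fun i => ?_)
      by_cases hi : ε i
      · exact h2 i (not_not.2 hi)
      · exact h1 i hi
    · rw [eq_top_iff]
      intro x _
      rw [pi_eq_sum_univ' x]
      refine Submodule.sum_mem _ fun i _ => Submodule.smul_mem _ _ ?_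
      by_cases hi : ε i
      · refine Submodule.mem_sup_left fun j hj => ?_
        exact Pi.single_eq_of_ne (fun h => hj (by rwa [h])) _
      · refine Submodule.mem_sup_right fun j hj => ?_
        exact Pi.single_eq_of_ne (fun h => hj (by rwa [h])) _
    · intro x hx
      rw [pi_eq_sum_univ' x]
      refine Submodule.sum_mem _ fun i _ => ?_
      by_cases hi : ε i
      · refine Submodule.mem_sup_left (Submodule.smul_mem _ _ fun j hj => ?_)
        exact Pi.single_eq_of_ne (fun h => hj (by rwa [h])) _
      · refine Submodule.mem_sup_right (Submodule.smul_mem_smul (hx i hi) fun j hj => ?_)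
        exact Pi.single_eq_of_ne (fun h => hj (by rwa [h])) _
    · intro x hx i hi
      rw [(Submodule.mem_bot S).1 (hx i hi)]
      exact F.I.zero_mem
    · exact Submodule.smul_le.2 fun a ha x _ i _ => F.I.mul_mem_right _ ha
  F₁_smul := fun a x h => by
    rw [LinearMap.comp_apply, coordF₁_smul, map_smul]
    rfl
  span_F₁ := by
    classical
    set N := Submodule.span S (Set.range (A.mulVecLin.comp (coordF₁ F ε))) with hN
    have h1 : ∀ i, A.mulVecLin (Pi.single i 1) ∈ N := by
      intro i
      by_cases hi : ε i
      · refine Submodule.subset_span ⟨⟨_, single_mem_coordQ F ε hi⟩, ?_⟩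
        rw [LinearMap.comp_apply, coordF₁_single F ε hi]
      -- For a basis vector of `T` only its multiples by `a ∈ I` lie in `Q`; they yield `σ₁(a)`
      -- times the column, and `σ₁(I)` generates `S`.
      · have h2 : ∀ y ∈ Submodule.span S (Set.range F.σ₁), y • A.mulVecLin (Pi.single i 1) ∈ N := by
          intro y hy
          induction hy using Submodule.span_induction with
          | mem y hy =>
            obtain ⟨a, rfl⟩ := hy
            have hm : (a : S) • (Pi.single i 1 : ι → S) ∈ coordQ F.I ε := fun j _ =>
              F.I.mul_mem_right _ a.2
            refine Submodule.subset_span ⟨⟨_, hm⟩, ?_⟩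
            rw [LinearMap.comp_apply, coordF₁_smul, map_smul, coordFr_single F ε hi]
          | zero => rw [zero_smul]; exact N.zero_mem
          | add y z _ _ hy hz => rw [add_smul]; exact N.add_mem hy hz
          | smul c y _ hy => rw [smul_eq_mul, mul_smul]; exact N.smul_mem _ hy
        have h3 := h2 1 (by rw [F.span_σ₁]; trivial)
        rwa [one_smul] at h3
    obtain ⟨A', hA'⟩ := hA.exists_right_inv
    rw [eq_top_iff]
    intro x _
    have h2 : x = A.mulVecLin (A' *ᵥ x) := by
      rw [Matrix.mulVecLin_apply, Matrix.mulVec_mulVec, hA', Matrix.one_mulVec]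
    rw [h2, pi_eq_sum_univ' (A' *ᵥ x), map_sum]
    refine N.sum_mem fun i _ => ?_
    rw [map_smul]
    exact N.smul_mem _ (h1 i)

/-- The standard basis of `ofMatrix`. -/
noncomputable def ofMatrixBasis (A : Matrix ι ι S) (hA : IsUnit A) :
    (ofMatrix F ε A hA).AdaptedBasis ι where
  b := Pi.basisFun S ι
  ε := ε
  mem_Q := fun _ => Iff.rfl

theorem ofMatrixBasis_mat (A : Matrix ι ι S) (hA : IsUnit A) :
    (ofMatrixBasis F ε A hA).mat = A := by
  classical
  have h1 : ∀ j, (ofMatrixBasis F ε A hA).val (ofMatrix F ε A hA).F₁ (ofMatrix F ε A hA).Fr j =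
      A *ᵥ Pi.single j 1 := by
    intro j
    have hb : (ofMatrixBasis F ε A hA).b j = Pi.single j (1 : S) := Pi.basisFun_apply S ι j
    by_cases hj : ε j
    · refine (dif_pos hj).trans (Eq.trans ?_ (congrArg (fun x => A *ᵥ x) (coordF₁_single F ε hj)))
      exact congrArg (fun x => A *ᵥ coordF₁ F ε x) (Subtype.ext hb)
    · refine (dif_neg hj).trans (Eq.trans ?_ (congrArg (fun x => A *ᵥ x) (coordFr_single F ε hj)))
      exact congrArg (fun x => A *ᵥ coordFr F ε x) hb
  ext i j
  change (ofMatrixBasis F ε A hA).val (ofMatrix F ε A hA).F₁ (ofMatrix F ε A hA).Fr j i = _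
  rw [h1, Matrix.mulVec_single_one]
  rfl

end ofMatrix

/-- A homomorphism of windows with a linear inverse that preserves `Q` is an isomorphism. -/
theorem nonempty_iso_of_hom {P P' : Window F} (f : P ⟶ P') (g : P'.P →ₗ[S] P.P)
    (hfg : ∀ x, Hom.toLin f (g x) = x) (hgf : ∀ x, g (Hom.toLin f x) = x)
    (hg : ∀ x ∈ P'.Q, g x ∈ P.Q) : Nonempty (P ≅ P') := by
  have hg₁ : ∀ q : P'.Q, g (P'.F₁ q) = P.F₁ ⟨g q, hg q q.2⟩ := by
    intro q
    rw [← hgf (P.F₁ ⟨g q, hg q q.2⟩), Hom.map_F₁ f]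
    congr 2
    exact Subtype.ext (hfg _).symm
  let g' : P' ⟶ P := Hom.mk g hg (map_Fr_of_map_F₁ g hg hg₁) hg₁
  exact ⟨⟨f, g', Hom.ext (LinearMap.ext hgf), Hom.ext (LinearMap.ext hfg)⟩⟩

namespace AdaptedBasis

variable {P P' : Window F} {ι : Type u} [Fintype ι] [DecidableEq ι] (b : P.AdaptedBasis ι)
  (b' : P'.AdaptedBasis ι)

open Classical in
/-- The value of `F₁` and `Fr` on the columns of a matrix congruent to `1` modulo `I`, in
coordinates. -/
noncomputable def coordMatrix (F : Frame p S) (ε : ι → Prop) (X : Matrix ι ι S) : Matrix ι ι S :=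
  Matrix.of fun k i => if ε i then
    (if ε k then F.σ (X k i) else if h : X k i ∈ F.I then F.σ₁ ⟨X k i, h⟩ else 0)
    else (if ε k then F.theta else 1) * F.σ (X k i)

theorem repr_toLin (X : Matrix ι ι S) (x : P.P) (i : ι) :
    b'.b.repr (Matrix.toLin b.b b'.b X x) i = (X *ᵥ b.b.repr x) i := by
  conv_rhs => rw [← LinearMap.toMatrix_toLin b.b b'.b X, LinearMap.toMatrix_mulVec_repr]

variable {b b'} in
theorem toLin_mem_Q (hε : b'.ε = b.ε) {X : Matrix ι ι S} (hX : EntriesIn F.I (X - 1)) {x : P.P}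
    (hx : x ∈ P.Q) : Matrix.toLin b.b b'.b X x ∈ P'.Q := by
  refine (b'.mem_Q _).2 fun i hi => ?_
  rw [repr_toLin, ← sub_add_cancel X 1, Matrix.add_mulVec, Matrix.one_mulVec, Pi.add_apply]
  refine F.I.add_mem ?_ ((b.mem_Q x).1 hx i (by rwa [← hε]))
  exact F.I.sum_mem fun k _ => F.I.mul_mem_right _ (hX i k)

theorem sum_mat_smul (v : ι → S) :
    ∑ k, v k • b.val P.F₁ P.Fr k = ∑ l, (b.mat *ᵥ v) l • b.b l := by
  have h : ∀ k, b.val P.F₁ P.Fr k = ∑ l, b.mat l k • b.b l := fun k => (b.b.sum_repr _).symm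
  simp only [h, Finset.smul_sum, smul_smul]
  rw [Finset.sum_comm]
  refine Finset.sum_congr rfl fun l _ => ?_
  rw [← Finset.sum_smul]
  congr 1
  exact Finset.sum_congr rfl fun k _ => mul_comm _ _

/-- Two windows with adapted bases are isomorphic if their matrices are conjugate. -/
theorem nonempty_iso [IsLocalRing S] (hε : b'.ε = b.ε) {X : Matrix ι ι S}
    (hX : EntriesIn F.I (X - 1)) (h : X * b.mat = b'.mat * coordMatrix F b.ε X) :
    Nonempty (P ≅ P') := by
  classical
  have hI : F.I ≤ maximalIdeal S := by
    rw [← IsLocalRing.jacobson_eq_maximalIdeal _ bot_ne_top]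
    exact le_sup_left.trans F.le_rad
  obtain ⟨⟨X, Y, hXY, hYX⟩, rfl⟩ := isUnit_of_entriesIn_sub isUnit_one (hX.mono hI)
  change EntriesIn F.I (X - 1) at hX
  change X * b.mat = b'.mat * coordMatrix F b.ε X at h
  have hY : EntriesIn F.I (Y - 1) := by
    rw [← hYX, ← Matrix.mul_one Y, Matrix.mul_assoc, ← Matrix.mul_sub, Matrix.one_mul, ← neg_sub]
    exact (hX.neg).mul_left _
  let f := Matrix.toLin b.b b'.b X
  have hQ : ∀ x ∈ P.Q, f x ∈ P'.Q := fun x hx => toLin_mem_Q hε hX hx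
  have hfb : ∀ i k, b'.b.repr (f (b.b i)) k = X k i := fun i k => by
    rw [repr_toLin, b.b.repr_self, Finsupp.single_eq_pi_single, Matrix.mulVec_single_one]
    rfl
  have hcol : ∀ i, f (b.val P.F₁ P.Fr i) =
      ∑ k, coordMatrix F b.ε X k i • b'.val P'.F₁ P'.Fr k := by
    intro i
    rw [b'.sum_mat_smul]
    apply b'.b.repr.injective
    ext l
    rw [repr_toLin, b'.b.repr_sum_self]
    have h1 := congrFun (congrFun h l) i
    rw [Matrix.mul_apply, Matrix.mul_apply] at h1
    exact h1
  -- The matrix identity is compatibility with `F₁` on the basis of `L` and with `Fr` on that of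
  -- `T`; `apply_eq_sum` extends it to all of `Q`.
  have hval : ∀ i, f (b.val P.F₁ P.Fr i) = b.val (P'.F₁.comp (f.restrict hQ)) (P'.Fr.comp f) i := by
    intro i
    rw [hcol]
    by_cases hi : b.ε i
    · rw [val, dif_pos hi, LinearMap.comp_apply, b'.apply_eq_sum P'.F₁ P'.Fr
        (fun a x => P'.F₁_smul a x _)]
      refine Finset.sum_congr rfl fun k _ => ?_
      congr 1
      have h2 : b'.b.repr ((f.restrict hQ ⟨b.b i, b.b_mem i hi⟩ : P'.Q) : P'.P) k = X k i := hfb i k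
      rw [coordMatrix, Matrix.of_apply, if_pos hi, coef]
      simp only [hε]
      by_cases hk : b.ε k
      · rw [if_pos hk, dif_pos hk, h2]
      · have h3 : X k i ∈ F.I := by
          rw [← h2]
          exact (b'.mem_Q _).1 (Subtype.prop _) k (by rwa [hε])
        rw [if_neg hk, dif_neg hk, dif_pos h3]
        congr 1
        exact Subtype.ext h2.symm
    · rw [val, dif_neg hi, LinearMap.comp_apply, ← b'.b.sum_repr (f (b.b i)), map_sum]
      refine Finset.sum_congr rfl fun k _ => ?_
      rw [LinearMap.map_smulₛₗ, hfb, coordMatrix, Matrix.of_apply, if_neg hi, mul_comm, mul_smul]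
      congr 1
      by_cases hk : b.ε k
      · have hk' : b'.ε k := by rwa [hε]
        rw [if_pos hk, val, dif_pos hk', ← P'.Fr_eq_theta]
      · have hk' : ¬ b'.ε k := by rwa [hε]
        rw [if_neg hk, val, dif_neg hk', one_smul]
  have hF₁ : ∀ q : P.Q, f (P.F₁ q) = P'.F₁ ⟨f q, hQ q q.2⟩ := by
    intro q
    have h1 := b.apply_eq_sum (P'.F₁.comp (f.restrict hQ)) (P'.Fr.comp f) (fun a x => by
      rw [LinearMap.comp_apply, LinearMap.comp_apply,
        ← P'.F₁_smul a (f x) (P'.smul_mem_Q a _)]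
      congr 1
      exact Subtype.ext (map_smul f _ _)) q
    rw [b.apply_eq_sum P.F₁ P.Fr (fun a x => P.F₁_smul a x _), map_sum]
    refine Eq.trans ?_ h1.symm
    exact Finset.sum_congr rfl fun i _ => by rw [map_smul, hval]
  refine nonempty_iso_of_hom (Hom.mk f hQ (map_Fr_of_map_F₁ f hQ hF₁) hF₁)
    (Matrix.toLin b'.b b.b Y) (fun x => ?_) (fun x => ?_) fun x hx => toLin_mem_Q hε.symm hY hx
  · change f (Matrix.toLin b'.b b.b Y x) = x
    rw [← Matrix.toLin_mul_apply, hXY, Matrix.toLin_one]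
    rfl
  · change Matrix.toLin b'.b b.b Y (f x) = x
    rw [← Matrix.toLin_mul_apply, hYX, Matrix.toLin_one]
    rfl

end AdaptedBasis

end Window

/-! ### Descent of nilpotent windows along a homomorphism of frames -/

open Classical in
/-- The map `u⁻¹ σ₁'` on `I'`, extended by zero. -/
noncomputable def FrameHom.normalized {p : ℕ} {S S' : Type u} [CommRing S] [CommRing S']
    {F : Frame p S} {F' : Frame p S'} (α : FrameHom F F') (x : S') : S' :=
  if h : x ∈ F'.I then ((α.u⁻¹ : S'ˣ) : S') * F'.σ₁ ⟨x, h⟩ else 0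

theorem FrameHom.map_theta {p : ℕ} {S S' : Type u} [CommRing S] [CommRing S']
    {F : Frame p S} {F' : Frame p S'} (α : FrameHom F F') :
    α.toRingHom F.theta = α.u * F'.theta :=
  letI := α.toRingHom.toAlgebra
  BaseChange.map_theta α.map_I α.map_σ α.u α.map_σ₁

namespace Window

open CategoryTheory
open scoped Matrix

variable {p : ℕ} {S S' : Type u} [CommRing S] [CommRing S'] {F : Frame p S} {F' : Frame p S'}
  {α : FrameHom F F'} {ι : Type u} [Fintype ι] [DecidableEq ι]

namespace BaseChangeMap

variable {P : Window F} {P' : Window F'}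

theorem exists_adaptedBasis (B : BaseChangeMap α P P') (b : P.AdaptedBasis ι) :
    ∃ b' : P'.AdaptedBasis ι, b'.ε = b.ε ∧ ∀ i, b'.b i = B.j (b.b i) := by
  obtain ⟨b', hb'⟩ := B.exists_basis b.b
  refine ⟨⟨b', b.ε, fun x => ⟨fun hx i hi => ?_, fun hx => ?_⟩⟩, rfl, hb'⟩
  · have h : P'.Q ≤ Submodule.comap (b'.coord i) F'.I := by
      rw [B.Q_eq]
      refine sup_le (Submodule.span_le.2 ?_) (Submodule.smul_le.2 fun a ha t _ => ?_)
      · rintro _ ⟨q, rfl⟩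
        change b'.repr (B.j q) i ∈ F'.I
        rw [B.repr_apply hb']
        exact α.map_I _ ((b.mem_Q q).1 q.2 i hi)
      · rw [Submodule.mem_comap, map_smul]
        exact Ideal.mul_mem_right _ _ ha
    exact h hx
  · rw [← b'.sum_repr x]
    refine Submodule.sum_mem _ fun i _ => ?_
    by_cases hi : b.ε i
    · rw [hb']
      exact Submodule.smul_mem _ _ (B.map_Q _ (b.b_mem i hi))
    · exact P'.smul_mem_Q ⟨_, hx i hi⟩ _

/-- Only the columns of `L` acquire the unit `u`: base change multiplies `F₁` by `u`, while `Fr` is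
compatible as it stands. -/
theorem mat_eq (B : BaseChangeMap α P P') (b : P.AdaptedBasis ι) (b' : P'.AdaptedBasis ι)
    (hε : b'.ε = b.ε) (hb : ∀ i, b'.b i = B.j (b.b i)) :
    b'.mat = α.toRingHom.mapMatrix b.mat * AdaptedBasis.diag b.ε (α.u : S') := by
  classical
  ext l k
  rw [AdaptedBasis.diag, Matrix.mul_diagonal]
  change b'.b.repr (b'.val P'.F₁ P'.Fr k) l = α.toRingHom (b.b.repr (b.val P.F₁ P.Fr k) l) * _
  rw [← B.repr_apply hb]
  by_cases hk : b.ε k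
  · have hk' : b'.ε k := by rwa [hε]
    have h1 : (⟨b'.b k, b'.b_mem k hk'⟩ : P'.Q) = ⟨B.j (b.b k), B.map_Q _ (b.b_mem k hk)⟩ :=
      Subtype.ext (hb k)
    rw [if_pos hk, AdaptedBasis.val, dif_pos hk', AdaptedBasis.val, dif_pos hk, h1,
      B.map_F₁ ⟨_, b.b_mem k hk⟩, map_smul, Finsupp.smul_apply, smul_eq_mul, mul_comm]
  · have hk' : ¬ b'.ε k := by rwa [hε]
    rw [if_neg hk, AdaptedBasis.val, dif_neg hk', AdaptedBasis.val, dif_neg hk, hb, B.map_Fr,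
      mul_one]

end BaseChangeMap

namespace AdaptedBasis

theorem mapMatrix_diag (κ : S →+* S') (ε : ι → Prop) (c : S) :
    κ.mapMatrix (diag ε c) = diag ε (κ c) := by
  classical
  rw [diag, diag, RingHom.mapMatrix_apply, Matrix.diagonal_map (map_zero κ)]
  congr 1
  ext i
  split_ifs <;> simp

theorem mapMatrix_coDiag (κ : S →+* S') (ε : ι → Prop) (c : S) :
    κ.mapMatrix (coDiag ε c) = coDiag ε (κ c) := by
  classical
  rw [coDiag, coDiag, RingHom.mapMatrix_apply, Matrix.diagonal_map (map_zero κ)]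
  congr 1
  ext i
  split_ifs <;> simp

theorem diag_mul_diag (ε : ι → Prop) (c d : S) : diag ε c * diag ε d = diag ε (c * d) := by
  rw [diag, diag, diag, Matrix.diagonal_mul_diagonal]
  congr 1
  ext i
  split_ifs <;> simp

theorem diag_one (ε : ι → Prop) : diag ε (1 : S) = 1 := by
  rw [diag]
  simp

variable (α) in
-- The operator `Φ`, built from the normalised `u⁻¹σ₁'`, is the action of `F₁` and `Fr` on `X` up to
-- conjugation by the diagonal matrix of `u`. The four blocks for `L` and `T` are compared using `σ'
-- y = α(θ) u⁻¹σ₁'(y)` on `I'` and `α(θ) = u θ'`.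
theorem phi_mul_diag (ε : ι → Prop) {X : Matrix ι ι S'} (hX : EntriesIn F'.I (X - 1)) :
    DescentData.phi α.toRingHom α.normalized (diag ε F.theta) (coDiag ε F.theta) X *
      diag ε (α.u : S') = diag ε (α.u : S') * coordMatrix F' ε X := by
  classical
  have hXI : ∀ k i, k ≠ i → X k i ∈ F'.I := fun k i hki => by
    have := hX k i
    rwa [Matrix.sub_apply, Matrix.one_apply_ne hki, sub_zero] at this
  have hf : ∀ y ∈ F'.I, F'.σ y = α.toRingHom F.theta * α.normalized y := fun y hy => by
    rw [FrameHom.normalized, dif_pos hy, α.map_theta, F'.sigma_eq_theta ⟨y, hy⟩]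
    linear_combination (- F'.theta * F'.σ₁ ⟨y, hy⟩) * α.u.mul_inv
  have hdiag : ∀ i, F'.σ (X i i) = 1 + α.toRingHom F.theta * α.normalized ((X - 1) i i) := fun i => by
    rw [← hf _ (hX i i), Matrix.sub_apply, Matrix.one_apply_eq, map_sub, map_one, add_sub_cancel]
  ext k i
  rw [DescentData.phi, mapMatrix_diag, mapMatrix_coDiag, diag, coDiag, diag, Matrix.mul_diagonal,
    Matrix.diagonal_mul, Matrix.add_apply, Matrix.mul_diagonal, Matrix.diagonal_mul,
    Matrix.map_apply, coordMatrix, Matrix.of_apply]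
  by_cases hki : k = i
  · subst hki
    rw [Matrix.one_apply_eq, hdiag]
    split_ifs <;> ring
  · have h1 : (X - 1) k i = X k i := by rw [Matrix.sub_apply, Matrix.one_apply_ne hki, sub_zero]
    have h2 := hXI k i hki
    have h3 : α.u * α.normalized (X k i) = F'.σ₁ ⟨X k i, h2⟩ := by
      rw [FrameHom.normalized, dif_pos h2, ← mul_assoc, Units.mul_inv, one_mul]
    rw [Matrix.one_apply_ne hki, h1]
    by_cases hi : ε i <;> by_cases hk : ε k
    · simp only [if_pos hi, if_pos hk]
      rw [hf _ h2]
      ring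
    · simp only [if_pos hi, if_neg hk, dif_pos h2]
      rw [← h3]
      ring
    · simp only [if_neg hi, if_pos hk]
      rw [hf _ h2, α.map_theta]
      ring
    · simp only [if_neg hi, if_neg hk]
      rw [hf _ h2]
      ring

end AdaptedBasis

open AdaptedBasis in
/-- Descent of nilpotent windows along a homomorphism of frames. -/
theorem exists_baseChange_iso [IsLocalRing S] [IsLocalRing S'] [IsAdicComplete (maximalIdeal S) S]
    {N : ℕ → Ideal S'}
    (H : DescentData F.σ F.theta α.toRingHom F'.σ F'.I α.normalized N)
    (hκ : ∀ a ∈ maximalIdeal S, α.toRingHom a ∈ maximalIdeal S')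
    (hf : ∀ a ∈ maximalIdeal S', F'.σ a ∈ maximalIdeal S') (P' : Window F')
    (hP' : IsNilpotent (maximalIdeal S') P') :
    ∃ M : Window F, IsNilpotent (maximalIdeal S) M ∧ Nonempty (α.baseChange.obj M ≅ P') := by
  classical
  have hI : F'.I ≤ maximalIdeal S' := by
    rw [← IsLocalRing.jacobson_eq_maximalIdeal _ bot_ne_top]
    exact le_sup_left.trans F'.le_rad
  have hκ' : ∀ a, α.toRingHom a ∈ maximalIdeal S' → a ∈ maximalIdeal S := fun a ha => by
    rw [mem_maximalIdeal, mem_nonunits_iff] at ha ⊢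
    exact fun h => ha (h.map _)
  obtain ⟨ι, _, ⟨b⟩⟩ := P'.exists_adaptedBasis
  obtain ⟨M', hM'⟩ := b.isUnit_mat.exists_right_inv
  have hM'' : M' * b.mat = 1 := mul_eq_one_comm.1 hM'
  set u : S' := Units.val α.u
  set w : S' := Units.val α.u⁻¹
  have huw : u * w = 1 := α.u.mul_inv
  have hwu : w * u = 1 := α.u.inv_mul
  -- Removing `u` from the columns of `L` gives the matrix that would be `α(A)` if the given basis
  -- came from a window over `S`.
  let Ψ := b.mat * diag b.ε w
  let Ψ' := diag b.ε u * M'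
  have hΨ : Ψ' * Ψ = 1 := by
    change diag b.ε u * M' * (b.mat * diag b.ε w) = 1
    rw [Matrix.mul_assoc, ← Matrix.mul_assoc M', hM'', Matrix.one_mul, diag_mul_diag, huw, diag_one]
  have hΨ' : Ψ * Ψ' = 1 := mul_eq_one_comm.1 hΨ
  obtain ⟨A₀, hA₀⟩ := H.exists_lift_matrix Ψ
  have hA₀' : EntriesIn F'.I (α.toRingHom.mapMatrix A₀ - Ψ) := by
    rw [← neg_sub]
    exact hA₀.neg
  -- Modulo `I'` the matrix `α(A₀)` is the invertible `Ψ`, and `α` sends nonunits to nonunits.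
  have hA₀u : IsUnit A₀ := by
    have h1 : IsUnit (α.toRingHom.mapMatrix A₀) :=
      isUnit_of_entriesIn_sub (IsUnit.of_mul_eq_one _ hΨ') (hA₀'.mono hI)
    rw [Matrix.isUnit_iff_isUnit_det, ← RingHom.map_det] at h1
    rw [Matrix.isUnit_iff_isUnit_det]
    by_contra h2
    exact (mem_nonunits_iff.1 ((mem_maximalIdeal _).1 (hκ _ ((mem_maximalIdeal _).2 h2)))) h1
  obtain ⟨B₀, hAB₀⟩ := hA₀u.exists_right_inv
  have hBA₀ : B₀ * A₀ = 1 := mul_eq_one_comm.1 hAB₀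
  obtain ⟨n₀, hn₀⟩ := (b.isNilpotent_iff hM').1 hP'
  -- Nilpotence is checked after applying `α`. Since `α(θ) = u θ'` and `B₀` lifts `Ψ⁻¹` modulo `I'`,
  -- the matrix becomes congruent to `u` times that of `V♯` on `P'`; scalars do not affect vanishing
  -- of the products.
  have hnil : ∀ n ≥ n₀, EntriesIn (maximalIdeal S) (iterMatrix F.σ (coDiag b.ε F.theta * B₀) n) := by
    intro n hn
    have h1 : u • (coDiag b.ε F'.theta * M') = coDiag b.ε (α.toRingHom F.theta) * Ψ' := by
      rw [← Matrix.mul_assoc, ← Matrix.smul_mul]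
      congr 1
      rw [coDiag, coDiag, diag, Matrix.diagonal_mul_diagonal, ← Matrix.diagonal_smul]
      congr 1
      ext i
      rw [Pi.smul_apply, α.map_theta, smul_eq_mul]
      split_ifs <;> ring
    have h2 : EntriesIn (maximalIdeal S')
        (iterMatrix F'.σ (coDiag b.ε (α.toRingHom F.theta) * Ψ') n) := by
      rw [← h1]
      obtain ⟨d, hd⟩ := exists_iterMatrix_smul F'.σ u (coDiag b.ε F'.theta * M') n
      rw [hd]
      exact (hn₀ n hn).smul d
    have h3 : EntriesIn (maximalIdeal S') (α.toRingHom.mapMatrix (coDiag b.ε F.theta * B₀) -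
        coDiag b.ε (α.toRingHom F.theta) * Ψ') := by
      have h4 : α.toRingHom.mapMatrix B₀ * α.toRingHom.mapMatrix A₀ = 1 := by
        rw [← map_mul, hBA₀, map_one]
      have h5 : α.toRingHom.mapMatrix B₀ - Ψ' =
          α.toRingHom.mapMatrix B₀ * (Ψ - α.toRingHom.mapMatrix A₀) * Ψ' := by
        rw [Matrix.mul_sub, Matrix.sub_mul, Matrix.mul_assoc, hΨ', h4, Matrix.mul_one,
          Matrix.one_mul]
      rw [map_mul, mapMatrix_coDiag, ← Matrix.mul_sub, h5]
      exact (((hA₀.mono hI).mul_left _).mul_right _).mul_left _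
    have h6 := (iterMatrix_sub_mem hf h3 n).add h2
    rw [sub_add_cancel, ← map_iterMatrix α.map_σ] at h6
    exact fun i j => hκ' _ (h6 i j)
  obtain ⟨A, B, X, hAB, hB, hX, hsol⟩ := H.exists_solution (coDiag_mul_diag b.ε F.theta) hΨ hAB₀ hA₀'
    (iterMatrix F.σ (coDiag b.ε F.theta * B₀)) rfl (fun _ => rfl) (hnil n₀ le_rfl)
  have hA : IsUnit A := IsUnit.of_mul_eq_one _ hAB
  refine ⟨ofMatrix F b.ε A hA, ?_, ?_⟩
  · refine ((ofMatrixBasis F b.ε A hA).isNilpotent_iff (M' := B) ?_).2 ⟨n₀, fun n hn => ?_⟩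
    · rw [ofMatrixBasis_mat, hAB]
    -- The descended window is nilpotent since `D' B` and `D' B₀` agree modulo `𝔪`.
    · have h1 := (iterMatrix_sub_mem H.σ_mem hB n).add (hnil n hn)
      rw [sub_add_cancel] at h1
      exact h1
  · obtain ⟨b', hε, hb'⟩ := (baseChangeMap α (ofMatrix F b.ε A hA)).exists_adaptedBasis
      (ofMatrixBasis F b.ε A hA)
    have hmat := (baseChangeMap α (ofMatrix F b.ε A hA)).mat_eq _ b' hε hb'
    rw [ofMatrixBasis_mat] at hmat
    change b'.mat = α.toRingHom.mapMatrix A * diag b.ε u at hmat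
    obtain ⟨e⟩ := b.nonempty_iso b' hε hX (by
      have h1 : X * Ψ = α.toRingHom.mapMatrix A *
          DescentData.phi α.toRingHom α.normalized (diag b.ε F.theta) (coDiag b.ε F.theta) X := by
        rw [← hsol, Matrix.mul_assoc (α.toRingHom.mapMatrix B), ← Matrix.mul_assoc _ _ (X * Ψ),
          ← map_mul, hAB, map_one, Matrix.one_mul]
      have h2 : b.mat = Ψ * diag b.ε u := by
        change b.mat = b.mat * diag b.ε w * diag b.ε u
        rw [Matrix.mul_assoc, diag_mul_diag, hwu, diag_one, Matrix.mul_one]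
      rw [h2, ← Matrix.mul_assoc, h1, Matrix.mul_assoc, phi_mul_diag α b.ε hX, hmat,
        Matrix.mul_assoc])
    exact ⟨e.symm⟩

end Window

/-! ### A criterion for being nil-crystalline -/

/-- One has `θ σ₁(a) = σ(a) ∈ J` for `a ∈ I`, and the elements `σ₁(a)` generate the unit ideal. -/
theorem Frame.theta_mem {p : ℕ} {S : Type u} [CommRing S] (F : Frame p S) {J : Ideal S}
    (hI : F.I ≤ J) (hσ : ∀ a ∈ J, F.σ a ∈ J) : F.theta ∈ J := by
  have key : ∀ y ∈ Submodule.span S (Set.range F.σ₁), y * F.theta ∈ J := by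
    intro y hy
    induction hy using Submodule.span_induction with
    | mem y hy =>
      obtain ⟨a, rfl⟩ := hy
      rw [mul_comm, ← F.sigma_eq_theta]
      exact hσ _ (hI a.2)
    | zero => rw [zero_mul]; exact J.zero_mem
    | add y z _ _ hy hz => rw [add_mul]; exact J.add_mem hy hz
    | smul c y _ hy => rw [smul_eq_mul, mul_assoc]; exact J.mul_mem_left c hy
  simpa using key 1 (by rw [F.span_σ₁]; trivial)

/-- The maximal ideal of a local ring is an ideal of definition of every frame on it. -/
theorem Frame.isIdealOfDefinition_maximalIdeal {p : ℕ} [hp : Fact p.Prime] {S : Type u} [CommRing S]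
    [IsLocalRing S] (F : Frame p S) : F.IsIdealOfDefinition (maximalIdeal S) := by
  have h := F.le_rad
  rw [IsLocalRing.jacobson_eq_maximalIdeal _ bot_ne_top] at h
  have hσ : ∀ a ∈ maximalIdeal S, F.σ a ∈ maximalIdeal S := fun a ha => by
    rw [← sub_add_cancel (F.σ a) (a ^ p)]
    exact Ideal.add_mem _ (le_sup_right.trans h (F.frob a)) (Ideal.pow_mem_of_mem _ ha p hp.out.pos)
  exact ⟨hσ, le_sup_left.trans h, F.theta_mem (le_sup_left.trans h) hσ⟩

open CategoryTheory Window in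
/-- A criterion for a homomorphism of frames on local rings to be nil-crystalline. -/
theorem FrameHom.isNilCrystalline_maximalIdeal {p : ℕ} [Fact p.Prime] {S S' : Type u} [CommRing S]
    [CommRing S'] {F : Frame p S} {F' : Frame p S'} (α : FrameHom F F') [IsLocalRing S]
    [IsLocalRing S'] [IsNoetherianRing S] [IsAdicComplete (maximalIdeal S) S]
    {N : ℕ → Ideal S'} (H : DescentData F.σ F.theta α.toRingHom F'.σ F'.I α.normalized N)
    (hα : ∀ a ∈ maximalIdeal S, α.toRingHom a ∈ maximalIdeal S')
    (hI : ∀ a, α.toRingHom a ∈ F'.I → a ∈ F.I)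
    (hcl : ∀ w, (∀ n, ∃ a, w - α.toRingHom a ∈ (maximalIdeal S ^ n).map α.toRingHom) →
      w ∈ α.toRingHom.range) :
    α.IsNilCrystalline (maximalIdeal S) (maximalIdeal S') := by
  have hJ := F.isIdealOfDefinition_maximalIdeal
  have hJ' := F'.isIdealOfDefinition_maximalIdeal
  refine ⟨hJ, hJ', hα, fun P hP => (baseChangeMap α P).isNilpotent hα hP, ?_⟩
  refine
    { faithful := ⟨fun {P₁ P₂ f g} hfg => ?_⟩
      full := ⟨fun {P₁ P₂} ψ => ?_⟩
      essSurj := ⟨fun P' => ?_⟩ }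
  · apply ObjectProperty.hom_ext
    refine (baseChangeMap α P₂.obj).eq_of_map_eq hI hJ.1 P₁.property f.hom g.hom fun x => ?_
    have h1 : α.baseChange.map f.hom = α.baseChange.map g.hom :=
      congrArg (fun h => (Window.IsNilpotent (maximalIdeal S')).ι.map h) hfg
    rw [← baseChange_map_toLin, ← baseChange_map_toLin, h1]
  · obtain ⟨f, hf⟩ := (baseChangeMap α P₁.obj).exists_hom (baseChangeMap α P₂.obj) hI H.exists_lift
      hJ.1 hcl P₁.property ψ.hom
    refine ⟨ObjectProperty.homMk f, ?_⟩
    apply ObjectProperty.hom_ext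
    refine Window.Hom.ext (LinearMap.ext_on_range (baseChangeMap α P₁.obj).span_j fun x => ?_)
    rw [hf]
    exact baseChange_map_toLin α f x
  · obtain ⟨M, hM, ⟨e⟩⟩ := exists_baseChange_iso H hα hJ'.1 P'.obj P'.property
    exact ⟨⟨M, hM⟩, ⟨ObjectProperty.isoMk _ e⟩⟩

/-! ### Verification of the criterion for `ϰ` -/

namespace MainDatum

variable {p : ℕ} [hp : Fact p.Prime] {C R : Type u} [CommRing C] [IsDomain C]
  [IsDiscreteValuationRing C] [IsPRing p C] [CommRing R] [IsLocalRing R] {r : ℕ}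
  (D : MainDatum p C R r)

theorem isAdicComplete (p : ℕ) (C : Type u) [CommRing C] [IsDomain C] [IsDiscreteValuationRing C]
    [IsPRing p C] (r : ℕ) :
    IsAdicComplete (maximalIdeal (MvPowerSeries (Fin r) C)) (MvPowerSeries (Fin r) C) :=
  haveI := IsPRing.isAdicComplete (p := p) (C := C)
  isAdicComplete_mvPowerSeries (IsPRing.maximalIdeal_eq (p := p) (C := C))

theorem π_mem_maximalIdeal {a : MvPowerSeries (Fin r) C}
    (ha : a ∈ maximalIdeal (MvPowerSeries (Fin r) C)) : D.π a ∈ maximalIdeal R := by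
  have := IsLocalHom.of_surjective D.π D.π_surjective
  rw [mem_maximalIdeal, mem_nonunits_iff] at ha ⊢
  exact fun h => ha (isUnit_of_map_unit D.π a h)

variable [CharP (ResidueField R) p]

theorem mem_maximalIdeal_wittVector {w : WittVector p R} :
    w ∈ maximalIdeal (WittVector p R) ↔ w.coeff 0 ∈ maximalIdeal R := by
  rw [mem_maximalIdeal, mem_maximalIdeal, mem_nonunits_iff, mem_nonunits_iff, isUnit_wittVector_iff]

theorem exists_sub_kappa_mem (w : WittVector p R) :
    ∃ a, w - D.kappaRingHom a ∈ (wittFrame p R).I := by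
  obtain ⟨a, ha⟩ := D.π_surjective (w.coeff 0)
  refine ⟨a, ?_⟩
  change WittVector.constantCoeff _ = 0
  rw [map_sub, WittVector.constantCoeff_apply, WittVector.constantCoeff_apply, kappa_coeff_zero, ha,
    sub_self]

theorem mem_of_kappa_mem (a : MvPowerSeries (Fin r) C)
    (ha : D.kappaRingHom a ∈ (wittFrame p R).I) : a ∈ D.frame.I := by
  have h : WittVector.constantCoeff (D.kappaRingHom a) = 0 := ha
  rw [WittVector.constantCoeff_apply, kappa_coeff_zero] at h
  exact D.ker_π.le h

theorem exists_kappa_pow_mem_wittFil (i : ℕ) :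
    ∃ q, ∀ a ∈ maximalIdeal (MvPowerSeries (Fin r) C) ^ q, D.kappaRingHom a ∈ wittFil p R i :=
  exists_map_pow_mem_wittFil (natCast_mem_maximalIdeal p R) _ (IsNoetherian.noetherian _) _
    (fun a ha => by rw [kappa_coeff_zero]; exact D.π_mem_maximalIdeal ha) i

variable [IsAdicComplete (maximalIdeal R) R]

/-- The image of `ϰ` is closed. -/
theorem mem_range_kappa (w : WittVector p R)
    (hw : ∀ n, ∃ a, w - D.kappaRingHom a ∈
      (maximalIdeal (MvPowerSeries (Fin r) C) ^ n).map D.kappaRingHom) :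
    w ∈ D.kappaRingHom.range := by
  have := isAdicComplete p C r
  have h1 : ∀ i, ∃ a, w - D.kappaRingHom a ∈ wittFil p R i := by
    intro i
    obtain ⟨q, hq⟩ := D.exists_kappa_pow_mem_wittFil i
    obtain ⟨a, ha⟩ := hw q
    exact ⟨a, Ideal.map_le_iff_le_comap.2 hq ha⟩
  choose a ha using h1
  -- The approximations `a i` define nested cosets of the inverse images of the filtration. A common
  -- point exists up to a power of `𝔪`, and by continuity of `ϰ` a high power lies in the inverse
  -- image anyway.
  obtain ⟨t, ht⟩ := exists_sub_mem_sup_pow (fun i => (wittFil p R i).comap D.kappaRingHom)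
    (fun i j hij => Ideal.comap_mono (wittFil_antitone hij)) a (fun n m hnm => by
      rw [Ideal.mem_comap, map_sub, ← sub_sub_sub_cancel_left _ _ w]
      exact Ideal.sub_mem _ (ha n) (wittFil_antitone hnm (ha m)))
  refine ⟨t, (sub_eq_zero.1 (eq_zero_of_mem_wittFil fun i => ?_)).symm⟩
  obtain ⟨q, hq⟩ := D.exists_kappa_pow_mem_wittFil i
  have h2 : D.kappaRingHom (t - a i) ∈ wittFil p R i :=
    (sup_le le_rfl hq : (wittFil p R i).comap D.kappaRingHom ⊔ _ ≤ _) (ht i q)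
  rw [map_sub] at h2
  rw [← sub_sub_sub_cancel_right _ _ (D.kappaRingHom (a i))]
  exact Ideal.sub_mem _ (ha i) h2

theorem normalized_eq {x : WittVector p R} (hx : x ∈ (wittFrame p R).I) :
    D.kappa.normalized x = (Units.val D.kappa.u⁻¹) * x.shift 1 :=
  dif_pos hx

theorem descentData : DescentData D.frame.σ D.frame.theta D.kappa.toRingHom (wittFrame p R).σ
    (wittFrame p R).I D.kappa.normalized (wittFil p R) where
  map_σ := D.kappa.map_σ
  σ_mem := D.frame.isIdealOfDefinition_maximalIdeal.1
  θ_mem := D.frame.isIdealOfDefinition_maximalIdeal.2.2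
  g_add x hx y hy := by
    rw [FrameHom.normalized, FrameHom.normalized, FrameHom.normalized, dif_pos hx, dif_pos hy,
      dif_pos (Ideal.add_mem _ hx hy), ← mul_add, ← map_add]
    rfl
  g_mul w x hx := by
    rw [FrameHom.normalized, FrameHom.normalized, dif_pos hx, dif_pos (Ideal.mul_mem_left _ w hx),
      mul_left_comm, ← smul_eq_mul ((wittFrame p R).σ w), ← (wittFrame p R).σ₁.map_smulₛₗ]
    rfl
  f_eq x hx := by
    rw [FrameHom.normalized, dif_pos hx, FrameHom.map_theta, (wittFrame p R).sigma_eq_theta ⟨x, hx⟩]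
    linear_combination (-(wittFrame p R).theta * (wittFrame p R).σ₁ ⟨x, hx⟩) * D.kappa.u.mul_inv
  exists_lift := D.exists_sub_kappa_mem
  g_mem i x hx hxi := by
    rw [D.normalized_eq hx]
    exact Ideal.mul_mem_left _ _ (shift_mem_wittFil hxi)
  κ_mem := D.exists_kappa_pow_mem_wittFil
  antitone := wittFil_antitone
  separated _ := eq_zero_of_mem_wittFil
  complete := exists_limit_wittFil
  -- Closedness of `I_R` is separatedness of `R`: the zeroth component of `w` lies in every power of
  -- the maximal ideal.
  closed w hw := by
    change w.coeff 0 = 0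
    refine IsHausdorff.haus (I := maximalIdeal R) inferInstance _ fun n => ?_
    rw [SModEq.sub_mem, smul_eq_mul, Ideal.mul_top, sub_zero]
    obtain ⟨x, hx, hwx⟩ := hw (n + 1)
    have hx' : x.coeff 0 = 0 := hx
    have h1 := sub_mem_wittFil_iff.1 hwx 0 n.succ_pos
    rw [hx', sub_zero] at h1
    exact Ideal.pow_le_pow_right n.le_succ h1

theorem isNilCrystalline_kappa : D.kappa.IsNilCrystalline
    (maximalIdeal (MvPowerSeries (Fin r) C)) (maximalIdeal (WittVector p R)) :=
  haveI := isAdicComplete p C r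
  D.kappa.isNilCrystalline_maximalIdeal D.descentData
    (fun a ha => mem_maximalIdeal_wittVector.2 (by
      rw [show (D.kappa.toRingHom a).coeff 0 = D.π a from D.kappa_coeff_zero a]
      exact D.π_mem_maximalIdeal ha))
    D.mem_of_kappa_mem D.mem_range_kappa

end MainDatum

end WindowTheory

theorem mainTheorem11 (p : ℕ) [Fact p.Prime] (C R : Type u)
    [CommRing C] [IsDomain C] [IsDiscreteValuationRing C] [WindowTheory.IsPRing p C]
    [CommRing R] [IsRegularLocalRing R] [IsAdicComplete (IsLocalRing.maximalIdeal R) R]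
    [CharP (IsLocalRing.ResidueField R) p]
    (r : ℕ) (D : WindowTheory.MainDatum p C R r) :
    D.kappa.IsNilCrystalline
      (IsLocalRing.maximalIdeal (MvPowerSeries (Fin r) C))
      (IsLocalRing.maximalIdeal (WittVector p R)) := by
  exact D.isNilCrystalline_kappa
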